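/- Let $M\ge 2$ and $H\ge 2$ be integers and write $\tilde p(x\mid\theta)=\binom Mx\theta^x(1-\theta)^{M-x}$ for $x=0,\dots,M$. Consider the mixture model $$p(x\mid\theta,\tau)=\sum_{i=1}^{H-1}\tau_i\,\tilde p(x\mid\theta_i)+\Bigl(1-\sum_{i=1}^{H-1}\tau_i\Bigr)\tilde p(x\mid\theta_H),$$ with parameter space $\Theta=\{(\theta,\tau)\in[0,1]^H\times[0,1]^{H-1}:\sum_i\tau_i\le 1\}$. Let the true distribution be $q(x)=\sum_{j=1}^{H_0}w_j\,\tilde p(x\mid t_j)$ with $w_j>0$, $\sum_j w_j=1$ and distinct $t_j\in[0,1]$, where $1\le H_0\le\min\{H,M/2\}$, and assume $q(x)>0$ for all $x=0,\dots,M$ (equivalently, some $t_j$ lies in $(0,1)$). Let $\Theta_*=\{(\theta,\tau)\in\Theta: p(\cdot\mid\theta,\tau)=q\}$ and $K(\theta,\tau)=\sum_x q(x)\log\frac{q(x)}{p(x\mid\theta,\tau)}$, which is real analytic in a neighbourhood of $\Theta_*$ in $\mathbb R^{2H-1}$. For a zero $P$ of $K$, take a resolution of singularities $g:U\to W$ of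 $K$ on an open neighbourhood $W$ of $P$ in $\mathbb R^{2H-1}$: $U$ is a real analytic manifold, $g$ is proper and analytic and is an analytic isomorphism over $\{K\ne0\}$, and around each $Q\in U$ with $K(g(Q))=0$ there are analytic coordinates $u$ centred at $Q$ in which $K(g(u))=a(u)\prod_i u_i^{k_i}$ and $|g'(u)|=|b(u)\prod_i u_i^{h_i}|$ with $a,b$ analytic and $a(0),b(0)\neq0$. The real log canonical threshold $\lambda_P$ of $K$ at $P$ is the infimum of $(h_i+1)/k_i$ (equal to $\infty$ if $k_i=0$) over all $i$ and all $Q\in g^{-1}(P)$, and its multiplicity is the largest number, over $Q\in g^{-1}(P)$, of indices $i$ with $(h_i+1)/k_i=\lambda_P$; both are independent of the resolution. The learning coefficient is $\lambda=\inf_{P\in\Theta_*}\lambda_P$. Then $$\lambda\le\frac{3H_0+H-2}{4}.$$ More precisely, there are points $P=(\theta,\tau)$ with $\theta_i=t_i$ for $i<H_0$, $\theta_i=t_{H_0}$ for $H_0\le i\le H$, $\tau_i=w_i$ for $i<H_0$, all $\tau_i>0$ and $\sum_{i=1}^{H-1}\tau_i<1$. Every such $P$ belongs to $\Theta_*$;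 the solutions of $p(\cdot\mid\theta',\tau')=q$ near $P$ in $\mathbb R^{2H-1}$ are exactly the points near $P$ with $\theta'=\theta$ and $\tau'_i=\tau_i$ for $i<H_0$ (a non-singular set of codimension $H+H_0-1$); resolutions of $K$ at $P$ exist, and every one of them gives $\lambda_P=\frac{3H_0+H-2}{4}$ with multiplicity $1$. -/

import Mathlib

open scoped Manifold ContDiff ENNReal Topology

/-! ### Real log canonical thresholds via resolution of singularities -/

/-- A resolution of singularities of the real function `F` at a zero `P` of `F`: an open
neighbourhood `W` of `P` on which `F` is real analytic, a (Hausdorff) real analytic manifold `U`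
and a proper real analytic map `g : U → W` which is an analytic isomorphism away from the zero set
of `F`, and such that around every point `Q` of `U` lying over a zero of `F` there are analytic
coordinates, centred at `Q`, in which `F ∘ g` and the Jacobian determinant of `g` are monomials
with exponents `k Q` and `h Q`, up to nowhere vanishing analytic factors. -/
structure Resolution {ι : Type} [Fintype ι] (F : (ι → ℝ) → ℝ) (P : ι → ℝ) : Type 1 where
  zero : F P = 0
  W : Set (ι → ℝ)
  isOpen_W : IsOpen W
  mem_W : P ∈ W
  analytic_F : AnalyticOnNhd ℝ F W
  U : Type
  [topology : TopologicalSpace U]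
  [t2 : T2Space U]
  [charted : ChartedSpace (ι → ℝ) U]
  [manifold : IsManifold 𝓘(ℝ, ι → ℝ) ω U]
  g : U → ι → ℝ
  g_mem : ∀ u, g u ∈ W
  proper_g : IsProperMap (Set.codRestrict g W g_mem)
  analytic_g : ContMDiff 𝓘(ℝ, ι → ℝ) 𝓘(ℝ, ι → ℝ) ω g
  -- the analytic inverse of `g` outside the zero sets
  ginv : (ι → ℝ) → U
  analytic_ginv : ContMDiffOn 𝓘(ℝ, ι → ℝ) 𝓘(ℝ, ι → ℝ) ω ginv {x | x ∈ W ∧ F x ≠ 0}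
  ginv_g : ∀ u, F (g u) ≠ 0 → ginv (g u) = u
  g_ginv : ∀ x ∈ W, F x ≠ 0 → g (ginv x) = x
  -- local coordinates `coord Q`, exponents `k Q`, `h Q` and units `a Q`, `b Q`
  coord : U → OpenPartialHomeomorph U (ι → ℝ)
  k : U → ι → ℕ
  h : U → ι → ℕ
  a : U → (ι → ℝ) → ℝ
  b : U → (ι → ℝ) → ℝ
  coord_mem : ∀ Q, F (g Q) = 0 → coord Q ∈ IsManifold.maximalAtlas 𝓘(ℝ, ι → ℝ) ω U
  mem_source : ∀ Q, F (g Q) = 0 → Q ∈ (coord Q).source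
  coord_self : ∀ Q, F (g Q) = 0 → coord Q Q = 0
  analytic_a : ∀ Q, F (g Q) = 0 → AnalyticAt ℝ (a Q) 0
  analytic_b : ∀ Q, F (g Q) = 0 → AnalyticAt ℝ (b Q) 0
  a_ne_zero : ∀ Q, F (g Q) = 0 → a Q 0 ≠ 0
  b_ne_zero : ∀ Q, F (g Q) = 0 → b Q 0 ≠ 0
  normal_crossing : ∀ Q, F (g Q) = 0 →
    ∀ᶠ u in 𝓝 (0 : ι → ℝ), F (g ((coord Q).symm u)) = a Q u * ∏ i, u i ^ k Q i
  jacobian : ∀ Q, F (g Q) = 0 →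
    ∀ᶠ u in 𝓝 (0 : ι → ℝ),
      |(fderiv ℝ (fun v => g ((coord Q).symm v)) u).det| = |b Q u * ∏ i, u i ^ h Q i|

namespace Resolution

variable {ι : Type} [Fintype ι] {F : (ι → ℝ) → ℝ} {P : ι → ℝ}

/-- The ratio `(h_i + 1) / k_i` at the point `Q`; it is `∞` when `k_i = 0`. -/
noncomputable def ratio (R : Resolution F P) (Q : R.U) (i : ι) : ℝ≥0∞ :=
  ((R.h Q i : ℝ≥0∞) + 1) / (R.k Q i : ℝ≥0∞)

/-- The infimum of the ratios `(h_i + 1) / k_i` over the points `Q` of the fibre over `P`. (The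
fibre over `P`, rather than the whole of `g⁻¹ (F⁻¹ 0)`, makes the value local at `P`; the two agree
when `W` is a small enough neighbourhood of `P`.) -/
noncomputable def threshold (R : Resolution F P) : ℝ≥0∞ :=
  ⨅ Q : R.U, ⨅ _ : R.g Q = P, ⨅ i : ι, R.ratio Q i

open Classical in
/-- The largest number of indices `i` for which `(h_i + 1) / k_i` equals the threshold, over the
points `Q` of the fibre over `P`. -/
noncomputable def multiplicity (R : Resolution F P) : ℕ∞ :=
  ⨆ Q : R.U, ⨆ _ : R.g Q = P,
    ((Finset.univ.filter fun i : ι => R.ratio Q i = R.threshold).card : ℕ∞)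

end Resolution

/-- `F` has real log canonical threshold `lam` with multiplicity `m` at its zero `P`: resolutions
of `F` at `P` exist, and each of them computes the threshold `lam` and the multiplicity `m`. -/
def HasRLCTAt {ι : Type} [Fintype ι] (F : (ι → ℝ) → ℝ) (P : ι → ℝ) (lam : ℝ≥0∞) (m : ℕ∞) : Prop :=
  Nonempty (Resolution F P) ∧
    ∀ R : Resolution F P, R.threshold = lam ∧ R.multiplicity = m

/-- The real log canonical threshold of `F` at `P`. All resolutions give the same threshold, so
the infimum over the resolutions is this common value. -/
noncomputable def rlctAt {ι : Type} [Fintype ι] (F : (ι → ℝ) → ℝ) (P : ι → ℝ) : ℝ≥0∞ :=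
  ⨅ R : Resolution F P, R.threshold

/-- The real log canonical threshold of `F` on a set `C` of zeros of `F`. -/
noncomputable def rlctOn {ι : Type} [Fintype ι] (F : (ι → ℝ) → ℝ) (C : Set (ι → ℝ)) : ℝ≥0∞ :=
  ⨅ P ∈ C, rlctAt F P

/-! ### Binomial mixtures -/

/-- The probability of `x` under the binomial distribution `Bin(M, t)`. -/
noncomputable def binomialProb (M : ℕ) (x : Fin (M + 1)) (t : ℝ) : ℝ :=
  (M.choose x : ℝ) * t ^ (x : ℕ) * (1 - t) ^ (M - (x : ℕ))

/-- The parameters `(θ_1, …, θ_H, τ_1, …, τ_{H-1})` of the mixture of `H` components: `θ` sits in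
the left summand of the index type, `τ` in the right one. -/
abbrev MixParam (H : ℕ) : Type := Fin H ⊕ Fin (H - 1) → ℝ

/-- The mixing proportions: `τ_i` for the first `H - 1` components, and `1 - ∑ τ_i` for the last
one. -/
noncomputable def mixWeight {H : ℕ} (v : MixParam H) (i : Fin H) : ℝ :=
  if hi : (i : ℕ) < H - 1 then v (Sum.inr ⟨i, hi⟩) else 1 - ∑ j : Fin (H - 1), v (Sum.inr j)

/-- The statistical model `p(x | θ, τ)`: the mixture of `H` binomial distributions. -/
noncomputable def mixModel (M H : ℕ) (x : Fin (M + 1)) (v : MixParam H) : ℝ :=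
  ∑ i : Fin H, mixWeight v i * binomialProb M x (v (Sum.inl i))

/-- The parameter space: all `θ_i` and `τ_i` in `[0, 1]`, with `∑ τ_i ≤ 1`. -/
def mixParamSpace (H : ℕ) : Set (MixParam H) :=
  {v | (∀ i, v i ∈ Set.Icc (0 : ℝ) 1) ∧ ∑ j : Fin (H - 1), v (Sum.inr j) ≤ 1}

/-- The realizable parameters `Θ_*` for the true distribution `q`. -/
def realizable (M H : ℕ) (q : Fin (M + 1) → ℝ) : Set (MixParam H) :=
  {v | v ∈ mixParamSpace H ∧ ∀ x, mixModel M H x v = q x}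

/-- The Kullback-Leibler divergence `K(θ, τ) = E_q[log (q(X) / p(X | θ, τ))]`. It is used only
close to realizable parameters, for a `q` without zeros, where all the `p(x | θ, τ)` are positive
(and sum to one), also for parameters outside the parameter space. -/
noncomputable def klMix (M H : ℕ) (q : Fin (M + 1) → ℝ) (v : MixParam H) : ℝ :=
  ∑ x, q x * Real.log (q x / mixModel M H x v)

/-- The learning coefficient of the binomial mixture model: the real log canonical threshold of
the Kullback-Leibler divergence on the set of realizable parameters. -/
noncomputable def learningCoefficient (M H : ℕ) (q : Fin (M + 1) → ℝ) : ℝ≥0∞ :=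
  rlctOn (klMix M H q) (realizable M H q)

/-- The parameters of the `H`-component model that keep the first `H0 - 1` components
`(w_j, t_j)` of the true distribution as they are and split its last component into
`H - H0 + 1` components at the same location `t_{H0}`, where all the mixing proportions
`τ_i` and `1 - ∑ τ_i` are positive. (Indices start at `0` in the code.) -/
def IsSplitPoint {H H0 : ℕ} (w t : Fin H0 → ℝ) (v : MixParam H) : Prop :=
  (∀ (i : Fin H) (j : Fin H0), (j : ℕ) = min (i : ℕ) (H0 - 1) → v (Sum.inl i) = t j) ∧
  (∀ (i : Fin (H - 1)) (j : Fin H0), (j : ℕ) = (i : ℕ) → (i : ℕ) < H0 - 1 →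
    v (Sum.inr i) = w j) ∧
  (∀ i : Fin (H - 1), 0 < v (Sum.inr i)) ∧
  ∑ i : Fin (H - 1), v (Sum.inr i) < 1

-- Near a split point the components form clusters, one around each t_j, and all clusters but the
-- last are singletons. A second order Taylor expansion at the t_j (`exists_mixDiff_eq`) writes p -
-- q as a combination of the excess masses of the clusters, their first moments, and the squared
-- displacements θ_i - t_j. The masses sum to zero, so H0 - 1 of them together with the H0 moments
-- give 2 * H0 - 1 functions z. The last cluster contributes H - H0 further displacements y, and the
-- remaining H - H0 weights are free. After a shear of Jacobian one (`unimodularCoords`), z and y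
-- are coordinates up to nonvanishing factors, and every p(x) - q(x) lies in the ideal generated by
-- the z_i and the y_j y_k (`mixDiff_inQuadIdeal`).
--
-- Conversely, each z_i and each y_j² is O(∑ |p - q|) (`linCoord_isBigO`, `sqCoord_isBigO`). Indeed
-- p - q determines the integrals of all polynomials of degree at most M against the difference of
-- the two mixing measures, and 2 * H0 ≤ M leaves room for test polynomials with double zeros at the
-- t_k. The nonnegative polynomial ∏ (X - t_k)² controls the squared displacements, because the
-- weights are positive and nothing cancels (`sq_isBigO`). Omitting one double zero then isolates
-- the mass and the moment of a single cluster.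
--
-- Since K is comparable to ∑ (p - q)², it is bounded below by a multiple of ∑ z_i² + ∑ y_j⁴ and is
-- O(s⁴) where |z_i| ≤ s² and |y_j| ≤ s. Hence the set 0 < |K| ≤ ε near P has volume of exact order
-- ε ^ λ, where λ = (2 #z + #y) / 4 = (3 * H0 + H - 2) / 4.
--
-- Volumes do not depend on a resolution, and `threshold_eq_and_multiplicity_eq` shows that this
-- growth, without a logarithm, forces threshold λ and multiplicity 1 in every resolution. What
-- remains is that a resolution exists (`nonempty_resolution`): blow up z = y = 0, then the strict
-- transform of z = 0 in the exceptional divisor. This makes the ideal principal and monomial, and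
-- the lower bound on K shows that the cofactor does not vanish. The bound on the learning
-- coefficient follows, as it is an infimum over realizable points.

attribute [instance] Resolution.topology Resolution.t2 Resolution.charted Resolution.manifold

/-! ### Volumes of images of small boxes in resolution coordinates -/

namespace Resolution

open MeasureTheory

variable {ι : Type} [Fintype ι] {F : (ι → ℝ) → ℝ} {P : ι → ℝ}

/-- The map `g` read in the local coordinates at `Q`. -/
noncomputable def local_g (R : Resolution F P) (Q : R.U) (v : ι → ℝ) : ι → ℝ :=
  R.g ((R.coord Q).symm v)

/-- Uniform control of a resolution on a small cube around a point `Q` of the fibre over `P`. -/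
structure IsGoodCube (R : Resolution F P) (Q : R.U) (B : Set (ι → ℝ))
    (δ a₀ a₁ b₀ b₁ : ℝ) : Prop where
  δ_pos : 0 < δ
  δ_le : δ ≤ 1
  a₀_pos : 0 < a₀
  a₁_pos : 0 < a₁
  b₀_pos : 0 < b₀
  b₁_pos : 0 < b₁
  target : ∀ u ∈ Metric.ball (0 : ι → ℝ) δ, u ∈ (R.coord Q).target
  mem_B : ∀ u ∈ Metric.ball (0 : ι → ℝ) δ, R.local_g Q u ∈ B
  diff : ∀ u ∈ Metric.ball (0 : ι → ℝ) δ, DifferentiableAt ℝ (R.local_g Q) u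
  crossing_lower : ∀ u ∈ Metric.ball (0 : ι → ℝ) δ,
    a₀ * ∏ i, |u i| ^ R.k Q i ≤ |F (R.local_g Q u)|
  crossing_upper : ∀ u ∈ Metric.ball (0 : ι → ℝ) δ,
    |F (R.local_g Q u)| ≤ a₁ * ∏ i, |u i| ^ R.k Q i
  jacobian_lower : ∀ u ∈ Metric.ball (0 : ι → ℝ) δ,
    b₀ * ∏ i, |u i| ^ R.h Q i ≤ |(fderiv ℝ (R.local_g Q) u).det|
  jacobian_upper : ∀ u ∈ Metric.ball (0 : ι → ℝ) δ,
    |(fderiv ℝ (R.local_g Q) u).det| ≤ b₁ * ∏ i, |u i| ^ R.h Q i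

theorem symm_coord_zero (R : Resolution F P) {Q : R.U} (hQ : R.g Q = P) :
    (R.coord Q).symm 0 = Q := by
  have h0 : F (R.g Q) = 0 := by rw [hQ, R.zero]
  rw [← R.coord_self Q h0, (R.coord Q).left_inv (R.mem_source Q h0)]

theorem zero_mem_target (R : Resolution F P) {Q : R.U} (hQ : R.g Q = P) :
    (0 : ι → ℝ) ∈ (R.coord Q).target := by
  have h0 : F (R.g Q) = 0 := by rw [hQ, R.zero]
  rw [← R.coord_self Q h0]
  exact (R.coord Q).map_source (R.mem_source Q h0)

theorem contDiffOn_local_g (R : Resolution F P) {Q : R.U} (hQ : R.g Q = P) :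
    ContDiffOn ℝ ω (R.local_g Q) (R.coord Q).target := by
  have h0 : F (R.g Q) = 0 := by rw [hQ, R.zero]
  rw [← contMDiffOn_iff_contDiffOn]
  exact R.analytic_g.comp_contMDiffOn
    (contMDiffOn_symm_of_mem_maximalAtlas (R.coord_mem Q h0))

theorem eventually_abs_bounds {f : (ι → ℝ) → ℝ} (hf : AnalyticAt ℝ f 0) (h0 : f 0 ≠ 0) :
    ∀ᶠ u in 𝓝 (0 : ι → ℝ), |f 0| / 2 ≤ |f u| ∧ |f u| ≤ 2 * |f 0| := by
  have hc := hf.continuousAt.abs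
  have hp : 0 < |f 0| := abs_pos.2 h0
  filter_upwards [hc.eventually (Ioi_mem_nhds (show |f 0| / 2 < |f 0| by linarith)),
    hc.eventually (Iio_mem_nhds (show |f 0| < 2 * |f 0| by linarith))] with u h1 h2
  exact ⟨le_of_lt h1, le_of_lt h2⟩

theorem exists_isGoodCube (R : Resolution F P) {Q : R.U} (hQ : R.g Q = P)
    {B : Set (ι → ℝ)} (hB : B ∈ 𝓝 P) :
    ∃ δ a₀ a₁ b₀ b₁ : ℝ, R.IsGoodCube Q B δ a₀ a₁ b₀ b₁ := by
  have h0 : F (R.g Q) = 0 := by rw [hQ, R.zero]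
  have htar : (R.coord Q).target ∈ 𝓝 (0 : ι → ℝ) :=
    (R.coord Q).open_target.mem_nhds (R.zero_mem_target hQ)
  have hcd := R.contDiffOn_local_g hQ
  have hcont : ContinuousAt (R.local_g Q) 0 := hcd.continuousOn.continuousAt htar
  have hg0 : R.local_g Q 0 = P := by rw [local_g, R.symm_coord_zero hQ, hQ]
  have hB' : ∀ᶠ u in 𝓝 (0 : ι → ℝ), R.local_g Q u ∈ B := hcont (by rwa [hg0])
  have htar' : ∀ᶠ u in 𝓝 (0 : ι → ℝ), u ∈ (R.coord Q).target := htar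
  have hall := htar'.and (hB'.and ((R.normal_crossing Q h0).and ((R.jacobian Q h0).and
    ((eventually_abs_bounds (R.analytic_a Q h0) (R.a_ne_zero Q h0)).and
      (eventually_abs_bounds (R.analytic_b Q h0) (R.b_ne_zero Q h0))))))
  obtain ⟨δ', hδ', hball⟩ := Metric.eventually_nhds_iff_ball.1 hall
  have ha := abs_pos.2 (R.a_ne_zero Q h0)
  have hb := abs_pos.2 (R.b_ne_zero Q h0)
  have hsub : ∀ u ∈ Metric.ball (0 : ι → ℝ) (min δ' 1), u ∈ Metric.ball (0 : ι → ℝ) δ' :=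
    fun u hu => Metric.ball_subset_ball (min_le_left _ _) hu
  have hpr : ∀ (u : ι → ℝ) (n : ι → ℕ), 0 ≤ ∏ i, |u i| ^ n i :=
    fun u n => Finset.prod_nonneg fun i _ => by positivity
  refine ⟨min δ' 1, |R.a Q 0| / 2, 2 * |R.a Q 0|, |R.b Q 0| / 2, 2 * |R.b Q 0|,
    { δ_pos := lt_min hδ' one_pos, δ_le := min_le_right _ _
      a₀_pos := by positivity
      a₁_pos := by positivity
      b₀_pos := by positivity
      b₁_pos := by positivity
      target := fun u hu => (hball u (hsub u hu)).1
      mem_B := fun u hu => (hball u (hsub u hu)).2.1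
      diff := fun u hu => ?_
      crossing_lower := fun u hu => ?_
      crossing_upper := fun u hu => ?_
      jacobian_lower := fun u hu => ?_
      jacobian_upper := fun u hu => ?_ }⟩
  · exact (hcd.contDiffAt ((R.coord Q).open_target.mem_nhds
      (hball u (hsub u hu)).1)).differentiableAt (by simp)
  · obtain ⟨-, -, h1, -, h2, -⟩ := hball u (hsub u hu)
    rw [local_g, h1, abs_mul, Finset.abs_prod]
    simp only [abs_pow]
    exact mul_le_mul_of_nonneg_right h2.1 (hpr _ _)
  · obtain ⟨-, -, h1, -, h2, -⟩ := hball u (hsub u hu)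
    rw [local_g, h1, abs_mul, Finset.abs_prod]
    simp only [abs_pow]
    exact mul_le_mul_of_nonneg_right h2.2 (hpr _ _)
  · obtain ⟨-, -, -, h1, -, h2⟩ := hball u (hsub u hu)
    have h1' : |(fderiv ℝ (R.local_g Q) u).det| = |R.b Q u * ∏ i, u i ^ R.h Q i| := h1
    rw [h1', abs_mul, Finset.abs_prod]
    simp only [abs_pow]
    exact mul_le_mul_of_nonneg_right h2.1 (hpr _ _)
  · obtain ⟨-, -, -, h1, -, h2⟩ := hball u (hsub u hu)
    have h1' : |(fderiv ℝ (R.local_g Q) u).det| = |R.b Q u * ∏ i, u i ^ R.h Q i| := h1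
    rw [h1', abs_mul, Finset.abs_prod]
    simp only [abs_pow]
    exact mul_le_mul_of_nonneg_right h2.2 (hpr _ _)

/-- Off the zero set of F the map g has the left inverse `ginv`, and the chart is injective. -/
theorem injOn_local_g (R : Resolution F P) (Q : R.U) {S : Set (ι → ℝ)}
    (hS : S ⊆ (R.coord Q).target) (hF : ∀ u ∈ S, F (R.local_g Q u) ≠ 0) :
    Set.InjOn (R.local_g Q) S := by
  intro u hu v hv huv
  have h1 := R.ginv_g _ (hF u hu)
  have h2 := R.ginv_g _ (hF v hv)
  rw [local_g] at huv
  rw [huv] at h1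
  exact (R.coord Q).symm.injOn (hS hu) (hS hv) (h1.symm.trans h2)

/-- The open box with sides `(r i / 2, r i)`. -/
def halfBox (r : ι → ℝ) : Set (ι → ℝ) := Set.univ.pi fun i => Set.Ioo (r i / 2) (r i)

theorem measurableSet_halfBox (r : ι → ℝ) : MeasurableSet (halfBox r) :=
  MeasurableSet.univ_pi fun _ => measurableSet_Ioo

theorem volume_halfBox (r : ι → ℝ) (hr : ∀ i, 0 < r i) :
    volume (halfBox r) = ENNReal.ofReal (∏ i, (r i / 2)) := by
  rw [halfBox, Real.volume_pi_Ioo, ENNReal.ofReal_prod_of_nonneg]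
  · exact Finset.prod_congr rfl fun i _ => by congr 1; ring
  · intro i _; exact (half_pos (hr i)).le

/-- On a half box each coordinate is comparable to its side, so the Jacobian bounds the volume of
the image from below and the monomial bounds |F| by ε. Off the zeros g is injective, so the images
of disjoint boxes are disjoint and fit together into one sublevel set. -/
theorem sum_halfBox_le (R : Resolution F P) {Q : R.U} {B : Set (ι → ℝ)}
    {δ a₀ a₁ b₀ b₁ C lam : ℝ} (hG : R.IsGoodCube Q B δ a₀ a₁ b₀ b₁)
    {ε : ℝ} (hC : 0 ≤ C * ε ^ lam)
    (hV : volume {x | x ∈ B ∧ F x ≠ 0 ∧ |F x| ≤ ε} ≤ ENNReal.ofReal (C * ε ^ lam))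
    {κ : Type} (s : Finset κ) (r : κ → ι → ℝ) (hr : ∀ n ∈ s, ∀ i, 0 < r n i)
    (hrδ : ∀ n ∈ s, ∀ i, r n i < δ)
    (hdisj : (s : Set κ).PairwiseDisjoint fun n => halfBox (r n))
    (hε : ∀ n ∈ s, a₁ * ∏ i, r n i ^ R.k Q i ≤ ε) :
    ∑ n ∈ s, b₀ * ∏ i, (r n i / 2) ^ (R.h Q i + 1) ≤ C * ε ^ lam := by
  set S : Set (ι → ℝ) := ⋃ n ∈ s, halfBox (r n) with hS
  have hSm : MeasurableSet S := s.measurableSet_biUnion fun n _ => measurableSet_halfBox _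
  have hpos : ∀ n ∈ s, ∀ u ∈ halfBox (r n), ∀ i, 0 < u i ∧ r n i / 2 < u i ∧ u i < r n i := by
    intro n hn u hu i
    have := hu i (Set.mem_univ i)
    exact ⟨lt_trans (half_pos (hr n hn i)) this.1, this.1, this.2⟩
  have hball : ∀ n ∈ s, ∀ u ∈ halfBox (r n), u ∈ Metric.ball (0 : ι → ℝ) δ := by
    intro n hn u hu
    rw [mem_ball_zero_iff, pi_norm_lt_iff hG.δ_pos]
    intro i
    obtain ⟨h1, h2, h3⟩ := hpos n hn u hu i
    rw [Real.norm_eq_abs, abs_of_pos h1]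
    exact h3.trans (hrδ n hn i)
  have hSball : S ⊆ Metric.ball (0 : ι → ℝ) δ := Set.iUnion₂_subset fun n hn u hu => hball n hn u hu
  have hSF : ∀ u ∈ S, F (R.local_g Q u) ≠ 0 := by
    intro u hu
    obtain ⟨n, hn, hu⟩ := Set.mem_iUnion₂.1 hu
    have h1 := hG.crossing_lower u (hball n hn u hu)
    have : 0 < a₀ * ∏ i, |u i| ^ R.k Q i :=
      mul_pos hG.a₀_pos (Finset.prod_pos fun i _ => pow_pos (abs_pos.2 (hpos n hn u hu i).1.ne') _)
    exact abs_pos.1 (this.trans_le h1)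
  have hinj : Set.InjOn (R.local_g Q) S :=
    R.injOn_local_g Q (fun u hu => hG.target u (hSball hu)) hSF
  have himage : R.local_g Q '' S ⊆ {x | x ∈ B ∧ F x ≠ 0 ∧ |F x| ≤ ε} := by
    rintro _ ⟨u, hu, rfl⟩
    refine ⟨hG.mem_B u (hSball hu), hSF u hu, (hG.crossing_upper u (hSball hu)).trans ?_⟩
    obtain ⟨n, hn, hu⟩ := Set.mem_iUnion₂.1 hu
    refine le_trans (mul_le_mul_of_nonneg_left ?_ hG.a₁_pos.le) (hε n hn)
    refine Finset.prod_le_prod (fun i _ => by positivity) fun i _ => ?_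
    obtain ⟨h1, h2, h3⟩ := hpos n hn u hu i
    rw [abs_of_pos h1]
    exact pow_le_pow_left₀ h1.le h3.le _
  have hint := lintegral_abs_det_fderiv_eq_addHaar_image volume hSm
    (fun u hu => ((hG.diff u (hSball hu)).hasFDerivAt).hasFDerivWithinAt) hinj
  have hle : ∑ n ∈ s, ENNReal.ofReal (b₀ * ∏ i, (r n i / 2) ^ (R.h Q i + 1)) ≤
      ENNReal.ofReal (C * ε ^ lam) := by
    calc ∑ n ∈ s, ENNReal.ofReal (b₀ * ∏ i, (r n i / 2) ^ (R.h Q i + 1))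
        ≤ ∑ n ∈ s, ∫⁻ u in halfBox (r n), ENNReal.ofReal |(fderiv ℝ (R.local_g Q) u).det| := by
          refine Finset.sum_le_sum fun n hn => ?_
          have : ENNReal.ofReal (b₀ * ∏ i, (r n i / 2) ^ (R.h Q i + 1)) =
              ENNReal.ofReal (b₀ * ∏ i, (r n i / 2) ^ (R.h Q i)) * volume (halfBox (r n)) := by
            rw [volume_halfBox _ (hr n hn), ← ENNReal.ofReal_mul, mul_assoc,
              ← Finset.prod_mul_distrib]
            · simp only [pow_succ]
            · exact mul_nonneg hG.b₀_pos.le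
                (Finset.prod_nonneg fun i _ => pow_nonneg (half_pos (hr n hn i)).le _)
          rw [this, ← setLIntegral_const]
          refine setLIntegral_mono' (measurableSet_halfBox _) fun u hu => ?_
          refine ENNReal.ofReal_le_ofReal (le_trans ?_ (hG.jacobian_lower u (hball n hn u hu)))
          refine mul_le_mul_of_nonneg_left ?_ hG.b₀_pos.le
          refine Finset.prod_le_prod (fun i _ => pow_nonneg (half_pos (hr n hn i)).le _)
            fun i _ => ?_
          obtain ⟨h1, h2, h3⟩ := hpos n hn u hu i
          rw [abs_of_pos h1]
          exact pow_le_pow_left₀ (half_pos (hr n hn i)).le h2.le _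
      _ = ∫⁻ u in S, ENNReal.ofReal |(fderiv ℝ (R.local_g Q) u).det| :=
          (lintegral_biUnion_finset hdisj (fun n _ => measurableSet_halfBox _) _).symm
      _ = volume (R.local_g Q '' S) := hint
      _ ≤ _ := (measure_mono himage).trans hV
  rw [← ENNReal.ofReal_sum_of_nonneg] at hle
  · exact (ENNReal.ofReal_le_ofReal_iff hC).1 hle
  · intro n hn
    exact mul_nonneg hG.b₀_pos.le
      (Finset.prod_nonneg fun i _ => pow_nonneg (half_pos (hr n hn i)).le _)

end Resolution

/-! ### Constraints on the exponents from an upper volume bound -/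

namespace Resolution

open MeasureTheory

variable {ι : Type} [Fintype ι] {F : (ι → ℝ) → ℝ} {P : ι → ℝ}

/-- A box of side ρ in direction i and fixed sides otherwise has |F| = O(ρ ^ k_i) and an image of
volume at least a constant times ρ ^ (h_i + 1). If lam * k_i exceeded h_i + 1, the volume bound
would fail as ρ tends to 0. -/
theorem mul_k_le_of_volume_le (R : Resolution F P) {Q : R.U} (hQ : R.g Q = P)
    {B : Set (ι → ℝ)} (hB : B ∈ 𝓝 P) {C lam : ℝ} (hC : 0 < C)
    (hV : ∀ ε : ℝ, 0 < ε →
      volume {x | x ∈ B ∧ F x ≠ 0 ∧ |F x| ≤ ε} ≤ ENNReal.ofReal (C * ε ^ lam)) (i : ι) :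
    lam * R.k Q i ≤ R.h Q i + 1 := by
  classical
  obtain ⟨δ, a₀, a₁, b₀, b₁, hG⟩ := R.exists_isGoodCube hQ hB
  by_contra! hlt
  have hδ := hG.δ_pos
  have ha₁ := hG.a₁_pos
  have hb₀ := hG.b₀_pos
  set d : ℝ := lam * R.k Q i - (R.h Q i + 1) with hd
  have hdpos : 0 < d := by linarith
  set K : ℝ := b₀ * ((1 / 2) ^ (R.h Q i + 1) *
    ∏ l ∈ Finset.univ.erase i, (δ / 2 / 2) ^ (R.h Q l + 1)) with hK
  have hKpos : 0 < K := by positivity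
  have key : ∀ ρ ∈ Set.Ioo 0 (δ / 2), K ≤ C * a₁ ^ lam * ρ ^ d := by
    intro ρ hρ
    have hρ0 : 0 < ρ := hρ.1
    have hε : 0 < a₁ * ρ ^ R.k Q i := by positivity
    have h := R.sum_halfBox_le (ε := a₁ * ρ ^ R.k Q i) (C := C) (lam := lam) hG (by positivity)
      (hV _ hε) ({()} : Finset Unit) (fun _ => Function.update (fun _ => δ / 2) i ρ)
      (fun _ _ l => by
        by_cases hl : l = i
        · subst hl; simpa using hρ0
        · simpa [Function.update_of_ne hl] using hδ)
      (fun _ _ l => by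
        by_cases hl : l = i
        · subst hl; simp only [Function.update_self]; linarith [hρ.2]
        · simp only [Function.update_of_ne hl]; linarith)
      (by simp)
      (fun _ _ => by
        refine mul_le_mul_of_nonneg_left ?_ ha₁.le
        rw [← Finset.mul_prod_erase _ _ (Finset.mem_univ i), Function.update_self]
        refine mul_le_of_le_one_right (by positivity) ?_
        refine Finset.prod_le_one (fun l hl => ?_) fun l hl => ?_
        · rw [Function.update_of_ne (Finset.ne_of_mem_erase hl)]; positivity
        · rw [Function.update_of_ne (Finset.ne_of_mem_erase hl)]
          exact pow_le_one₀ (by positivity) (by linarith [hG.δ_le]))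
    rw [Finset.sum_singleton, ← Finset.mul_prod_erase _ _ (Finset.mem_univ i),
      Function.update_self] at h
    rw [Finset.prod_congr rfl (g := fun l => (δ / 2 / 2) ^ (R.h Q l + 1)) (fun l hl => by
      rw [Function.update_of_ne (Finset.ne_of_mem_erase hl)])] at h
    have h1 : (a₁ * ρ ^ R.k Q i) ^ lam = a₁ ^ lam * (ρ ^ d * ρ ^ (R.h Q i + 1)) := by
      rw [Real.mul_rpow ha₁.le (by positivity), ← Real.rpow_natCast ρ (R.k Q i),
        ← Real.rpow_natCast ρ (R.h Q i + 1), ← Real.rpow_mul hρ0.le, ← Real.rpow_add hρ0]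
      congr 2
      rw [hd]; push_cast; ring
    rw [h1] at h
    have h2 : K * ρ ^ (R.h Q i + 1) ≤ C * a₁ ^ lam * ρ ^ d * ρ ^ (R.h Q i + 1) := by
      calc K * ρ ^ (R.h Q i + 1) = _ := by rw [hK]; ring
        _ ≤ _ := h
        _ = _ := by ring
    exact le_of_mul_le_mul_right h2 (by positivity)
  have hlim : Filter.Tendsto (fun ρ : ℝ => C * a₁ ^ lam * ρ ^ d) (𝓝[>] 0) (𝓝 0) := by
    have h1 : ContinuousAt (fun ρ : ℝ => C * a₁ ^ lam * ρ ^ d) 0 :=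
      continuousAt_const.mul (Real.continuousAt_rpow_const 0 d (Or.inr hdpos.le))
    have h2 := h1.tendsto
    simp only [Real.zero_rpow hdpos.ne', mul_zero] at h2
    exact h2.mono_left nhdsWithin_le_nhds
  have := ge_of_tendsto hlim (Filter.mem_of_superset
    (Ioo_mem_nhdsGT (half_pos hδ)) fun ρ hρ => key ρ hρ)
  linarith

/-- Two critical directions would create a logarithm. Trading size between the coordinates i and j
along a level curve of u_i ^ k_i * u_j ^ k_j produces arbitrarily many disjoint boxes with the same
bound on |F| and the same lower bound on the volume of the image. -/
theorem eq_of_mul_k_eq_of_volume_le (R : Resolution F P) {Q : R.U} (hQ : R.g Q = P)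
    {B : Set (ι → ℝ)} (hB : B ∈ 𝓝 P) {C lam : ℝ} (hC : 0 < C)
    (hV : ∀ ε : ℝ, 0 < ε →
      volume {x | x ∈ B ∧ F x ≠ 0 ∧ |F x| ≤ ε} ≤ ENNReal.ofReal (C * ε ^ lam)) {i j : ι}
    (hi : lam * R.k Q i = R.h Q i + 1) (hj : lam * R.k Q j = R.h Q j + 1) : i = j := by
  classical
  by_contra hij
  obtain ⟨δ, a₀, a₁, b₀, b₁, hG⟩ := R.exists_isGoodCube hQ hB
  have hδ := hG.δ_pos
  have ha₁ := hG.a₁_pos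
  have hb₀ := hG.b₀_pos
  have hki : R.k Q i ≠ 0 := by
    intro h; rw [h] at hi; push_cast at hi
    have : (0 : ℝ) ≤ R.h Q i := Nat.cast_nonneg _
    linarith
  -- This makes the lower bound for the image volume independent of the box: the powers of 2 gained
  -- in direction i cancel those lost in direction j.
  have hnat : R.k Q j * (R.h Q i + 1) = R.k Q i * (R.h Q j + 1) := by
    have : (R.k Q j : ℝ) * (R.h Q i + 1) = R.k Q i * (R.h Q j + 1) := by rw [← hi, ← hj]; ring
    exact_mod_cast this
  have hji : j ∈ Finset.univ.erase i := Finset.mem_erase.2 ⟨Ne.symm hij, Finset.mem_univ _⟩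
  set η : ℝ := δ / 2 with hη
  have hη0 : 0 < η := half_pos hδ
  set K : ℝ := b₀ * ((1 / 2) ^ (R.h Q i + 1) * ((1 / 2) ^ (R.h Q j + 1) *
    ∏ l ∈ (Finset.univ.erase i).erase j, (η / 2) ^ (R.h Q l + 1))) with hK
  have hKpos : 0 < K := by positivity
  have key : ∀ L : ℕ, L * K ≤ C * a₁ ^ lam := by
    intro L
    -- The starting side is small enough for all L boxes with i-sides ρ * 2 ^ (n * k_j), n < L, to
    -- stay within η.
    set ρ : ℝ := η * (1 / 2) ^ (L * R.k Q j) with hρ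
    have hρ0 : 0 < ρ := by positivity
    set r : ℕ → ι → ℝ := fun n l => if l = i then ρ * 2 ^ (n * R.k Q j)
      else if l = j then η * (1 / 2) ^ (n * R.k Q i) else η with hr
    have hri : ∀ n, r n i = ρ * 2 ^ (n * R.k Q j) := fun n => by simp [hr]
    have hrj : ∀ n, r n j = η * (1 / 2) ^ (n * R.k Q i) := fun n => by simp [hr, Ne.symm hij]
    have hrl : ∀ n, ∀ l ∈ (Finset.univ.erase i).erase j, r n l = η := fun n l hl => by
      have h1 := Finset.ne_of_mem_erase hl
      have h2 := Finset.ne_of_mem_erase (Finset.mem_of_mem_erase hl)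
      simp [hr, h1, h2]
    have hrpos : ∀ n l, 0 < r n l := by
      intro n l
      simp only [hr]
      split_ifs <;> positivity
    have hrη : ∀ n < L, ∀ l, r n l ≤ η := by
      intro n hn l
      simp only [hr]
      split_ifs
      · rw [hρ, mul_assoc]
        refine mul_le_of_le_one_right hη0.le ?_
        rw [one_div, inv_pow, inv_mul_le_iff₀ (by positivity), mul_one]
        exact pow_le_pow_right₀ (by norm_num) (Nat.mul_le_mul_right _ hn.le)
      · exact mul_le_of_le_one_right hη0.le (pow_le_one₀ (by norm_num) (by norm_num))
      · exact le_rfl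
    have hcancel : ∀ a : ℕ, (2 : ℝ) ^ a * (1 / 2) ^ a = 1 := fun a => by
      rw [← mul_pow]; norm_num
    have hε : 0 < a₁ * (ρ ^ R.k Q i * η ^ R.k Q j) := by positivity
    have h := R.sum_halfBox_le (ε := a₁ * (ρ ^ R.k Q i * η ^ R.k Q j)) (C := C) (lam := lam) hG
      (by positivity) (hV _ hε) (Finset.range L) r (fun n _ l => hrpos n l)
      (fun n hn l => (hrη n (Finset.mem_range.1 hn) l).trans_lt (by linarith))
      (by
        have hlt : ∀ n m : ℕ, n < m → Disjoint (halfBox (r n)) (halfBox (r m)) := by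
          intro n m hnm
          rw [Set.disjoint_left]
          intro x hx hx'
          have h1 := (hx j (Set.mem_univ j)).1
          have h2 := (hx' j (Set.mem_univ j)).2
          -- Since k_i ≥ 1, each step at least halves the side in direction j; this separates the
          -- half boxes.
          have h3 : r m j ≤ r n j / 2 := by
            rw [hrj, hrj, mul_div_assoc]
            refine mul_le_mul_of_nonneg_left ?_ hη0.le
            have : n * R.k Q i + 1 ≤ m * R.k Q i := by
              have := Nat.mul_le_mul_right (R.k Q i) (Nat.succ_le_of_lt hnm)
              have h1 : 1 ≤ R.k Q i := Nat.one_le_iff_ne_zero.2 hki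
              rw [Nat.succ_mul] at this
              omega
            calc (1 / 2 : ℝ) ^ (m * R.k Q i) ≤ (1 / 2) ^ (n * R.k Q i + 1) :=
                  pow_le_pow_of_le_one (by norm_num) (by norm_num) this
              _ = _ := by rw [pow_succ]; ring
          linarith
        intro n _ m _ hnm
        rcases lt_or_gt_of_ne hnm with h | h
        · exact hlt n m h
        · exact (hlt m n h).symm)
      (fun n hn => by
        refine mul_le_mul_of_nonneg_left ?_ ha₁.le
        rw [← Finset.mul_prod_erase _ _ (Finset.mem_univ i), ← Finset.mul_prod_erase _ _ hji,
          hri, hrj, ← mul_assoc]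
        have h1 : ∀ x y : ℝ, (x * 2 ^ (n * R.k Q j)) ^ R.k Q i *
            (y * (1 / 2) ^ (n * R.k Q i)) ^ R.k Q j = x ^ R.k Q i * y ^ R.k Q j := by
          intro x y
          calc _ = x ^ R.k Q i * y ^ R.k Q j * (2 ^ (n * R.k Q j * R.k Q i) *
                (1 / 2) ^ (n * R.k Q j * R.k Q i)) := by
                rw [mul_pow x, mul_pow y, ← pow_mul, ← pow_mul, mul_right_comm n (R.k Q i)]; ring
            _ = _ := by rw [hcancel, mul_one]
        rw [h1]
        refine mul_le_of_le_one_right (by positivity) ?_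
        refine Finset.prod_le_one (fun l hl => pow_nonneg (hrpos n l).le _) fun l hl => ?_
        exact pow_le_one₀ (hrpos n l).le
          ((hrη n (Finset.mem_range.1 hn) l).trans (by linarith [hG.δ_le])))
    have hterm : ∀ n ∈ Finset.range L, b₀ * ∏ l, (r n l / 2) ^ (R.h Q l + 1) =
        K * (ρ ^ (R.h Q i + 1) * η ^ (R.h Q j + 1)) := by
      intro n _
      rw [← Finset.mul_prod_erase _ _ (Finset.mem_univ i), ← Finset.mul_prod_erase _ _ hji,
          hri, hrj, Finset.prod_congr rfl (g := fun l => (η / 2) ^ (R.h Q l + 1))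
          (fun l hl => by rw [hrl n l hl])]
      have h1 : (ρ * 2 ^ (n * R.k Q j) / 2) ^ (R.h Q i + 1) =
          (1 / 2) ^ (R.h Q i + 1) * ρ ^ (R.h Q i + 1) * 2 ^ (n * (R.k Q j * (R.h Q i + 1))) := by
        rw [← mul_assoc n, pow_mul _ (n * R.k Q j), ← mul_pow, ← mul_pow]; ring
      have h2 : (η * (1 / 2) ^ (n * R.k Q i) / 2) ^ (R.h Q j + 1) =
          (1 / 2) ^ (R.h Q j + 1) * η ^ (R.h Q j + 1) *
            (1 / 2) ^ (n * (R.k Q j * (R.h Q i + 1))) := by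
        rw [hnat, ← mul_assoc n, pow_mul _ (n * R.k Q i), ← mul_pow, ← mul_pow]; ring
      rw [h1, h2, hK]
      linear_combination (b₀ * ((1 / 2) ^ (R.h Q i + 1) * ((1 / 2) ^ (R.h Q j + 1) *
        ∏ l ∈ (Finset.univ.erase i).erase j, (η / 2) ^ (R.h Q l + 1)))) *
        (ρ ^ (R.h Q i + 1) * η ^ (R.h Q j + 1)) * hcancel (n * (R.k Q j * (R.h Q i + 1)))
    rw [Finset.sum_congr rfl hterm, Finset.sum_const, Finset.card_range, nsmul_eq_mul] at h
    have hpow : ∀ (x : ℝ) (_ : 0 < x) (l : ι) (_ : lam * R.k Q l = R.h Q l + 1),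
        (x ^ R.k Q l) ^ lam = x ^ (R.h Q l + 1) := by
      intro x hx l hl
      rw [← Real.rpow_natCast x (R.k Q l), ← Real.rpow_mul hx.le, mul_comm, hl,
        ← Real.rpow_natCast]
      push_cast; rfl
    rw [Real.mul_rpow ha₁.le (by positivity), Real.mul_rpow (by positivity) (by positivity),
      hpow ρ hρ0 i hi, hpow η hη0 j hj, ← mul_assoc, ← mul_assoc C] at h
    exact le_of_mul_le_mul_right h (by positivity)
  obtain ⟨L, hL⟩ := exists_nat_gt (C * a₁ ^ lam / K)
  rw [div_lt_iff₀ hKpos] at hL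
  exact absurd (key L) (not_le.2 hL)

end Resolution

/-! ### Integrability of negative powers, and the volume criterion -/

namespace Resolution

open MeasureTheory

variable {ι : Type} [Fintype ι] {F : (ι → ℝ) → ℝ} {P : ι → ℝ}

theorem integrableOn_abs_pow_mul_rpow {δ lam : ℝ} {k h : ℕ} (hlam : lam * k < h + 1) :
    IntegrableOn (fun t : ℝ => |t| ^ h * (|t| ^ k) ^ (-lam)) (Set.Ioo (-δ) δ) := by
  have hpos : IntegrableOn (fun t : ℝ => |t| ^ h * (|t| ^ k) ^ (-lam)) (Set.Ioo 0 δ) := by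
    rcases le_or_gt δ 0 with hδ | hδ
    · simp [Set.Ioo_eq_empty_of_le hδ]
    have h1 : IntegrableOn (fun t : ℝ => t ^ ((h : ℝ) - lam * k)) (Set.Ioo 0 δ) :=
      (intervalIntegral.integrableOn_Ioo_rpow_iff hδ).2 (by linarith)
    refine h1.congr_fun (fun t ht => ?_) measurableSet_Ioo
    have ht0 : 0 < t := ht.1
    simp only [abs_of_pos ht0]
    rw [← Real.rpow_natCast t k, ← Real.rpow_natCast t h, ← Real.rpow_mul ht0.le,
      ← Real.rpow_add ht0]
    congr 1; ring
  have hneg : IntegrableOn (fun t : ℝ => |t| ^ h * (|t| ^ k) ^ (-lam)) (Set.Ioo (-δ) 0) := by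
    have := hpos.comp_neg
    simpa using this
  refine ((hneg.union hpos).union (integrableOn_singleton (x := (0 : ℝ)) (by finiteness) (by simp))).mono_set
    fun t ht => ?_
  rcases lt_trichotomy t 0 with h | h | h
  · exact Or.inl (Or.inl ⟨ht.1, h⟩)
  · exact Or.inr h
  · exact Or.inl (Or.inr ⟨h, ht.2⟩)

/-- In the chart coordinates |F| ^ (-lam) times the Jacobian is bounded by a product of one-variable
functions |u_i| ^ (h_i - lam * k_i), all of exponent greater than -1. -/
theorem lintegral_image_lt_top (R : Resolution F P) {Q : R.U}
    {B : Set (ι → ℝ)} {δ a₀ a₁ b₀ b₁ lam : ℝ} (hlam : 0 < lam)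
    (hG : R.IsGoodCube Q B δ a₀ a₁ b₀ b₁)
    (hk : ∀ i, lam * R.k Q i < R.h Q i + 1) :
    ∫⁻ x in R.local_g Q '' {u | u ∈ Metric.ball 0 δ ∧ F (R.local_g Q u) ≠ 0},
      ENNReal.ofReal (|F x| ^ (-lam)) < ⊤ := by
  set S : Set (ι → ℝ) := {u | u ∈ Metric.ball 0 δ ∧ F (R.local_g Q u) ≠ 0} with hS
  have hballeq : Metric.ball (0 : ι → ℝ) δ = Set.univ.pi fun _ => Set.Ioo (-δ) δ := by
    ext u
    simp only [mem_ball_zero_iff, pi_norm_lt_iff hG.δ_pos, Real.norm_eq_abs, abs_lt, Set.mem_pi,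
      Set.mem_univ, true_imp_iff, Set.mem_Ioo]
  have hSeq : S = {u | u ∈ Metric.ball 0 δ ∧ ∏ i, |u i| ^ R.k Q i ≠ 0} := by
    ext u
    simp only [hS, Set.mem_ofPred_eq, and_congr_right_iff]
    intro hu
    rw [not_iff_not]
    have hp : 0 ≤ ∏ i, |u i| ^ R.k Q i := Finset.prod_nonneg fun i _ => by positivity
    constructor
    · intro h
      have := hG.crossing_lower u hu
      rw [h, abs_zero] at this
      have h2 := hG.a₀_pos
      nlinarith
    · intro h
      have := hG.crossing_upper u hu
      rw [h, mul_zero] at this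
      exact abs_nonpos_iff.1 this
  have hSm : MeasurableSet S := by
    rw [hSeq]
    refine measurableSet_ball.inter (measurableSet_eq_fun ?_ measurable_const).compl
    fun_prop
  have hinj : Set.InjOn (R.local_g Q) S :=
    R.injOn_local_g Q (fun u hu => hG.target u hu.1) fun u hu => hu.2
  rw [lintegral_image_eq_lintegral_abs_det_fderiv_mul volume hSm
    (fun u hu => ((hG.diff u hu.1).hasFDerivAt).hasFDerivWithinAt) hinj]
  have hint : Integrable (fun u : ι → ℝ => b₁ * a₀ ^ (-lam) *
      ∏ i, (|u i| ^ R.h Q i * (|u i| ^ R.k Q i) ^ (-lam)))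
      (volume.restrict (Metric.ball (0 : ι → ℝ) δ)) := by
    rw [hballeq, volume_pi, Measure.restrict_pi_pi]
    exact (Integrable.fintype_prod fun i => integrableOn_abs_pow_mul_rpow (hk i)).const_mul _
  refine lt_of_le_of_lt ?_ hint.lintegral_lt_top
  refine le_trans ?_ (lintegral_mono_set (fun u hu => hu.1 : S ⊆ Metric.ball 0 δ))
  refine setLIntegral_mono' hSm fun u hu => ?_
  have hp : 0 ≤ ∏ i, |u i| ^ R.k Q i := Finset.prod_nonneg fun i _ => by positivity
  have hp' : 0 < ∏ i, |u i| ^ R.k Q i := by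
    rw [hSeq] at hu
    exact lt_of_le_of_ne hp hu.2.symm
  rw [← ENNReal.ofReal_mul (abs_nonneg _)]
  refine ENNReal.ofReal_le_ofReal ?_
  have h1 : |F (R.local_g Q u)| ^ (-lam) ≤ (a₀ * ∏ i, |u i| ^ R.k Q i) ^ (-lam) :=
    Real.rpow_le_rpow_of_nonpos (mul_pos hG.a₀_pos hp') (hG.crossing_lower u hu.1) (by linarith)
  calc |(fderiv ℝ (R.local_g Q) u).det| * |F (R.local_g Q u)| ^ (-lam)
      ≤ (b₁ * ∏ i, |u i| ^ R.h Q i) * (a₀ * ∏ i, |u i| ^ R.k Q i) ^ (-lam) :=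
        mul_le_mul (hG.jacobian_upper u hu.1) h1 (by positivity)
          (mul_nonneg hG.b₁_pos.le (Finset.prod_nonneg fun i _ => by positivity))
    _ = _ := by
        rw [Real.mul_rpow hG.a₀_pos.le hp, ← Real.finsetProd_rpow _ _ (fun i _ => by positivity),
          Finset.prod_mul_distrib]
        ring

/-- Properness makes the fibre over P compact, so finitely many coordinate cubes cover it, and their
images cover a neighbourhood of P apart from the zeros of F. -/
theorem exists_lintegral_lt_top (R : Resolution F P) {lam : ℝ} (hlam : 0 < lam)
    (hk : ∀ Q, R.g Q = P → ∀ i, lam * R.k Q i < R.h Q i + 1) :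
    ∃ B ∈ 𝓝 P, ∫⁻ x in {x | x ∈ B ∧ F x ≠ 0}, ENNReal.ofReal (|F x| ^ (-lam)) < ⊤ := by
  classical
  choose δ a₀ a₁ b₀ b₁ hG using fun (Q : R.U) (hQ : R.g Q = P) =>
    R.exists_isGoodCube hQ (Filter.univ_mem (f := 𝓝 P))
  set p : R.U → R.W := Set.codRestrict R.g R.W R.g_mem with hp
  set P' : R.W := ⟨P, R.mem_W⟩ with hP'
  have hfib : ∀ Q, Q ∈ p ⁻¹' {P'} ↔ R.g Q = P := fun Q => by
    simp [hp, hP', Subtype.ext_iff]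
  have hcomp : IsCompact (p ⁻¹' {P'}) := R.proper_g.isCompact_preimage isCompact_singleton
  set N : ∀ Q, R.g Q = P → Set R.U := fun Q hQ =>
    (R.coord Q).source ∩ (R.coord Q) ⁻¹' Metric.ball 0 (δ Q hQ) with hN
  have hNo : ∀ Q hQ, IsOpen (N Q hQ) := fun Q hQ =>
    (R.coord Q).isOpen_inter_preimage Metric.isOpen_ball
  have hQN : ∀ Q hQ, Q ∈ N Q hQ := fun Q hQ => by
    have h0 : F (R.g Q) = 0 := by rw [hQ, R.zero]
    refine ⟨R.mem_source Q h0, ?_⟩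
    simp only [Set.mem_preimage, R.coord_self Q h0]
    exact Metric.mem_ball_self (hG Q hQ).δ_pos
  obtain ⟨s, hs⟩ := hcomp.elim_nhds_subcover' (fun Q hQ => N Q ((hfib Q).1 hQ))
    (fun Q hQ => (hNo Q _).mem_nhds (hQN Q _))
  set NN : Set R.U := ⋃ x ∈ s, N x.1 ((hfib x.1).1 x.2) with hNN
  have hNNo : IsOpen NN := isOpen_biUnion fun x _ => hNo _ _
  -- A proper map is closed, so the points of `W` whose whole fibre lies in `NN` form an open set;
  -- it contains P.
  have hcl : IsClosed (p '' NNᶜ) := R.proper_g.isClosedMap _ hNNo.isClosed_compl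
  refine ⟨(↑) '' (p '' NNᶜ)ᶜ, ?_, ?_⟩
  · refine (R.isOpen_W.isOpenMap_subtype_val _ hcl.isOpen_compl).mem_nhds ⟨P', ?_, rfl⟩
    rintro ⟨Q, hQ, hQP⟩
    exact hQ (hs hQP)
  · set T : p ⁻¹' {P'} → Set (ι → ℝ) := fun x =>
      R.local_g x.1 '' {u | u ∈ Metric.ball 0 (δ x.1 ((hfib x.1).1 x.2)) ∧
        F (R.local_g x.1 u) ≠ 0} with hT
    have hsub : {x | x ∈ (((↑) : R.W → ι → ℝ) '' (p '' NNᶜ)ᶜ) ∧ F x ≠ 0} ⊆ ⋃ x ∈ s, T x := by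
      rintro x ⟨⟨y, hy, rfl⟩, hx⟩
      have hgx : R.g (R.ginv y) = y := R.g_ginv _ y.2 hx
      have hmem : R.ginv y ∈ NN := by
        by_contra hcon
        exact hy ⟨_, hcon, Subtype.ext hgx⟩
      obtain ⟨z, hz, hzN⟩ := Set.mem_iUnion₂.1 hmem
      refine Set.mem_iUnion₂.2 ⟨z, hz, R.coord z.1 (R.ginv y), ⟨hzN.2, ?_⟩, ?_⟩
      · rw [local_g, (R.coord z.1).left_inv hzN.1, hgx]; exact hx
      · rw [local_g, (R.coord z.1).left_inv hzN.1, hgx]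
    refine lt_of_le_of_lt (lintegral_mono_set hsub) ?_
    have hfin : ∀ s : Finset (p ⁻¹' {P'}),
        ∫⁻ x in ⋃ z ∈ s, T z, ENNReal.ofReal (|F x| ^ (-lam)) < ⊤ := by
      intro s
      induction s using Finset.induction_on with
      | empty => simp
      | insert z s _ ih =>
        rw [Finset.set_biUnion_insert]
        refine lt_of_le_of_lt (lintegral_union_le _ _ _) (ENNReal.add_lt_top.2 ⟨?_, ih⟩)
        exact R.lintegral_image_lt_top hlam (hG z.1 ((hfib z.1).1 z.2)) (hk z.1 ((hfib z.1).1 z.2))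
    exact hfin s

/-- If the volumes of the sublevel sets of `|F|` near `P` decay like `ε ^ lam`, then every
resolution of `F` at `P` has threshold `lam` and multiplicity `1`. -/
theorem threshold_eq_and_multiplicity_eq (R : Resolution F P) {lam : ℝ} (hlam : 0 < lam)
    (hup : ∃ B ∈ 𝓝 P, ∃ C : ℝ, 0 < C ∧ ∀ ε : ℝ, 0 < ε →
      volume {x | x ∈ B ∧ F x ≠ 0 ∧ |F x| ≤ ε} ≤ ENNReal.ofReal (C * ε ^ lam))
    (hlow : ∀ B ∈ 𝓝 P, ∃ c : ℝ, 0 < c ∧ ∀ᶠ ε : ℝ in 𝓝[>] 0,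
      ENNReal.ofReal (c * ε ^ lam) ≤ volume {x | x ∈ B ∧ F x ≠ 0 ∧ |F x| ≤ ε}) :
    R.threshold = ENNReal.ofReal lam ∧ R.multiplicity = 1 := by
  classical
  obtain ⟨B, hB, C, hC, hV⟩ := hup
  have hratio : ∀ Q i, R.ratio Q i = ENNReal.ofReal lam ↔ lam * R.k Q i = R.h Q i + 1 := by
    intro Q i
    have hcast : (R.h Q i : ℝ≥0∞) + 1 = ENNReal.ofReal (R.h Q i + 1) := by
      rw [ENNReal.ofReal_add (Nat.cast_nonneg _) zero_le_one]; simp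
    rcases Nat.eq_zero_or_pos (R.k Q i) with h | h
    · rw [ratio, h, Nat.cast_zero, ENNReal.div_zero (by simp)]
      constructor
      · intro h; simp at h
      · intro h
        have : (0 : ℝ) ≤ R.h Q i := Nat.cast_nonneg _
        simp at h; linarith
    · have h' : (0 : ℝ) < R.k Q i := Nat.cast_pos.2 h
      rw [ratio, hcast, ← ENNReal.ofReal_natCast, ← ENNReal.ofReal_div_of_pos h',
        ENNReal.ofReal_eq_ofReal_iff (by positivity) hlam.le, div_eq_iff h'.ne', eq_comm]
  have hge : ∀ Q, R.g Q = P → ∀ i, ENNReal.ofReal lam ≤ R.ratio Q i := by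
    intro Q hQ i
    have h := R.mul_k_le_of_volume_le hQ hB hC hV i
    rw [ratio, ENNReal.le_div_iff_mul_le (Or.inr (by simp)) (Or.inr (by finiteness)),
      ← ENNReal.ofReal_natCast (R.k Q i), ← ENNReal.ofReal_mul hlam.le]
    refine (ENNReal.ofReal_le_ofReal h).trans ?_
    rw [ENNReal.ofReal_add (Nat.cast_nonneg _) zero_le_one]; simp
  -- If no ratio attained lam, then |F| ^ (-lam) would be integrable near P, and its integral over
  -- the shrinking sublevel sets would tend to 0. The lower volume bound keeps these integrals above
  -- c.
  have hex : ∃ Q, R.g Q = P ∧ ∃ i, R.ratio Q i = ENNReal.ofReal lam := by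
    by_contra! hcon
    obtain ⟨B', hB', hfin⟩ := R.exists_lintegral_lt_top hlam fun Q hQ i =>
      lt_of_le_of_ne (R.mul_k_le_of_volume_le hQ hB hC hV i)
        fun h => hcon Q hQ i ((hratio Q i).2 h)
    set O : Set (ι → ℝ) := interior B ∩ interior B' ∩ R.W with hO
    have hOo : IsOpen O := (isOpen_interior.inter isOpen_interior).inter R.isOpen_W
    have hOP : O ∈ 𝓝 P := Filter.inter_mem (Filter.inter_mem (interior_mem_nhds.2 hB)
      (interior_mem_nhds.2 hB')) (R.isOpen_W.mem_nhds R.mem_W)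
    have hFc : ContinuousOn F O := fun x hx =>
      (R.analytic_F x hx.2).continuousAt.continuousWithinAt
    obtain ⟨c, hc, hlow'⟩ := hlow O hOP
    set T : ℝ → Set (ι → ℝ) := fun ε => {x | x ∈ O ∧ F x ≠ 0 ∧ |F x| ≤ ε} with hT
    have hTm : ∀ ε, MeasurableSet (T ε) := by
      intro ε
      have h1 : IsOpen (O ∩ F ⁻¹' {t | t ≠ 0}) := hFc.isOpen_inter_preimage hOo isOpen_ne
      have h2 : IsOpen (O ∩ F ⁻¹' {t | ε < |t|}) :=
        hFc.isOpen_inter_preimage hOo (isOpen_lt continuous_const continuous_abs)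
      have : T ε = (O ∩ F ⁻¹' {t | t ≠ 0}) \ (O ∩ F ⁻¹' {t | ε < |t|}) := by
        ext x
        simp only [hT, Set.mem_sdiff, Set.mem_inter_iff, Set.mem_preimage, Set.mem_ofPred_eq, not_and,
          not_lt]
        tauto
      rw [this]
      exact h1.measurableSet.diff h2.measurableSet
    have hTsub : ∀ ε, T ε ⊆ {x | x ∈ B ∧ F x ≠ 0 ∧ |F x| ≤ ε} := fun ε x hx =>
      ⟨interior_subset hx.1.1.1, hx.2⟩
    have hTsub' : ∀ ε, T ε ⊆ {x | x ∈ B' ∧ F x ≠ 0} := fun ε x hx =>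
      ⟨interior_subset hx.1.1.2, hx.2.1⟩
    set ν : Measure (ι → ℝ) := volume.restrict {x | x ∈ B' ∧ F x ≠ 0} with hν
    have hνT : ∀ ε, ν.restrict (T ε) = volume.restrict (T ε) := fun ε =>
      Measure.restrict_restrict_of_subset (hTsub' ε)
    have hT0 : Filter.Tendsto (fun ε => ν (T ε)) (𝓝[>] 0) (𝓝 0) := by
      have h1 : Filter.Tendsto (fun ε : ℝ => ENNReal.ofReal (C * ε ^ lam)) (𝓝[>] 0) (𝓝 0) := by
        have h2 : ContinuousAt (fun ε : ℝ => ENNReal.ofReal (C * ε ^ lam)) 0 :=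
          ENNReal.continuous_ofReal.continuousAt.comp
            (continuousAt_const.mul (Real.continuousAt_rpow_const 0 lam (Or.inr hlam.le)))
        have h3 := h2.tendsto
        simp only [Real.zero_rpow hlam.ne', mul_zero, ENNReal.ofReal_zero] at h3
        exact h3.mono_left nhdsWithin_le_nhds
      refine tendsto_of_tendsto_of_tendsto_of_le_of_le' tendsto_const_nhds h1
        (Filter.Eventually.of_forall fun _ => zero_le) ?_
      filter_upwards [self_mem_nhdsWithin] with ε hε
      exact (Measure.restrict_apply_le _ _).trans ((measure_mono (hTsub ε)).trans (hV ε hε))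
    have hI := tendsto_setLIntegral_zero hfin.ne hT0
    have hIge : ∀ᶠ ε : ℝ in 𝓝[>] 0, ENNReal.ofReal c ≤
        ∫⁻ x in T ε, ENNReal.ofReal (|F x| ^ (-lam)) ∂ν := by
      filter_upwards [self_mem_nhdsWithin, hlow'] with ε (hε : 0 < ε) hl
      rw [hνT]
      -- Chebyshev's inequality: the integrand is at least ε ^ (-lam) on the sublevel set.
      calc ENNReal.ofReal c = ENNReal.ofReal (ε ^ (-lam)) * ENNReal.ofReal (c * ε ^ lam) := by
            rw [← ENNReal.ofReal_mul (by positivity), mul_left_comm, ← Real.rpow_add hε]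
            simp
        _ ≤ ENNReal.ofReal (ε ^ (-lam)) * volume (T ε) := by gcongr
        _ = ∫⁻ _ in T ε, ENNReal.ofReal (ε ^ (-lam)) := (setLIntegral_const _ _).symm
        _ ≤ _ := by
            refine setLIntegral_mono' (hTm ε) fun x hx => ENNReal.ofReal_le_ofReal ?_
            exact Real.rpow_le_rpow_of_nonpos (abs_pos.2 hx.2.1) hx.2.2 (by linarith)
    have := ge_of_tendsto hI hIge
    simp only [nonpos_iff_eq_zero, ENNReal.ofReal_eq_zero] at this
    linarith
  obtain ⟨Q, hQ, i, hi⟩ := hex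
  have hthr : R.threshold = ENNReal.ofReal lam := by
    refine le_antisymm ?_ (le_iInf fun Q => le_iInf fun hQ => le_iInf fun i => hge Q hQ i)
    exact (iInf_le_of_le Q (iInf_le_of_le hQ (iInf_le _ i))).trans hi.le
  refine ⟨hthr, le_antisymm ?_ ?_⟩
  · refine iSup_le fun Q => iSup_le fun hQ => ?_
    rw [hthr]
    norm_cast
    refine Finset.card_le_one.2 fun i hi j hj => ?_
    exact R.eq_of_mul_k_eq_of_volume_le hQ hB hC hV ((hratio Q i).1 (Finset.mem_filter.1 hi).2)
      ((hratio Q j).1 (Finset.mem_filter.1 hj).2)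
  · refine le_iSup_of_le Q (le_iSup_of_le hQ ?_)
    rw [hthr]
    norm_cast
    exact Finset.card_pos.2 ⟨i, Finset.mem_filter.2 ⟨Finset.mem_univ _, hi⟩⟩

end Resolution

/-! ### Analytic submanifolds given by parametrizations -/

/-- An analytic atlas, modelled on `E`, of a subset `S` of a normed space `V`, given by analytic
parametrizations `φ c` of pieces of `S` and by analytic maps `ψ c`, defined on open subsets of
`V`, which are inverse to them on `S`. -/
structure SubmanifoldAtlas (E : Type) [NormedAddCommGroup E] [NormedSpace ℝ E]
    {V : Type} [NormedAddCommGroup V] [NormedSpace ℝ V] (S : Set V) (C : Type) where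
  O : C → Set V
  D : C → Set E
  ψ : C → V → E
  φ : C → E → V
  isOpen_O : ∀ c, IsOpen (O c)
  isOpen_D : ∀ c, IsOpen (D c)
  contDiffOn_ψ : ∀ c, ContDiffOn ℝ ω (ψ c) (O c)
  contDiffOn_φ : ∀ c, ContDiffOn ℝ ω (φ c) (D c)
  φ_mem : ∀ c, ∀ u ∈ D c, φ c u ∈ S
  φ_mem_O : ∀ c, ∀ u ∈ D c, φ c u ∈ O c
  ψ_mem : ∀ c, ∀ p ∈ S, p ∈ O c → ψ c p ∈ D c
  ψ_φ : ∀ c, ∀ u ∈ D c, ψ c (φ c u) = u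
  φ_ψ : ∀ c, ∀ p ∈ S, p ∈ O c → φ c (ψ c p) = p
  cover : ∀ p ∈ S, ∃ c, p ∈ O c

namespace SubmanifoldAtlas

variable {E : Type} [NormedAddCommGroup E] [NormedSpace ℝ E]
  {V : Type} [NormedAddCommGroup V] [NormedSpace ℝ V] {S : Set V} {C : Type}

/-- The map `φ c`, with values in the subtype `S`; the point `p` is a junk value. -/
noncomputable def param (A : SubmanifoldAtlas E S C) (p : S) (c : C) (u : E) : S :=
  open Classical in if h : A.φ c u ∈ S then ⟨A.φ c u, h⟩ else p

theorem coe_param (A : SubmanifoldAtlas E S C) (p : S) (c : C) {u : E} (hu : u ∈ A.D c) :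
    (A.param p c u : V) = A.φ c u := by
  rw [param, dif_pos (A.φ_mem c u hu)]

/-- The charts of the atlas. -/
noncomputable def chart (A : SubmanifoldAtlas E S C) (p : S) (c : C) :
    OpenPartialHomeomorph S E where
  toFun q := A.ψ c q
  invFun := A.param p c
  source := {q : S | (q : V) ∈ A.O c}
  target := A.D c
  map_source' q hq := A.ψ_mem c q q.2 hq
  map_target' u hu := by
    rw [Set.mem_ofPred_eq, A.coe_param p c hu]; exact A.φ_mem_O c u hu
  left_inv' q hq := by
    apply Subtype.ext
    rw [A.coe_param p c (A.ψ_mem c q q.2 hq), A.φ_ψ c q q.2 hq]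
  right_inv' u hu := by rw [A.coe_param p c hu, A.ψ_φ c u hu]
  open_source := (A.isOpen_O c).preimage continuous_subtype_val
  open_target := A.isOpen_D c
  continuousOn_toFun := (A.contDiffOn_ψ c).continuousOn.comp
    continuous_subtype_val.continuousOn fun _ hq => hq
  continuousOn_invFun := by
    rw [Topology.IsInducing.subtypeVal.continuousOn_iff]
    exact (A.contDiffOn_φ c).continuousOn.congr fun u hu => A.coe_param p c hu

/-- The charted space structure on `S`. -/
noncomputable abbrev chartedSpace (A : SubmanifoldAtlas E S C) : ChartedSpace E S where
  atlas := {e | ∃ p c, e = A.chart p c}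
  chartAt p := A.chart p (A.cover p p.2).choose
  mem_chart_source p := (A.cover p p.2).choose_spec
  chart_mem_atlas p := ⟨p, _, rfl⟩

theorem isManifold (A : SubmanifoldAtlas E S C) :
    letI := A.chartedSpace
    IsManifold 𝓘(ℝ, E) ω S := by
  let _ := A.chartedSpace
  refine isManifold_of_contDiffOn _ _ _ ?_
  rintro _ _ ⟨p, c, rfl⟩ ⟨p', c', rfl⟩
  simp only [modelWithCornersSelf_coe, modelWithCornersSelf_coe_symm, Function.comp_id,
    Function.id_comp, Set.preimage_id, Set.range_id, Set.inter_univ]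
  have h : ContDiffOn ℝ ω (fun u => A.ψ c' (A.φ c u))
      ((A.chart p c).symm.trans (A.chart p' c')).source := by
    refine (A.contDiffOn_ψ c').comp ((A.contDiffOn_φ c).mono fun u hu => hu.1) fun u hu => ?_
    have h2 : (A.param p c u : V) ∈ A.O c' := hu.2
    rwa [A.coe_param p c hu.1] at h2
  refine h.congr fun u hu => ?_
  have h1 : u ∈ A.D c := hu.1
  change A.ψ c' (A.param p c u : V) = _
  rw [A.coe_param p c h1]

theorem chart_mem_maximalAtlas (A : SubmanifoldAtlas E S C) (p : S) (c : C) :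
    letI := A.chartedSpace
    A.chart p c ∈ IsManifold.maximalAtlas 𝓘(ℝ, E) ω S := by
  let _ := A.chartedSpace
  have _ := A.isManifold
  exact IsManifold.subset_maximalAtlas ⟨p, c, rfl⟩

/-- Analytic functions on the ambient space are analytic on `S`. -/
theorem contMDiff_restrict (A : SubmanifoldAtlas E S C) {G : V → E} {T : Set V} (hT : IsOpen T)
    (hST : S ⊆ T) (hG : ContDiffOn ℝ ω G T) :
    letI := A.chartedSpace
    ContMDiff 𝓘(ℝ, E) 𝓘(ℝ, E) ω (fun p : S => G p) := by
  let _ := A.chartedSpace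
  have _ := A.isManifold
  intro p
  set c := (A.cover p p.2).choose with hc
  have hp : (p : V) ∈ A.O c := (A.cover p p.2).choose_spec
  rw [contMDiffAt_iff_source_of_mem_source (x := p) (x' := p) (mem_chart_source E p)]
  have h : ContDiffAt ℝ ω (fun u => G (A.φ c u)) (A.ψ c p) := by
    have hD := A.ψ_mem c p p.2 hp
    have h1 : ContDiffAt ℝ ω (A.φ c) (A.ψ c p) :=
      (A.contDiffOn_φ c).contDiffAt ((A.isOpen_D c).mem_nhds hD)
    refine ContDiffAt.comp (A.ψ c p) ?_ h1
    rw [A.φ_ψ c p p.2 hp]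
    exact hG.contDiffAt (hT.mem_nhds (hST p.2))
  have h' : ContDiffAt ℝ ω (fun u => G (A.param p c u)) (A.ψ c p) := by
    refine h.congr_of_eventuallyEq ?_
    filter_upwards [(A.isOpen_D c).mem_nhds (A.ψ_mem c p p.2 hp)] with u hu
    rw [A.coe_param p c hu]
  exact (contMDiffAt_iff_contDiffAt.2 h').contMDiffWithinAt

/-- Maps to `S` are analytic if they are analytic as maps to the ambient space. -/
theorem contMDiffOn_codRestrict (A : SubmanifoldAtlas E S C) {f : E → S} {T : Set E}
    (hf : ContDiffOn ℝ ω (fun x => (f x : V)) T) :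
    letI := A.chartedSpace
    ContMDiffOn 𝓘(ℝ, E) 𝓘(ℝ, E) ω f T := by
  let _ := A.chartedSpace
  have _ := A.isManifold
  intro x hx
  set c := (A.cover (f x) (f x).2).choose with hc
  have hp : (f x : V) ∈ A.O c := (A.cover (f x) (f x).2).choose_spec
  rw [contMDiffWithinAt_iff_target]
  refine ⟨?_, ?_⟩
  · rw [Topology.IsInducing.subtypeVal.continuousWithinAt_iff]
    exact (hf x hx).continuousWithinAt
  · rw [contMDiffWithinAt_iff_contDiffWithinAt]
    have h : ContDiffWithinAt ℝ ω (fun x => A.ψ c (f x : V)) T x :=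
      ContDiffAt.comp_contDiffWithinAt x
        ((A.contDiffOn_ψ c).contDiffAt ((A.isOpen_O c).mem_nhds hp)) (hf x hx)
    exact h

end SubmanifoldAtlas

/-! ### Projective space as a set of rank one projections -/

/-- The matrix of the orthogonal projection to the line spanned by `w`. -/
noncomputable def lineProj {κ : Type} [Fintype κ] (w : κ → ℝ) : κ → κ → ℝ :=
  fun a b => w a * w b / ∑ c, w c ^ 2

section lineProj

variable {κ : Type} [Fintype κ]

theorem sum_sq_pos_of_ne_zero {w : κ → ℝ} (hw : w ≠ 0) : 0 < ∑ c, w c ^ 2 := by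
  obtain ⟨c, hc⟩ := Function.ne_iff.1 hw
  exact Finset.sum_pos' (fun _ _ => sq_nonneg _) ⟨c, Finset.mem_univ c, pow_two_pos_of_ne_zero hc⟩

theorem lineProj_smul {w : κ → ℝ} {t : ℝ} (ht : t ≠ 0) : lineProj (t • w) = lineProj w := by
  funext a b
  have : ∑ c, (t • w) c ^ 2 = t ^ 2 * ∑ c, w c ^ 2 := by
    rw [Finset.mul_sum]; exact Finset.sum_congr rfl fun c _ => by simp [mul_pow]
  rw [lineProj, lineProj, this]
  simp only [Pi.smul_apply, smul_eq_mul]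
  rw [show t * w a * (t * w b) = t ^ 2 * (w a * w b) by ring,
    mul_div_mul_left _ _ (pow_ne_zero 2 ht)]

theorem lineProj_self_ne_zero_iff {w : κ → ℝ} (hw : w ≠ 0) (a : κ) :
    lineProj w a a ≠ 0 ↔ w a ≠ 0 := by
  rw [lineProj, ne_eq, div_eq_zero_iff, not_or]
  simp [(sum_sq_pos_of_ne_zero hw).ne']

theorem lineProj_self_ne_zero {w : κ → ℝ} {a : κ} (h : w a ≠ 0) : lineProj w a a ≠ 0 :=
  (lineProj_self_ne_zero_iff (fun h0 => h (by rw [h0]; rfl)) a).2 h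

/-- These quotients are the affine coordinates of a line, so chart coordinates of the blow-up are
rational functions of the matrix entries. -/
theorem lineProj_div {w : κ → ℝ} (a b : κ) (hb : w b ≠ 0) :
    lineProj w a b / lineProj w b b = w a / w b := by
  have hw : w ≠ 0 := fun h => hb (by rw [h]; rfl)
  have := (sum_sq_pos_of_ne_zero hw).ne'
  rw [lineProj, lineProj]
  field_simp

theorem sum_lineProj {w : κ → ℝ} (hw : w ≠ 0) : ∑ a, lineProj w a a = 1 := by
  simp only [lineProj, ← sq]
  rw [← Finset.sum_div, div_self (sum_sq_pos_of_ne_zero hw).ne']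

theorem abs_lineProj_le (w : κ → ℝ) (a b : κ) : |lineProj w a b| ≤ 1 := by
  rw [lineProj, abs_div, abs_of_nonneg (Finset.sum_nonneg fun c _ => sq_nonneg (w c)), abs_mul]
  refine div_le_one_of_le₀ ?_ (Finset.sum_nonneg fun c _ => sq_nonneg _)
  have h1 : w a ^ 2 ≤ ∑ c, w c ^ 2 :=
    Finset.single_le_sum (f := fun c => w c ^ 2) (fun c _ => sq_nonneg _) (Finset.mem_univ a)
  have h2 : w b ^ 2 ≤ ∑ c, w c ^ 2 :=
    Finset.single_le_sum (f := fun c => w c ^ 2) (fun c _ => sq_nonneg _) (Finset.mem_univ b)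
  nlinarith [sq_nonneg (|w a| - |w b|), sq_abs (w a), sq_abs (w b)]

theorem contDiffOn_lineProj {E : Type} [NormedAddCommGroup E] [NormedSpace ℝ E] {f : E → κ → ℝ}
    {T : Set E} (hf : ContDiffOn ℝ ω f T) (h0 : ∀ x ∈ T, f x ≠ 0) :
    ContDiffOn ℝ ω (fun x => lineProj (f x)) T := by
  have hc : ∀ a, ContDiffOn ℝ ω (fun x => f x a) T := fun a => contDiffOn_pi.1 hf a
  refine contDiffOn_pi.2 fun a => contDiffOn_pi.2 fun b => ?_
  exact ((hc a).mul (hc b)).div (ContDiffOn.sum fun c _ => (hc c).pow 2)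
    fun x hx => (sum_sq_pos_of_ne_zero (h0 x hx)).ne'

end lineProj

/-! ### The twofold blow-up as the closure of a graph -/

section Blowup

variable {ι : Type} [Fintype ι] [DecidableEq ι]

/-- The part of the coordinates lying in `Z ∪ Y`. -/
def normalPart (Z Y : Finset ι) (x : ι → ℝ) : ι → ℝ := fun i => if i ∈ Z ∪ Y then x i else 0

/-- The coordinates in `Z`, and the sum of the squares of the coordinates in `Y`. -/
def quadPart (Z Y : Finset ι) (x : ι → ℝ) : Option ι → ℝ
  | none => ∑ i ∈ Y, x i ^ 2
  | some i => if i ∈ Z then x i else 0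

/-- The ambient space of the twofold blow-up. -/
abbrev BlowupAmbient (ι : Type) : Type :=
  (ι → ℝ) × (ι → ι → ℝ) × (Option ι → Option ι → ℝ)

/-- The rational section of the twofold blow-up. -/
noncomputable def blowupSection (Z Y : Finset ι) (x : ι → ℝ) : BlowupAmbient ι :=
  (x, lineProj (normalPart Z Y x), lineProj (quadPart Z Y x))

/-- The blow-up of `z = y = 0`, followed by the blow-up of the strict transform of the cone
`z = 0` in the exceptional divisor, where `z` and `y` are the coordinates in `Z` and in `Y`. -/
def blowupSet (Z Y : Finset ι) : Set (BlowupAmbient ι) :=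
  closure (blowupSection Z Y '' {x | normalPart Z Y x ≠ 0})

/-- Over the reals a sum of squares vanishes only if all terms do, so the second line is defined
wherever the first one is. -/
theorem quadPart_ne_zero {Z Y : Finset ι} {x : ι → ℝ} (hx : normalPart Z Y x ≠ 0) :
    quadPart Z Y x ≠ 0 := by
  intro h
  apply hx
  funext i
  simp only [normalPart, Pi.zero_apply, ite_eq_right_iff, Finset.mem_union]
  rintro (hi | hi)
  · have := congrFun h (some i)
    simpa [quadPart, hi] using this
  · have := congrFun h none
    simp only [quadPart, Pi.zero_apply] at this
    exact pow_eq_zero_iff (two_ne_zero) |>.1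
      ((Finset.sum_eq_zero_iff_of_nonneg fun i _ => sq_nonneg (x i)).1 this i hi)

theorem contDiff_normalPart (Z Y : Finset ι) : ContDiff ℝ ω (normalPart Z Y) := by
  refine contDiff_pi.2 fun i => ?_
  unfold normalPart
  split_ifs <;> fun_prop

theorem contDiff_quadPart (Z Y : Finset ι) : ContDiff ℝ ω (quadPart Z Y) := by
  refine contDiff_pi.2 fun i => ?_
  cases i with
  | none => unfold quadPart; fun_prop
  | some i =>
    by_cases h : i ∈ Z
    · simp only [quadPart, h, if_true]; fun_prop
    · simp only [quadPart, h, if_false]; fun_prop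

theorem contDiffOn_blowupSection (Z Y : Finset ι) :
    ContDiffOn ℝ ω (blowupSection Z Y) {x | normalPart Z Y x ≠ 0} :=
  contDiffOn_id.prodMk ((contDiffOn_lineProj (contDiff_normalPart Z Y).contDiffOn
    fun _ hx => hx).prodMk (contDiffOn_lineProj (contDiff_quadPart Z Y).contDiffOn
      fun _ hx => quadPart_ne_zero hx))

theorem isOpen_normalPart_ne_zero (Z Y : Finset ι) :
    IsOpen {x : ι → ℝ | normalPart Z Y x ≠ 0} :=
  isOpen_ne.preimage (contDiff_normalPart Z Y).continuous

theorem blowupSection_mem {Z Y : Finset ι} {x : ι → ℝ} (hx : normalPart Z Y x ≠ 0) :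
    blowupSection Z Y x ∈ blowupSet Z Y := subset_closure ⟨x, hx, rfl⟩

/-- A continuous function that agrees with the identity at the points of the section agrees with
it on the blow-up. -/
theorem eq_self_of_mem_blowupSet {Z Y : Finset ι} {O : Set (BlowupAmbient ι)} (hO : IsOpen O)
    {f : BlowupAmbient ι → BlowupAmbient ι} (hf : ContinuousOn f O)
    (h : ∀ x, normalPart Z Y x ≠ 0 → blowupSection Z Y x ∈ O →
      f (blowupSection Z Y x) = blowupSection Z Y x)
    {p : BlowupAmbient ι} (hp : p ∈ blowupSet Z Y) (hpO : p ∈ O) : f p = p := by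
  have h1 := hO.inter_closure ⟨hpO, hp⟩
  rw [mem_closure_iff_nhdsWithin_neBot] at h1
  have h2 : Filter.Tendsto f (𝓝[O ∩ blowupSection Z Y '' {x | normalPart Z Y x ≠ 0}] p)
      (𝓝 (f p)) := ((hf.continuousAt (hO.mem_nhds hpO)).tendsto).mono_left nhdsWithin_le_nhds
  refine tendsto_nhds_unique h2 (Filter.Tendsto.congr' ?_
    (Filter.tendsto_id.mono_left nhdsWithin_le_nhds))
  filter_upwards [self_mem_nhdsWithin] with q hq
  obtain ⟨hqO, x, hx, rfl⟩ := hq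
  exact (h x hx hqO).symm

/-- Outside the centre the section is continuous, so taking the closure of its graph adds no points
there. -/
theorem eq_blowupSection {Z Y : Finset ι} {p : BlowupAmbient ι} (hp : p ∈ blowupSet Z Y)
    (hp0 : normalPart Z Y p.1 ≠ 0) : blowupSection Z Y p.1 = p :=
  eq_self_of_mem_blowupSet (O := Prod.fst ⁻¹' {x | normalPart Z Y x ≠ 0})
    (f := fun p => blowupSection Z Y p.1)
    ((isOpen_normalPart_ne_zero Z Y).preimage continuous_fst)
    ((contDiffOn_blowupSection Z Y).continuousOn.comp continuous_fst.continuousOn fun _ h => h)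
    (fun _ _ _ => rfl) hp hp0

/-- These closed conditions hold on the section. Trace one supplies a nonzero diagonal entry, hence
a chart around every point; the bounds on the entries give properness. -/
theorem blowupSet_subset (Z Y : Finset ι) : blowupSet Z Y ⊆
    {p | (∑ i, p.2.1 i i = 1 ∧ ∑ i, p.2.2 i i = 1) ∧ (∀ i ∉ Z ∪ Y, p.2.1 i i = 0) ∧
      (∀ i ∉ Z, p.2.2 (some i) (some i) = 0) ∧
      (∀ i j, |p.2.1 i j| ≤ 1) ∧ ∀ i j, |p.2.2 i j| ≤ 1} := by
  refine closure_minimal ?_ ?_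
  · rintro _ ⟨x, hx, rfl⟩
    refine ⟨⟨sum_lineProj hx, sum_lineProj (quadPart_ne_zero hx)⟩, fun i hi => ?_, fun i hi => ?_,
      abs_lineProj_le _, abs_lineProj_le _⟩
    · simp [blowupSection, lineProj, normalPart, hi]
    · simp [blowupSection, lineProj, quadPart, hi]
  · refine IsClosed.and (IsClosed.and ?_ ?_) (IsClosed.and ?_ (IsClosed.and ?_ (IsClosed.and ?_ ?_)))
    · exact isClosed_eq (by fun_prop) (by fun_prop)
    · exact isClosed_eq (by fun_prop) (by fun_prop)
    · simp only [Set.ofPred_forall]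
      exact isClosed_iInter fun i => isClosed_iInter fun _ => isClosed_eq (by fun_prop) (by fun_prop)
    · simp only [Set.ofPred_forall]
      exact isClosed_iInter fun i => isClosed_iInter fun _ => isClosed_eq (by fun_prop) (by fun_prop)
    · simp only [Set.ofPred_forall]
      exact isClosed_iInter fun i => isClosed_iInter fun j => isClosed_le (by fun_prop) (by fun_prop)
    · simp only [Set.ofPred_forall]
      exact isClosed_iInter fun i => isClosed_iInter fun j => isClosed_le (by fun_prop) (by fun_prop)

theorem isCompact_blowupSet_inter (Z Y : Finset ι) {K : Set (ι → ℝ)} (hK : IsCompact K) :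
    IsCompact (blowupSet Z Y ∩ {p | p.1 ∈ K}) := by
  have hcomp : IsCompact (K ×ˢ (Set.univ.pi (fun _ : ι => Set.univ.pi fun _ : ι =>
      Set.Icc (-1 : ℝ) 1) ×ˢ Set.univ.pi (fun _ : Option ι => Set.univ.pi fun _ : Option ι =>
      Set.Icc (-1 : ℝ) 1))) :=
    hK.prod ((isCompact_univ_pi fun _ => isCompact_univ_pi fun _ => isCompact_Icc).prod
      (isCompact_univ_pi fun _ => isCompact_univ_pi fun _ => isCompact_Icc))
  refine hcomp.of_isClosed_subset (isClosed_closure.inter (hK.isClosed.preimage continuous_fst)) ?_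
  rintro p ⟨hp, hpK⟩
  obtain ⟨-, -, -, h1, h2⟩ := blowupSet_subset Z Y hp
  exact ⟨hpK, fun i _ j _ => abs_le.1 (h1 i j), fun i _ j _ => abs_le.1 (h2 i j)⟩

/-- A chart of the twofold blow-up: the map `g` to `ℝ ^ ι` in local coordinates, in which
`normalPart` and `quadPart` are multiples of the nowhere vanishing vectors `w` and `v`, and the
local coordinates `ψ` as functions on the ambient space. -/
structure BlowupChart (Z Y : Finset ι) where
  g : (ι → ℝ) → ι → ℝ
  w : (ι → ℝ) → ι → ℝ
  v : (ι → ℝ) → Option ι → ℝ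
  m : (ι → ℝ) → ℝ
  n : (ι → ℝ) → ℝ
  e : ι → ℕ
  h : ι → ℕ
  O : Set (BlowupAmbient ι)
  ψ : BlowupAmbient ι → ι → ℝ
  contDiff_g : ContDiff ℝ ω g
  contDiff_w : ContDiff ℝ ω w
  contDiff_v : ContDiff ℝ ω v
  contDiff_n : ContDiff ℝ ω n
  w_ne_zero : ∀ u, w u ≠ 0
  v_ne_zero : ∀ u, v u ≠ 0
  normalPart_g : ∀ u, normalPart Z Y (g u) = m u • w u
  quadPart_g : ∀ u, quadPart Z Y (g u) = (∏ i, u i ^ e i) • v u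
  -- With y = m w, the products y_i y_j are divisible by the monomial, with quotient n w_i w_j, just
  -- as the z_i are, with quotient v_i.
  m_sq : ∀ u, m u ^ 2 = (∏ i, u i ^ e i) * n u
  det_g : ∀ u, (fderiv ℝ g u).det = ∏ i, u i ^ h i
  isOpen_O : IsOpen O
  contDiffOn_ψ : ContDiffOn ℝ ω ψ O
  dense : Dense {u | m u ≠ 0 ∧ ∏ i, u i ^ e i ≠ 0}
  mem_O : ∀ u, (g u, lineProj (w u), lineProj (v u)) ∈ O
  ψ_eq : ∀ u, ψ (g u, lineProj (w u), lineProj (v u)) = u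
  g_ψ : ∀ x, normalPart Z Y x ≠ 0 → blowupSection Z Y x ∈ O →
    g (ψ (blowupSection Z Y x)) = x ∧ m (ψ (blowupSection Z Y x)) ≠ 0 ∧
      ∏ i, ψ (blowupSection Z Y x) i ^ e i ≠ 0
  -- This is (∑ z_i² + ∑ y_j⁴) divided by the square of the monomial: the pulled back ideal is
  -- generated by the monomial itself.
  pos : ∀ u, 0 < ∑ i ∈ Z, v u (some i) ^ 2 + n u ^ 2 * ∑ i ∈ Y, w u i ^ 4

namespace BlowupChart

variable {Z Y : Finset ι}

/-- The parametrization of the blow-up given by a chart. -/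
noncomputable def φ (c : BlowupChart Z Y) (u : ι → ℝ) : BlowupAmbient ι :=
  (c.g u, lineProj (c.w u), lineProj (c.v u))

theorem contDiff_φ (c : BlowupChart Z Y) : ContDiff ℝ ω c.φ := by
  rw [← contDiffOn_univ]
  exact c.contDiff_g.contDiffOn.prodMk
    ((contDiffOn_lineProj c.contDiff_w.contDiffOn fun u _ => c.w_ne_zero u).prodMk
      (contDiffOn_lineProj c.contDiff_v.contDiffOn fun u _ => c.v_ne_zero u))

theorem φ_eq_blowupSection (c : BlowupChart Z Y) {u : ι → ℝ} (hm : c.m u ≠ 0)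
    (he : ∏ i, u i ^ c.e i ≠ 0) : c.φ u = blowupSection Z Y (c.g u) := by
  rw [φ, blowupSection, c.normalPart_g, c.quadPart_g, lineProj_smul hm, lineProj_smul he]

theorem normalPart_ne_zero (c : BlowupChart Z Y) {u : ι → ℝ} (hm : c.m u ≠ 0) :
    normalPart Z Y (c.g u) ≠ 0 := by
  rw [c.normalPart_g]; exact smul_ne_zero hm (c.w_ne_zero u)

theorem φ_mem (c : BlowupChart Z Y) (u : ι → ℝ) : c.φ u ∈ blowupSet Z Y := by
  -- Off a nowhere dense set the parametrization meets the section, where both lines are scalar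
  -- multiples; elsewhere it is a limit of such points.
  refine map_mem_closure c.contDiff_φ.continuous (c.dense u) fun x hx => ?_
  rw [c.φ_eq_blowupSection hx.1 hx.2]
  exact ⟨c.g x, c.normalPart_ne_zero hx.1, rfl⟩

theorem φ_ψ (c : BlowupChart Z Y) {p : BlowupAmbient ι} (hp : p ∈ blowupSet Z Y)
    (hpO : p ∈ c.O) : c.φ (c.ψ p) = p := by
  refine eq_self_of_mem_blowupSet c.isOpen_O (f := fun p => c.φ (c.ψ p))
    (c.contDiff_φ.continuous.comp_continuousOn c.contDiffOn_ψ.continuousOn) ?_ hp hpO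
  intro x hx hxO
  obtain ⟨h1, h2, h3⟩ := c.g_ψ x hx hxO
  rw [c.φ_eq_blowupSection h2 h3, h1]

end BlowupChart

/-- The part of the blow-up over `W₀`. -/
def blowupOver (Z Y : Finset ι) (W₀ : Set (ι → ℝ)) : Set (BlowupAmbient ι) :=
  {p | p ∈ blowupSet Z Y ∧ p.1 ∈ W₀}

/-- A family of charts covering the blow-up gives an atlas, consisting of all the translates of
these charts. -/
noncomputable def blowupAtlas {Z Y : Finset ι} {C : Type} (κ : C → BlowupChart Z Y)
    (hκ : ∀ p ∈ blowupSet Z Y, ∃ c, p ∈ (κ c).O) {W₀ : Set (ι → ℝ)} (hW₀ : IsOpen W₀) :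
    SubmanifoldAtlas (ι → ℝ) (blowupOver Z Y W₀) (C × (ι → ℝ)) where
  O c := (κ c.1).O
  D c := {u | (κ c.1).g (u + c.2) ∈ W₀}
  ψ c p := (κ c.1).ψ p - c.2
  φ c u := (κ c.1).φ (u + c.2)
  isOpen_O c := (κ c.1).isOpen_O
  isOpen_D c := hW₀.preimage
    ((κ c.1).contDiff_g.continuous.comp (continuous_id.add continuous_const))
  contDiffOn_ψ c := (κ c.1).contDiffOn_ψ.sub contDiffOn_const
  contDiffOn_φ c := ((κ c.1).contDiff_φ.comp (contDiff_id.add contDiff_const)).contDiffOn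
  φ_mem c u hu := ⟨(κ c.1).φ_mem _, hu⟩
  φ_mem_O c u _ := (κ c.1).mem_O _
  ψ_mem c p hp hpO := by
    change (κ c.1).g ((κ c.1).ψ p - c.2 + c.2) ∈ W₀
    rw [sub_add_cancel]
    have : ((κ c.1).φ ((κ c.1).ψ p)).1 ∈ W₀ := by rw [(κ c.1).φ_ψ hp.1 hpO]; exact hp.2
    exact this
  ψ_φ c u _ := by
    have := (κ c.1).ψ_eq (u + c.2)
    rw [BlowupChart.φ, this, add_sub_cancel_right]
  φ_ψ c p hp hpO := by rw [sub_add_cancel, (κ c.1).φ_ψ hp.1 hpO]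
  cover p hp := by
    obtain ⟨c, hc⟩ := hκ p hp.1
    exact ⟨(c, 0), hc⟩

end Blowup

theorem contDiffAt_omega_iff_analyticAt {E G : Type} [NormedAddCommGroup E] [NormedSpace ℝ E]
    [NormedAddCommGroup G] [NormedSpace ℝ G] [CompleteSpace G] {f : E → G} {x : E} :
    ContDiffAt ℝ ω f x ↔ AnalyticAt ℝ f x := by
  rw [← contDiffWithinAt_univ, contDiffWithinAt_omega_iff_analyticWithinAt, analyticWithinAt_univ]

/-! ### From the blow-up and its charts to a resolution -/

section Blowup

variable {ι : Type} [Fintype ι] [DecidableEq ι]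

/-- The data from which a resolution is built: unimodular analytic coordinates `Ψ : W₀ → W` with
inverse `Φ`, and a function `F` whose pullback to each chart of the blow-up is a monomial up to a
nowhere vanishing factor. -/
structure BlowupData (Z Y : Finset ι) (F : (ι → ℝ) → ℝ) (P : ι → ℝ) where
  C : Type
  κ : C → BlowupChart Z Y
  cover : ∀ p ∈ blowupSet Z Y, ∃ c, p ∈ (κ c).O
  W₀ : Set (ι → ℝ)
  W : Set (ι → ℝ)
  isOpen_W₀ : IsOpen W₀
  isOpen_W : IsOpen W
  zero_mem : (0 : ι → ℝ) ∈ W₀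
  Ψ : (ι → ℝ) → ι → ℝ
  Φ : (ι → ℝ) → ι → ℝ
  Ψ_mem : ∀ x ∈ W₀, Ψ x ∈ W
  Φ_mem : ∀ y ∈ W, Φ y ∈ W₀
  Φ_Ψ : ∀ x ∈ W₀, Φ (Ψ x) = x
  Ψ_Φ : ∀ y ∈ W, Ψ (Φ y) = y
  Ψ_zero : Ψ 0 = P
  contDiffOn_Ψ : ContDiffOn ℝ ω Ψ W₀
  contDiffOn_Φ : ContDiffOn ℝ ω Φ W
  det_Ψ : ∀ x ∈ W₀, |(fderiv ℝ Ψ x).det| = 1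
  analytic_F : AnalyticOnNhd ℝ F W
  F_eq_zero : ∀ x ∈ W₀, normalPart Z Y x = 0 → F (Ψ x) = 0
  a : C → (ι → ℝ) → ℝ
  contDiffOn_a : ∀ c, ContDiffOn ℝ ω (a c) {u | (κ c).g u ∈ W₀}
  a_ne_zero : ∀ c u, (κ c).g u ∈ W₀ → a c u ≠ 0
  F_g : ∀ c u, (κ c).g u ∈ W₀ → F (Ψ ((κ c).g u)) = a c u * (∏ i, u i ^ (κ c).e i) ^ 2

namespace BlowupData

variable {Z Y : Finset ι} {F : (ι → ℝ) → ℝ} {P : ι → ℝ}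

/-- Recentring a chart keeps only the coordinates that vanish at the new centre in the monomial; the
others become part of the unit. -/
theorem prod_pow_translate (u u₀ : ι → ℝ) (e : ι → ℕ) :
    ∏ i, (u + u₀) i ^ e i = (∏ i, if u₀ i = 0 then 1 else (u i + u₀ i) ^ e i) *
      ∏ i, u i ^ (if u₀ i = 0 then e i else 0) := by
  rw [← Finset.prod_mul_distrib]
  refine Finset.prod_congr rfl fun i _ => ?_
  by_cases h : u₀ i = 0 <;> simp [h]

theorem analyticAt_prod_ite (u₀ : ι → ℝ) (e : ι → ℕ) :
    AnalyticAt ℝ (fun u : ι → ℝ => ∏ i, if u₀ i = 0 then 1 else (u i + u₀ i) ^ e i) 0 := by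
  have : ContDiff ℝ ω (fun u : ι → ℝ => ∏ i, if u₀ i = 0 then 1 else (u i + u₀ i) ^ e i) := by
    refine contDiff_prod fun i _ => ?_
    split_ifs <;> fun_prop
  exact contDiffAt_omega_iff_analyticAt.1 this.contDiffAt

theorem prod_ite_ne_zero (u₀ : ι → ℝ) (e : ι → ℕ) :
    (∏ i, if u₀ i = 0 then (1 : ℝ) else ((0 : ι → ℝ) i + u₀ i) ^ e i) ≠ 0 := by
  refine Finset.prod_ne_zero_iff.2 fun i _ => ?_
  split_ifs with h
  · exact one_ne_zero
  · exact pow_ne_zero _ (by simpa using h)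

variable (D : BlowupData Z Y F P)

/-- The atlas of the blow-up over `W₀`. -/
noncomputable def atlas : SubmanifoldAtlas (ι → ℝ) (blowupOver Z Y D.W₀) (D.C × (ι → ℝ)) :=
  blowupAtlas D.κ D.cover D.isOpen_W₀

/-- A chart around a point of the blow-up. -/
noncomputable def idx (Q : blowupOver Z Y D.W₀) : D.C := (D.cover Q Q.2.1).choose

theorem mem_O_idx (Q : blowupOver Z Y D.W₀) : (Q : BlowupAmbient ι) ∈ (D.κ (D.idx Q)).O :=
  (D.cover Q Q.2.1).choose_spec

/-- The coordinates of a point of the blow-up. -/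
noncomputable def center (Q : blowupOver Z Y D.W₀) : ι → ℝ := (D.κ (D.idx Q)).ψ Q

/-- The coordinates centred at a point of the blow-up. -/
noncomputable def coord (Q : blowupOver Z Y D.W₀) :
    OpenPartialHomeomorph (blowupOver Z Y D.W₀) (ι → ℝ) :=
  D.atlas.chart Q (D.idx Q, D.center Q)

theorem g_center (Q : blowupOver Z Y D.W₀) : (D.κ (D.idx Q)).g (D.center Q) = (Q : BlowupAmbient ι).1 :=
  congrArg Prod.fst ((D.κ (D.idx Q)).φ_ψ Q.2.1 (D.mem_O_idx Q))

theorem eventually_g_mem (Q : blowupOver Z Y D.W₀) :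
    ∀ᶠ u in 𝓝 (0 : ι → ℝ), (D.κ (D.idx Q)).g (u + D.center Q) ∈ D.W₀ := by
  have hc : Continuous fun u => (D.κ (D.idx Q)).g (u + D.center Q) :=
    (D.κ (D.idx Q)).contDiff_g.continuous.comp (continuous_id.add continuous_const)
  refine hc.continuousAt.eventually (D.isOpen_W₀.mem_nhds ?_)
  simp only [zero_add, g_center]
  exact Q.2.2

theorem coord_symm_fst (Q : blowupOver Z Y D.W₀) {u : ι → ℝ}
    (hu : (D.κ (D.idx Q)).g (u + D.center Q) ∈ D.W₀) :
    (((D.coord Q).symm u : blowupOver Z Y D.W₀) : BlowupAmbient ι).1 =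
      (D.κ (D.idx Q)).g (u + D.center Q) :=
  congrArg Prod.fst (D.atlas.coe_param Q (D.idx Q, D.center Q) hu)

/-- The preimage of a compact set K is the part of the blow-up over the compact set Φ(K); it is
closed, with bounded projection matrices. -/
theorem isProperMap : IsProperMap (Set.codRestrict
    (fun p : blowupOver Z Y D.W₀ => D.Ψ (p : BlowupAmbient ι).1) D.W
    fun p => D.Ψ_mem _ p.2.2) := by
  have hcont : Continuous fun p : blowupOver Z Y D.W₀ => D.Ψ (p : BlowupAmbient ι).1 :=
    D.contDiffOn_Ψ.continuousOn.comp_continuous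
      (continuous_fst.comp continuous_subtype_val) fun p => p.2.2
  have : LocallyCompactSpace D.W := D.isOpen_W.locallyCompactSpace
  rw [isProperMap_iff_isCompact_preimage]
  refine ⟨hcont.codRestrict _, fun K hK => ?_⟩
  rw [Topology.IsInducing.subtypeVal.isCompact_iff]
  have hK' : IsCompact (D.Φ '' (((↑) : D.W → ι → ℝ) '' K)) := by
    refine (hK.image continuous_subtype_val).image_of_continuousOn
      (D.contDiffOn_Φ.continuousOn.mono ?_)
    rintro _ ⟨y, _, rfl⟩
    exact y.2
  convert isCompact_blowupSet_inter Z Y hK' using 1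
  ext p
  constructor
  · rintro ⟨q, hq, rfl⟩
    exact ⟨q.2.1, _, ⟨_, hq, rfl⟩, D.Φ_Ψ _ q.2.2⟩
  · rintro ⟨hp, _, ⟨y, hy, rfl⟩, hyp⟩
    have hW : p.1 ∈ D.W₀ := by rw [← hyp]; exact D.Φ_mem _ y.2
    refine ⟨⟨p, hp, hW⟩, ?_, rfl⟩
    have : Set.codRestrict (fun p : blowupOver Z Y D.W₀ => D.Ψ (p : BlowupAmbient ι).1) D.W
        (fun p => D.Ψ_mem _ p.2.2) ⟨p, hp, hW⟩ = y := by
      apply Subtype.ext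
      change D.Ψ p.1 = y
      rw [← hyp, D.Ψ_Φ _ y.2]
    rw [Set.mem_preimage, this]
    exact hy

/-- The inverse of the blow-up map outside of the zero set of `F`; `Q` is a junk value. -/
noncomputable def ginv (Q : blowupOver Z Y D.W₀) (y : ι → ℝ) : blowupOver Z Y D.W₀ :=
  open Classical in
  if h : blowupSection Z Y (D.Φ y) ∈ blowupOver Z Y D.W₀ then ⟨_, h⟩ else Q

theorem normalPart_Φ {y : ι → ℝ} (hy : y ∈ D.W) (hF : F y ≠ 0) :
    normalPart Z Y (D.Φ y) ≠ 0 := by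
  intro h
  have := D.F_eq_zero _ (D.Φ_mem y hy) h
  rw [D.Ψ_Φ y hy] at this
  exact hF this

theorem coe_ginv (Q : blowupOver Z Y D.W₀) {y : ι → ℝ} (hy : y ∈ D.W) (hF : F y ≠ 0) :
    (D.ginv Q y : BlowupAmbient ι) = blowupSection Z Y (D.Φ y) := by
  rw [ginv, dif_pos]
  exact ⟨blowupSection_mem (D.normalPart_Φ hy hF), D.Φ_mem y hy⟩

/-- By the chain rule, since Ψ is unimodular, only the Jacobian of the blow-up chart contributes. -/
theorem contDiffAt_Ψ_g (Q : blowupOver Z Y D.W₀) {u : ι → ℝ}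
    (hu : (D.κ (D.idx Q)).g (u + D.center Q) ∈ D.W₀) :
    |(fderiv ℝ (fun v => D.Ψ ((D.coord Q).symm v : BlowupAmbient ι).1) u).det| =
      |∏ i, (u + D.center Q) i ^ (D.κ (D.idx Q)).h i| := by
  set c := D.κ (D.idx Q) with hc
  have hev : (fun v => D.Ψ ((D.coord Q).symm v : BlowupAmbient ι).1) =ᶠ[𝓝 u]
      fun v => D.Ψ (c.g (v + D.center Q)) := by
    have hcont : Continuous fun u => c.g (u + D.center Q) :=
      c.contDiff_g.continuous.comp (continuous_id.add continuous_const)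
    filter_upwards [hcont.continuousAt.eventually (D.isOpen_W₀.mem_nhds hu)] with v hv
    rw [D.coord_symm_fst Q hv]
  have h1 : HasFDerivAt c.g (fderiv ℝ c.g (u + D.center Q)) (u + D.center Q) :=
    (c.contDiff_g.differentiable (by simp) _).hasFDerivAt
  have h2 : HasFDerivAt (fun v => c.g (v + D.center Q)) (fderiv ℝ c.g (u + D.center Q)) u :=
    (hasFDerivAt_comp_add_right (D.center Q)).2 h1
  have h3 : HasFDerivAt D.Ψ (fderiv ℝ D.Ψ (c.g (u + D.center Q))) (c.g (u + D.center Q)) :=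
    ((D.contDiffOn_Ψ.contDiffAt (D.isOpen_W₀.mem_nhds hu)).differentiableAt (by simp)).hasFDerivAt
  have h6 := (h3.comp u h2).fderiv
  rw [Function.comp_def] at h6
  rw [hev.fderiv_eq, h6, ContinuousLinearMap.det,
    ContinuousLinearMap.toLinearMap_comp, LinearMap.det_comp, abs_mul]
  have h4 := D.det_Ψ _ hu
  have h5 := c.det_g (u + D.center Q)
  rw [ContinuousLinearMap.det] at h4 h5
  rw [h4, h5, one_mul]

/-- A point of the blow-up. -/
theorem nonempty (hZ : Z.Nonempty) : Nonempty (blowupOver Z Y D.W₀) := by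
  obtain ⟨i, hi⟩ := hZ
  have hc : Continuous fun t : ℝ => t • (Pi.single i (1 : ℝ) : ι → ℝ) := by fun_prop
  have h0 : ∀ᶠ t in 𝓝 (0 : ℝ), t • (Pi.single i (1 : ℝ) : ι → ℝ) ∈ D.W₀ :=
    hc.continuousAt.eventually (D.isOpen_W₀.mem_nhds (by simpa using D.zero_mem))
  obtain ⟨t, ht, ht0⟩ := ((h0.filter_mono nhdsWithin_le_nhds).and
    (self_mem_nhdsWithin (s := {0}ᶜ))).exists
  refine ⟨⟨blowupSection Z Y (t • (Pi.single i (1 : ℝ) : ι → ℝ)), blowupSection_mem ?_, ht⟩⟩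
  intro h
  have := congrFun h i
  simp only [normalPart, Finset.mem_union, hi, true_or, if_true, Pi.smul_apply, Pi.single_eq_same,
    smul_eq_mul, mul_one, Pi.zero_apply] at this
  exact ht0 this

/-- The resolution of `F` at `P` given by the blow-up. -/
noncomputable def resolution (p₀ : blowupOver Z Y D.W₀) : Resolution F P :=
  letI := D.atlas.chartedSpace
  { zero := by
      rw [← D.Ψ_zero]
      exact D.F_eq_zero 0 D.zero_mem (by funext i; simp [normalPart])
    W := D.W
    isOpen_W := D.isOpen_W
    mem_W := by
      have h := D.Ψ_mem 0 D.zero_mem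
      rwa [D.Ψ_zero] at h
    analytic_F := D.analytic_F
    U := blowupOver Z Y D.W₀
    topology := inferInstance
    t2 := inferInstance
    charted := inferInstance
    manifold := D.atlas.isManifold
    g := fun p => D.Ψ (p : BlowupAmbient ι).1
    g_mem := fun p => D.Ψ_mem _ p.2.2
    proper_g := D.isProperMap
    analytic_g := D.atlas.contMDiff_restrict (T := Prod.fst ⁻¹' D.W₀)
      (D.isOpen_W₀.preimage continuous_fst) (fun p hp => hp.2)
      (D.contDiffOn_Ψ.comp contDiff_fst.contDiffOn fun _ h => h)
    ginv := D.ginv p₀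
    analytic_ginv := by
      refine D.atlas.contMDiffOn_codRestrict (ContDiffOn.congr
        (f := fun y => blowupSection Z Y (D.Φ y)) ?_ fun y hy => D.coe_ginv p₀ hy.1 hy.2)
      exact (contDiffOn_blowupSection Z Y).comp (D.contDiffOn_Φ.mono fun y hy => hy.1)
        fun y hy => D.normalPart_Φ hy.1 hy.2
    ginv_g := fun p hF => by
      apply Subtype.ext
      rw [D.coe_ginv p₀ (D.Ψ_mem _ p.2.2) hF, D.Φ_Ψ _ p.2.2]
      refine eq_blowupSection p.2.1 fun h => hF (D.F_eq_zero _ p.2.2 h)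
    g_ginv := fun y hy hF => by
      rw [D.coe_ginv p₀ hy hF]
      exact D.Ψ_Φ y hy
    coord := D.coord
    -- The factor 2 appears because F is the square of the monomial up to a unit; coordinates that
    -- are nonzero at the centre get exponent 0.
    k := fun Q i => if D.center Q i = 0 then 2 * (D.κ (D.idx Q)).e i else 0
    h := fun Q i => if D.center Q i = 0 then (D.κ (D.idx Q)).h i else 0
    a := fun Q u => D.a (D.idx Q) (u + D.center Q) *
      ∏ i, if D.center Q i = 0 then 1 else (u i + D.center Q i) ^ (2 * (D.κ (D.idx Q)).e i)
    b := fun Q u =>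
      ∏ i, if D.center Q i = 0 then 1 else (u i + D.center Q i) ^ ((D.κ (D.idx Q)).h i)
    coord_mem := fun Q _ => D.atlas.chart_mem_maximalAtlas Q _
    mem_source := fun Q _ => D.mem_O_idx Q
    coord_self := fun Q _ => sub_self _
    analytic_a := fun Q _ => by
      refine AnalyticAt.mul ?_ (analyticAt_prod_ite _ _)
      have h1 : ContDiffAt ℝ ω (D.a (D.idx Q)) (0 + D.center Q) := by
        have hc := (D.κ (D.idx Q)).contDiff_g.continuous
        refine (D.contDiffOn_a (D.idx Q)).contDiffAt ((D.isOpen_W₀.preimage hc).mem_nhds ?_)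
        rw [zero_add, Set.mem_preimage, g_center]
        exact Q.2.2
      exact contDiffAt_omega_iff_analyticAt.1
        (h1.comp (0 : ι → ℝ) (contDiffAt_id.add contDiffAt_const))
    analytic_b := fun Q _ => analyticAt_prod_ite _ _
    a_ne_zero := fun Q _ => by
      refine mul_ne_zero (D.a_ne_zero _ _ ?_) (prod_ite_ne_zero _ _)
      rw [zero_add, g_center]
      exact Q.2.2
    b_ne_zero := fun Q _ => prod_ite_ne_zero _ _
    normal_crossing := fun Q _ => by
      filter_upwards [D.eventually_g_mem Q] with u hu
      rw [D.coord_symm_fst Q hu, D.F_g _ _ hu, ← Finset.prod_pow]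
      simp only [← pow_mul, mul_comm _ 2]
      rw [prod_pow_translate, mul_assoc]
    jacobian := fun Q _ => by
      filter_upwards [D.eventually_g_mem Q] with u hu
      rw [← prod_pow_translate]
      exact D.contDiffAt_Ψ_g Q hu }

end BlowupData

end Blowup

/-! ### The three families of charts of the twofold blow-up -/

section Blowup

variable {ι : Type} [Fintype ι] [DecidableEq ι]

/-- The chart map of the blow-up of the coordinate subspace `u_p = u_i = 0`, `i ∈ S`. -/
def blowupSubst (p : ι) (S : Finset ι) (u : ι → ℝ) : ι → ℝ :=
  fun i => if i ∈ S then u p * u i else u i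

theorem contDiff_blowupSubst (p : ι) (S : Finset ι) : ContDiff ℝ ω (blowupSubst p S) := by
  refine contDiff_pi.2 fun i => ?_
  unfold blowupSubst
  split_ifs <;> fun_prop

theorem det_fderiv_blowupSubst {p : ι} {S : Finset ι} (hp : p ∉ S) (u : ι → ℝ) :
    (fderiv ℝ (blowupSubst p S) u).det = u p ^ S.card := by
  set L : (ι → ℝ) →L[ℝ] (ι → ℝ) := ContinuousLinearMap.pi fun i =>
    if i ∈ S then u p • ContinuousLinearMap.proj i + u i • ContinuousLinearMap.proj p
      else ContinuousLinearMap.proj i with hL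
  have h1 : HasFDerivAt (blowupSubst p S) L u := by
    refine hasFDerivAt_pi.2 fun i => ?_
    unfold blowupSubst
    split_ifs with h
    · exact (hasFDerivAt_apply p u).mul (hasFDerivAt_apply i u)
    · exact hasFDerivAt_apply i u
  rw [h1.fderiv, ContinuousLinearMap.det]
  -- The derivative is a diagonal scaling followed by a transvection in a direction without
  -- p-component. The transvection has determinant one because p ∉ S.
  have h2 : (L : (ι → ℝ) →ₗ[ℝ] (ι → ℝ)) =
      LinearMap.transvection (LinearMap.proj p) (fun i => if i ∈ S then u i else 0) ∘ₗ
        Matrix.toLin' (Matrix.diagonal fun i => if i ∈ S then u p else 1) := by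
    refine LinearMap.ext fun x => funext fun i => ?_
    by_cases hi : i ∈ S
    · simp [hL, LinearMap.transvection.apply, Matrix.mulVec_diagonal, hi, hp, mul_comm]
    · simp only [hL, LinearMap.transvection.apply, ContinuousLinearMap.coe_coe, ContinuousLinearMap.pi_apply, hi,
        if_false, ContinuousLinearMap.proj_apply, LinearMap.comp_apply, Matrix.toLin'_apply,
        Matrix.mulVec_diagonal, Pi.add_apply, Pi.smul_apply, smul_zero, add_zero, one_mul]
  rw [h2, LinearMap.det_comp, LinearMap.transvection.det, LinearMap.det_toLin',
    Matrix.det_diagonal]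
  simp [hp]

theorem prod_pow_single (u : ι → ℝ) (k : ι) (a : ℕ) :
    ∏ i, u i ^ (Pi.single k a : ι → ℕ) i = u k ^ a := by
  rw [Finset.prod_eq_single k]
  · simp
  · intro i _ hi; simp [hi]
  · simp

theorem prod_pow_single_add (u : ι → ℝ) (j k : ι) (a b : ℕ) :
    ∏ i, u i ^ (Pi.single j a + Pi.single k b : ι → ℕ) i = u j ^ a * u k ^ b := by
  simp only [Pi.add_apply, pow_add, Finset.prod_mul_distrib, prod_pow_single]

theorem det_fderiv_comp_blowupSubst {p : ι} {S : Finset ι} (hp : p ∉ S) {q : ι} {T : Finset ι}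
    (hq : q ∉ T) (u : ι → ℝ) :
    (fderiv ℝ (fun u => blowupSubst p S (blowupSubst q T u)) u).det =
      blowupSubst q T u p ^ S.card * u q ^ T.card := by
  have h1 := ((contDiff_blowupSubst p S).differentiable (by simp) (blowupSubst q T u)).hasFDerivAt
  have h2 := ((contDiff_blowupSubst q T).differentiable (by simp) u).hasFDerivAt
  have h3 := (h1.comp u h2).fderiv
  rw [Function.comp_def] at h3
  have h4 := det_fderiv_blowupSubst hp (blowupSubst q T u)
  have h5 := det_fderiv_blowupSubst hq u
  rw [ContinuousLinearMap.det] at h4 h5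
  rw [h3, ContinuousLinearMap.det, ContinuousLinearMap.toLinearMap_comp, LinearMap.det_comp,
    h4, h5]

theorem dense_ne_zero (i j : ι) : Dense {u : ι → ℝ | u i ≠ 0 ∧ u j ≠ 0} := by
  have h (i : ι) : Dense {u : ι → ℝ | u i ≠ 0} :=
    (dense_compl_singleton (0 : ℝ)).preimage (isOpenMap_eval i)
  exact (h i).inter_of_isOpen_left (h j) (isOpen_ne.preimage (continuous_apply i))

variable {Z Y : Finset ι}

theorem normalPart_apply_of_mem_left {i : ι} (hi : i ∈ Z) (x : ι → ℝ) :
    normalPart Z Y x i = x i := by simp [normalPart, hi]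

theorem normalPart_apply_of_mem_right {i : ι} (hi : i ∈ Y) (x : ι → ℝ) :
    normalPart Z Y x i = x i := by simp [normalPart, hi]

/-- The chart in which `z = u_k² z'` and `y = u_k y'`. -/
noncomputable def blowupChartQuad (hZY : Disjoint Z Y) {k : ι} (hk : k ∈ Y) :
    BlowupChart Z Y where
  g u := blowupSubst k ((Z ∪ Y).erase k) (blowupSubst k Z u)
  w u i := if i = k then 1 else if i ∈ Y then u i else if i ∈ Z then u k * u i else 0
  v u
    | none => 1 + ∑ i ∈ Y.erase k, u i ^ 2
    | some i => if i ∈ Z then u i else 0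
  m u := u k
  n _ := 1
  e := Pi.single k 2
  h := Pi.single k ((Z ∪ Y).card - 1 + Z.card)
  O := {p | p.2.1 k k ≠ 0 ∧ p.2.2 none none ≠ 0}
  -- The Z-coordinates are z_i / y_k², written as z_i / ∑ y_l² times ∑ (y_l / y_k)² so that both
  -- factors extend to the exceptional set.
  ψ p i := if i = k then p.1 k else if i ∈ Y then p.2.1 i k / p.2.1 k k
    else if i ∈ Z then p.2.2 (some i) none / p.2.2 none none *
      ∑ l ∈ Y, (p.2.1 l k / p.2.1 k k) ^ 2 else p.1 i
  contDiff_g := (contDiff_blowupSubst _ _).comp (contDiff_blowupSubst _ _)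
  contDiff_w := by
    refine contDiff_pi.2 fun i => ?_
    split_ifs <;> fun_prop
  contDiff_v := by
    refine contDiff_pi.2 fun i => ?_
    cases i with
    | none => fun_prop
    | some i => simp only; split_ifs <;> fun_prop
  contDiff_n := contDiff_const
  w_ne_zero u h := by simpa using congrFun h k
  v_ne_zero u h := by
    have h1 := congrFun h none
    have h2 : 0 ≤ ∑ i ∈ Y.erase k, u i ^ 2 := Finset.sum_nonneg fun _ _ => sq_nonneg _
    simp only [Pi.zero_apply] at h1
    linarith
  normalPart_g u := by
    have hkZ : k ∉ Z := Finset.disjoint_right.1 hZY hk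
    funext i
    by_cases hik : i = k
    · subst hik
      simp [normalPart, blowupSubst, hk, hkZ]
    · by_cases hiY : i ∈ Y
      · have hiZ : i ∉ Z := Finset.disjoint_right.1 hZY hiY
        simp [normalPart, blowupSubst, hiY, hiZ, hkZ, hik]
      · by_cases hiZ : i ∈ Z
        · simp [normalPart, blowupSubst, hiY, hiZ, hkZ, hik]
        · simp [normalPart, hiY, hiZ, hik]
  quadPart_g u := by
    have hkZ : k ∉ Z := Finset.disjoint_right.1 hZY hk
    rw [prod_pow_single]
    funext i
    cases i with
    | none =>
      simp only [quadPart, Pi.smul_apply, smul_eq_mul]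
      rw [← Finset.add_sum_erase _ _ hk, mul_add, Finset.mul_sum]
      congr 1
      · simp [blowupSubst, hkZ]
      · refine Finset.sum_congr rfl fun i hi => ?_
        have hiZ : i ∉ Z := Finset.disjoint_right.1 hZY (Finset.mem_of_mem_erase hi)
        simp [blowupSubst, hkZ, hiZ, Finset.ne_of_mem_erase hi, Finset.mem_of_mem_erase hi, mul_pow]
    | some i =>
      by_cases hiZ : i ∈ Z
      · have hik : i ≠ k := fun h => hkZ (h ▸ hiZ)
        simp [quadPart, blowupSubst, hiZ, hik, hkZ]; ring
      · simp [quadPart, hiZ]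
  m_sq u := by rw [prod_pow_single, mul_one]
  det_g u := by
    have hkZ : k ∉ Z := Finset.disjoint_right.1 hZY hk
    rw [det_fderiv_comp_blowupSubst (Finset.notMem_erase _ _) hkZ, prod_pow_single,
      Finset.card_erase_of_mem (Finset.mem_union_right _ hk), pow_add]
    simp [blowupSubst, hkZ]
  isOpen_O := by
    refine IsOpen.and ?_ ?_
    · exact isOpen_ne_fun (by fun_prop) (by fun_prop)
    · exact isOpen_ne_fun (by fun_prop) (by fun_prop)
  contDiffOn_ψ := by
    have h1 : ∀ i, ContDiffOn ℝ ω (fun p : BlowupAmbient ι => p.2.1 i k / p.2.1 k k)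
        {p | p.2.1 k k ≠ 0 ∧ p.2.2 none none ≠ 0} := fun i =>
      ContDiffOn.div (by fun_prop) (by fun_prop) fun p hp => hp.1
    have h2 : ∀ i, ContDiffOn ℝ ω (fun p : BlowupAmbient ι => p.2.2 i none / p.2.2 none none)
        {p | p.2.1 k k ≠ 0 ∧ p.2.2 none none ≠ 0} := fun i =>
      ContDiffOn.div (by fun_prop) (by fun_prop) fun p hp => hp.2
    refine contDiffOn_pi.2 fun i => ?_
    split_ifs
    · fun_prop
    · exact h1 i
    · exact (h2 _).mul (ContDiffOn.sum fun l _ => (h1 l).pow 2)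
    · fun_prop
  dense := by
    simp only [prod_pow_single]
    refine (dense_ne_zero k k).mono fun u hu => ⟨hu.1, pow_ne_zero 2 hu.1⟩
  mem_O u := by
    have h2 : 0 < 1 + ∑ i ∈ Y.erase k, u i ^ 2 :=
      add_pos_of_pos_of_nonneg one_pos (Finset.sum_nonneg fun _ _ => sq_nonneg _)
    rw [Set.mem_ofPred_eq]
    dsimp only
    exact ⟨lineProj_self_ne_zero (by simp), lineProj_self_ne_zero h2.ne'⟩
  ψ_eq u := by
    have hkZ : k ∉ Z := Finset.disjoint_right.1 hZY hk
    have h2 : 0 < 1 + ∑ i ∈ Y.erase k, u i ^ 2 :=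
      add_pos_of_pos_of_nonneg one_pos (Finset.sum_nonneg fun _ _ => sq_nonneg _)
    generalize hw : (fun i => if i = k then (1 : ℝ) else if i ∈ Y then u i
      else if i ∈ Z then u k * u i else 0) = w
    have hwk : w k = 1 := by simp [← hw]
    have hwY : ∀ i ∈ Y, i ≠ k → w i = u i := fun i hi hik => by simp [← hw, hi, hik]
    have hA : ∀ i, lineProj w i k / lineProj w k k = w i := fun i => by
      rw [lineProj_div _ _ (by rw [hwk]; exact one_ne_zero), hwk, div_one]
    have hsum : ∑ l ∈ Y, w l ^ 2 = 1 + ∑ i ∈ Y.erase k, u i ^ 2 := by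
      rw [← Finset.add_sum_erase _ _ hk, hwk, one_pow]
      congr 1
      exact Finset.sum_congr rfl fun l hl => by
        rw [hwY l (Finset.mem_of_mem_erase hl) (Finset.ne_of_mem_erase hl)]
    simp only [hA, hsum]
    funext i
    rw [lineProj_div (some i) none h2.ne']
    by_cases hik : i = k
    · subst hik
      simp [blowupSubst, hkZ]
    · by_cases hiY : i ∈ Y
      · simp [hik, hiY, hwY]
      · by_cases hiZ : i ∈ Z
        · simp only [hik, hiY, hiZ, if_true, if_false]
          field_simp
        · simp [hik, hiY, hiZ, blowupSubst]
  g_ψ x hx hxO := by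
    have hkZ : k ∉ Z := Finset.disjoint_right.1 hZY hk
    have hxk : x k ≠ 0 := by
      have := (lineProj_self_ne_zero_iff hx k).1 hxO.1
      rwa [normalPart_apply_of_mem_right hk] at this
    have hq : quadPart Z Y x none ≠ 0 :=
      (lineProj_self_ne_zero_iff (quadPart_ne_zero hx) none).1 hxO.2
    have hA : ∀ i, lineProj (normalPart Z Y x) i k / lineProj (normalPart Z Y x) k k =
        normalPart Z Y x i / x k := fun i => by
      rw [lineProj_div _ _ (by rwa [normalPart_apply_of_mem_right hk]),
        normalPart_apply_of_mem_right hk]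
    have hsum : ∑ l ∈ Y, (normalPart Z Y x l / x k) ^ 2 = quadPart Z Y x none / x k ^ 2 := by
      rw [quadPart, Finset.sum_div]
      exact Finset.sum_congr rfl fun l hl => by rw [normalPart_apply_of_mem_right hl, div_pow]
    simp only [blowupSection, hA, lineProj_div _ _ hq, hsum, prod_pow_single, if_true]
    refine ⟨?_, hxk, pow_ne_zero 2 hxk⟩
    funext i
    by_cases hik : i = k
    · subst hik
      simp [blowupSubst, hkZ]
    · by_cases hiY : i ∈ Y
      · have hiZ : i ∉ Z := Finset.disjoint_right.1 hZY hiY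
        simp [blowupSubst, hiY, hiZ, hkZ, hik, normalPart_apply_of_mem_right]
        field_simp
      · by_cases hiZ : i ∈ Z
        · have hqi : quadPart Z Y x (some i) = x i := by simp [quadPart, hiZ]
          simp [blowupSubst, hiY, hiZ, hkZ, hik, hqi]
          field_simp
        · simp [blowupSubst, hiY, hiZ, hik]
  pos u := by
    refine add_pos_of_nonneg_of_pos (Finset.sum_nonneg fun _ _ => sq_nonneg _) ?_
    simp only [one_pow, one_mul]
    exact Finset.sum_pos' (fun _ _ => by positivity) ⟨k, hk, by simp⟩

/-- The chart in which `z_j = u_j² u_k`, `z = u_j² u_k z'` and `y = u_j u_k y'`. -/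
noncomputable def blowupChartMixed (hZY : Disjoint Z Y) {k j : ι} (hk : k ∈ Y) (hj : j ∈ Z) :
    BlowupChart Z Y where
  g u := blowupSubst k ((Z ∪ Y).erase k) (blowupSubst j (insert k (Z.erase j)) u)
  w u i := if i = k then 1 else if i ∈ Y then u i else if i = j then u j
    else if i ∈ Z then u j * u i else 0
  v u
    | none => u k * (1 + ∑ i ∈ Y.erase k, u i ^ 2)
    | some i => if i = j then 1 else if i ∈ Z then u i else 0
  m u := u j * u k
  n u := u k
  e := Pi.single j 2 + Pi.single k 1
  h := Pi.single j ((Z ∪ Y).card - 1 + Z.card) + Pi.single k ((Z ∪ Y).card - 1)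
  O := {p | p.2.1 k k ≠ 0 ∧ p.2.2 (some j) (some j) ≠ 0}
  -- The new u_k is y_k² / z_j, again obtained from ∑ y_l² / z_j, and the new u_j is z_j / y_k.
  ψ p i := if i = k then p.2.2 none (some j) / p.2.2 (some j) (some j) /
      ∑ l ∈ Y, (p.2.1 l k / p.2.1 k k) ^ 2
    else if i ∈ Y ∨ i = j then p.2.1 i k / p.2.1 k k
    else if i ∈ Z then p.2.2 (some i) (some j) / p.2.2 (some j) (some j) else p.1 i
  contDiff_g := (contDiff_blowupSubst _ _).comp (contDiff_blowupSubst _ _)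
  contDiff_w := by
    refine contDiff_pi.2 fun i => ?_
    split_ifs <;> fun_prop
  contDiff_v := by
    refine contDiff_pi.2 fun i => ?_
    cases i with
    | none => fun_prop
    | some i => simp only; split_ifs <;> fun_prop
  contDiff_n := by fun_prop
  w_ne_zero u h := by simpa using congrFun h k
  v_ne_zero u h := by simpa using congrFun h (some j)
  normalPart_g u := by
    have hkZ : k ∉ Z := Finset.disjoint_right.1 hZY hk
    have hjY : j ∉ Y := Finset.disjoint_left.1 hZY hj
    have hjk : j ≠ k := fun h => hkZ (h ▸ hj)
    funext i
    by_cases hik : i = k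
    · subst hik
      simp [normalPart, blowupSubst, hk]
    · by_cases hiY : i ∈ Y
      · have hiZ : i ∉ Z := Finset.disjoint_right.1 hZY hiY
        simp [normalPart, blowupSubst, hiY, hiZ, hik]
      · by_cases hij : i = j
        · subst hij
          simp [normalPart, blowupSubst, hiY, hj, hik]
        · by_cases hiZ : i ∈ Z
          · simp [normalPart, blowupSubst, hiY, hiZ, hik, hij]
          · simp [normalPart, hiY, hiZ, hik, hij]
  quadPart_g u := by
    have hkZ : k ∉ Z := Finset.disjoint_right.1 hZY hk
    have hjk : j ≠ k := fun h => hkZ (h ▸ hj)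
    rw [prod_pow_single_add]
    funext i
    cases i with
    | none =>
      simp only [quadPart, Pi.smul_apply, smul_eq_mul]
      rw [← Finset.add_sum_erase _ _ hk, mul_add, mul_add, Finset.mul_sum, Finset.mul_sum]
      congr 1
      · simp [blowupSubst]; ring
      · refine Finset.sum_congr rfl fun i hi => ?_
        have hiZ : i ∉ Z := Finset.disjoint_right.1 hZY (Finset.mem_of_mem_erase hi)
        simp [blowupSubst, hiZ, Finset.ne_of_mem_erase hi, Finset.mem_of_mem_erase hi]
        ring
    | some i =>
      by_cases hij : i = j
      · subst hij
        simp [quadPart, blowupSubst, hj, hjk]; ring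
      · by_cases hiZ : i ∈ Z
        · have hik : i ≠ k := fun h => hkZ (h ▸ hiZ)
          simp [quadPart, blowupSubst, hiZ, hik, hij]; ring
        · simp [quadPart, hiZ, hij]
  m_sq u := by rw [prod_pow_single_add]; ring
  det_g u := by
    have hkZ : k ∉ Z := Finset.disjoint_right.1 hZY hk
    have hjk : j ≠ k := fun h => hkZ (h ▸ hj)
    rw [det_fderiv_comp_blowupSubst (Finset.notMem_erase _ _) (by simp [hjk]),
      prod_pow_single_add, Finset.card_erase_of_mem (Finset.mem_union_right _ hk),
      Finset.card_insert_of_notMem (by simp [hkZ]), Finset.card_erase_add_one hj, pow_add]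
    simp [blowupSubst]
    ring
  isOpen_O := by
    refine IsOpen.and ?_ ?_
    · exact isOpen_ne_fun (by fun_prop) (by fun_prop)
    · exact isOpen_ne_fun (by fun_prop) (by fun_prop)
  contDiffOn_ψ := by
    have h1 : ∀ i, ContDiffOn ℝ ω (fun p : BlowupAmbient ι => p.2.1 i k / p.2.1 k k)
        {p | p.2.1 k k ≠ 0 ∧ p.2.2 (some j) (some j) ≠ 0} := fun i =>
      ContDiffOn.div (by fun_prop) (by fun_prop) fun p hp => hp.1
    have h2 : ∀ i, ContDiffOn ℝ ω
        (fun p : BlowupAmbient ι => p.2.2 i (some j) / p.2.2 (some j) (some j))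
        {p | p.2.1 k k ≠ 0 ∧ p.2.2 (some j) (some j) ≠ 0} := fun i =>
      ContDiffOn.div (by fun_prop) (by fun_prop) fun p hp => hp.2
    refine contDiffOn_pi.2 fun i => ?_
    split_ifs
    · refine (h2 _).div (ContDiffOn.sum fun l _ => (h1 l).pow 2) fun p hp => ?_
      refine (Finset.sum_pos' (fun _ _ => sq_nonneg _) ⟨k, hk, ?_⟩).ne'
      rw [div_self hp.1]; norm_num
    · exact h1 i
    · exact h2 _
    · fun_prop
  dense := by
    simp only [prod_pow_single_add]
    exact (dense_ne_zero j k).mono fun u hu =>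
      ⟨mul_ne_zero hu.1 hu.2, mul_ne_zero (pow_ne_zero 2 hu.1) (pow_ne_zero 1 hu.2)⟩
  mem_O u := by
    rw [Set.mem_ofPred_eq]
    dsimp only
    exact ⟨lineProj_self_ne_zero (by simp), lineProj_self_ne_zero (by simp)⟩
  ψ_eq u := by
    have hkZ : k ∉ Z := Finset.disjoint_right.1 hZY hk
    have hjY : j ∉ Y := Finset.disjoint_left.1 hZY hj
    have hjk : j ≠ k := fun h => hkZ (h ▸ hj)
    have h2 : 0 < 1 + ∑ i ∈ Y.erase k, u i ^ 2 :=
      add_pos_of_pos_of_nonneg one_pos (Finset.sum_nonneg fun _ _ => sq_nonneg _)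
    generalize hw : (fun i => if i = k then (1 : ℝ) else if i ∈ Y then u i else if i = j then u j
      else if i ∈ Z then u j * u i else 0) = w
    have hwk : w k = 1 := by simp [← hw]
    have hwj : w j = u j := by simp [← hw, hjk, hjY]
    have hwY : ∀ i ∈ Y, i ≠ k → w i = u i := fun i hi hik => by simp [← hw, hi, hik]
    have hA : ∀ i, lineProj w i k / lineProj w k k = w i := fun i => by
      rw [lineProj_div _ _ (by rw [hwk]; exact one_ne_zero), hwk, div_one]
    have hsum : ∑ l ∈ Y, w l ^ 2 = 1 + ∑ i ∈ Y.erase k, u i ^ 2 := by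
      rw [← Finset.add_sum_erase _ _ hk, hwk, one_pow]
      congr 1
      exact Finset.sum_congr rfl fun l hl => by
        rw [hwY l (Finset.mem_of_mem_erase hl) (Finset.ne_of_mem_erase hl)]
    simp only [hA, hsum]
    funext i
    rw [lineProj_div none (some j) (by simp), lineProj_div (some i) (some j) (by simp)]
    by_cases hik : i = k
    · subst hik
      simp [h2.ne']
    · by_cases hiY : i ∈ Y
      · simp [hik, hiY, hwY]
      · by_cases hij : i = j
        · subst hij
          simp [hik, hwj]
        · by_cases hiZ : i ∈ Z
          · simp [hik, hiY, hiZ, hij]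
          · simp [hik, hiY, hiZ, hij, blowupSubst]
  g_ψ x hx hxO := by
    have hkZ : k ∉ Z := Finset.disjoint_right.1 hZY hk
    have hjY : j ∉ Y := Finset.disjoint_left.1 hZY hj
    have hjk : j ≠ k := fun h => hkZ (h ▸ hj)
    have hxk : x k ≠ 0 := by
      have := (lineProj_self_ne_zero_iff hx k).1 hxO.1
      rwa [normalPart_apply_of_mem_right hk] at this
    have hqj : quadPart Z Y x (some j) = x j := by simp [quadPart, hj]
    have hxj : x j ≠ 0 := by
      have := (lineProj_self_ne_zero_iff (quadPart_ne_zero hx) (some j)).1 hxO.2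
      rwa [hqj] at this
    have hq : quadPart Z Y x none ≠ 0 :=
      (Finset.sum_pos' (fun _ _ => sq_nonneg _) ⟨k, hk, pow_two_pos_of_ne_zero hxk⟩).ne'
    have hA : ∀ i, lineProj (normalPart Z Y x) i k / lineProj (normalPart Z Y x) k k =
        normalPart Z Y x i / x k := fun i => by
      rw [lineProj_div _ _ (by rwa [normalPart_apply_of_mem_right hk]),
        normalPart_apply_of_mem_right hk]
    have hB : ∀ i, lineProj (quadPart Z Y x) i (some j) /
        lineProj (quadPart Z Y x) (some j) (some j) = quadPart Z Y x i / x j := fun i => by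
      rw [lineProj_div _ _ (by rwa [hqj]), hqj]
    have hsum : ∑ l ∈ Y, (normalPart Z Y x l / x k) ^ 2 = quadPart Z Y x none / x k ^ 2 := by
      rw [quadPart, Finset.sum_div]
      exact Finset.sum_congr rfl fun l hl => by rw [normalPart_apply_of_mem_right hl, div_pow]
    have huk : quadPart Z Y x none / x j / (quadPart Z Y x none / x k ^ 2) = x k ^ 2 / x j := by
      field_simp
    simp only [blowupSection, hA, hB, hsum, huk, prod_pow_single_add, if_true, hjk, or_true,
      if_false, normalPart_apply_of_mem_left hj]
    refine ⟨?_, by positivity, by positivity⟩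
    funext i
    by_cases hik : i = k
    · subst hik
      simp [blowupSubst, hjk, normalPart_apply_of_mem_left hj]
      field_simp
    · by_cases hiY : i ∈ Y
      · have hiZ : i ∉ Z := Finset.disjoint_right.1 hZY hiY
        simp [blowupSubst, hiY, hiZ, hjk, hik, normalPart_apply_of_mem_right,
          normalPart_apply_of_mem_left hj]
        field_simp
      · by_cases hij : i = j
        · subst hij
          simp [blowupSubst, hik, hj, normalPart_apply_of_mem_left hj]
          field_simp
        · by_cases hiZ : i ∈ Z
          · have hqi : quadPart Z Y x (some i) = x i := by simp [quadPart, hiZ]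
            simp [blowupSubst, hiY, hiZ, hjk, hik, hij, hqi, normalPart_apply_of_mem_left hj]
            field_simp
          · simp [blowupSubst, hiY, hiZ, hik, hij]
  pos u := by
    refine add_pos_of_pos_of_nonneg (Finset.sum_pos' (fun _ _ => sq_nonneg _) ⟨j, hj, ?_⟩)
      (mul_nonneg (sq_nonneg _) (Finset.sum_nonneg fun _ _ => by positivity))
    simp

/-- The chart in which `z_j = u_j`, `z = u_j z'` and `y = u_j y'`. -/
noncomputable def blowupChartLinear (hZY : Disjoint Z Y) {j : ι} (hj : j ∈ Z) :
    BlowupChart Z Y where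
  g u := blowupSubst j ((Z ∪ Y).erase j) u
  w u i := if i = j then 1 else if i ∈ Z ∪ Y then u i else 0
  v u
    | none => u j * ∑ i ∈ Y, u i ^ 2
    | some i => if i = j then 1 else if i ∈ Z then u i else 0
  m u := u j
  n u := u j
  e := Pi.single j 1
  h := Pi.single j ((Z ∪ Y).card - 1)
  -- No condition on the second line is needed: the second centre, where all strict transforms of
  -- the z_i vanish, does not meet this chart.
  O := {p | p.2.1 j j ≠ 0}
  ψ p i := if i = j then p.1 j else if i ∈ Z ∪ Y then p.2.1 i j / p.2.1 j j else p.1 i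
  contDiff_g := contDiff_blowupSubst _ _
  contDiff_w := by
    refine contDiff_pi.2 fun i => ?_
    split_ifs <;> fun_prop
  contDiff_v := by
    refine contDiff_pi.2 fun i => ?_
    cases i with
    | none => fun_prop
    | some i => simp only; split_ifs <;> fun_prop
  contDiff_n := by fun_prop
  w_ne_zero u h := by simpa using congrFun h j
  v_ne_zero u h := by simpa using congrFun h (some j)
  normalPart_g u := by
    funext i
    by_cases hij : i = j
    · subst hij
      simp [normalPart, blowupSubst, hj]
    · by_cases hi : i ∈ Z ∪ Y
      · simp only [normalPart, hi, if_true, blowupSubst, Finset.mem_erase, ne_eq, hij,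
          not_false_eq_true, and_self, Pi.smul_apply, if_false, smul_eq_mul]
      · simp only [normalPart, hi, if_false, hij, Pi.smul_apply, smul_eq_mul, mul_zero]
  quadPart_g u := by
    have hjY : j ∉ Y := Finset.disjoint_left.1 hZY hj
    rw [prod_pow_single]
    funext i
    cases i with
    | none =>
      simp only [quadPart, Pi.smul_apply, smul_eq_mul]
      rw [Finset.mul_sum, Finset.mul_sum]
      refine Finset.sum_congr rfl fun i hi => ?_
      have hij : i ≠ j := fun h => hjY (h ▸ hi)
      simp [blowupSubst, hi, hij]
      ring
    | some i =>
      by_cases hij : i = j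
      · subst hij
        simp [quadPart, blowupSubst, hj]
      · by_cases hiZ : i ∈ Z
        · simp [quadPart, blowupSubst, hiZ, hij]
        · simp [quadPart, hiZ, hij]
  m_sq u := by rw [prod_pow_single]; ring
  det_g u := by
    have h : blowupSubst j ((Z ∪ Y).erase j) = fun u => blowupSubst j ((Z ∪ Y).erase j) u := rfl
    rw [← h, det_fderiv_blowupSubst (Finset.notMem_erase _ _), prod_pow_single,
      Finset.card_erase_of_mem (Finset.mem_union_left _ hj)]
  isOpen_O := isOpen_ne_fun (by fun_prop) (by fun_prop)
  contDiffOn_ψ := by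
    refine contDiffOn_pi.2 fun i => ?_
    split_ifs
    · fun_prop
    · exact ContDiffOn.div (by fun_prop) (by fun_prop) fun p hp => hp
    · fun_prop
  dense := by
    simp only [prod_pow_single]
    exact (dense_ne_zero j j).mono fun u hu => ⟨hu.1, pow_ne_zero 1 hu.2⟩
  mem_O u := by
    rw [Set.mem_ofPred_eq]
    dsimp only
    exact lineProj_self_ne_zero (by simp)
  ψ_eq u := by
    generalize hw : (fun i => if i = j then (1 : ℝ) else if i ∈ Z ∪ Y then u i else 0) = w
    have hwj : w j = 1 := by simp [← hw]
    have hwi : ∀ i ∈ Z ∪ Y, i ≠ j → w i = u i := fun i hi hij => by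
      simp only [← hw, hi, hij, if_true, if_false]
    have hA : ∀ i, lineProj w i j / lineProj w j j = w i := fun i => by
      rw [lineProj_div _ _ (by rw [hwj]; exact one_ne_zero), hwj, div_one]
    simp only [hA]
    funext i
    by_cases hij : i = j
    · subst hij
      simp [blowupSubst]
    · by_cases hi : i ∈ Z ∪ Y
      · simp only [hij, hi, if_true, if_false, hwi i hi hij]
      · simp only [hij, hi, if_false, blowupSubst, Finset.mem_erase, and_false]
  g_ψ x hx hxO := by
    have hxj : x j ≠ 0 := by
      have := (lineProj_self_ne_zero_iff hx j).1 hxO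
      rwa [normalPart_apply_of_mem_left hj] at this
    have hA : ∀ i, lineProj (normalPart Z Y x) i j / lineProj (normalPart Z Y x) j j =
        normalPart Z Y x i / x j := fun i => by
      rw [lineProj_div _ _ (by rwa [normalPart_apply_of_mem_left hj]),
        normalPart_apply_of_mem_left hj]
    simp only [blowupSection, hA, prod_pow_single, if_true]
    refine ⟨?_, hxj, pow_ne_zero 1 hxj⟩
    funext i
    by_cases hij : i = j
    · subst hij
      simp [blowupSubst]
    · by_cases hi : i ∈ Z ∪ Y
      · have : normalPart Z Y x i = x i := by simp only [normalPart, hi, if_true]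
        simp only [blowupSubst, Finset.mem_erase, hij, hi, ne_eq, not_false_eq_true, and_self,
          if_true, if_false, this]
        field_simp
      · simp only [blowupSubst, Finset.mem_erase, hij, hi, and_false, if_false]
  pos u := by
    refine add_pos_of_pos_of_nonneg (Finset.sum_pos' (fun _ _ => sq_nonneg _) ⟨j, hj, ?_⟩)
      (mul_nonneg (sq_nonneg _) (Finset.sum_nonneg fun _ _ => by positivity))
    simp

/-- The charts of the twofold blow-up. -/
noncomputable def blowupCharts (hZY : Disjoint Z Y) : (Z ⊕ Y ⊕ Y × Z) → BlowupChart Z Y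
  | Sum.inl j => blowupChartLinear hZY j.2
  | Sum.inr (Sum.inl k) => blowupChartQuad hZY k.2
  | Sum.inr (Sum.inr kj) => blowupChartMixed hZY kj.1.2 kj.2.2

/-- A nonzero diagonal entry of the first projection selects a direction in Z or Y. A direction in Z
is already covered; in Y, a nonzero diagonal entry of the second projection decides between the
quadratic and the mixed chart. -/
theorem blowupCharts_cover (hZY : Disjoint Z Y) {p : BlowupAmbient ι} (hp : p ∈ blowupSet Z Y) :
    ∃ c, p ∈ (blowupCharts hZY c).O := by
  obtain ⟨⟨h1, h2⟩, h3, h4, -, -⟩ := blowupSet_subset Z Y hp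
  obtain ⟨i, -, hi⟩ := Finset.exists_ne_zero_of_sum_ne_zero (h1.trans_ne one_ne_zero)
  have hiZY : i ∈ Z ∪ Y := by
    by_contra h
    exact hi (h3 i h)
  rcases Finset.mem_union.1 hiZY with hiZ | hiY
  · exact ⟨Sum.inl ⟨i, hiZ⟩, hi⟩
  · obtain ⟨a, -, ha⟩ := Finset.exists_ne_zero_of_sum_ne_zero (h2.trans_ne one_ne_zero)
    cases a with
    | none => exact ⟨Sum.inr (Sum.inl ⟨i, hiY⟩), hi, ha⟩
    | some j =>
      have hj : j ∈ Z := by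
        by_contra h
        exact ha (h4 j h)
      exact ⟨Sum.inr (Sum.inr (⟨i, hiY⟩, ⟨j, hj⟩)), hi, ha⟩

end Blowup

/-! ### Volume growth for functions comparable to ∑ z_i² + ∑ y_j⁴ -/

section NormalForm

variable {ι : Type} [Fintype ι] [DecidableEq ι]

/-- `f` belongs, near `0`, to the ideal generated by the coordinates in `Z` and by the products of
two coordinates in `Y`. -/
def InQuadIdeal (Z Y : Finset ι) (f : (ι → ℝ) → ℝ) : Prop :=
  ∃ (A : ι → (ι → ℝ) → ℝ) (B : ι → ι → (ι → ℝ) → ℝ),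
    (∀ i, AnalyticAt ℝ (A i) 0) ∧ (∀ i j, AnalyticAt ℝ (B i j) 0) ∧
    ∀ᶠ x in 𝓝 (0 : ι → ℝ),
      f x = ∑ i ∈ Z, x i * A i x + ∑ i ∈ Y, ∑ j ∈ Y, x i * x j * B i j x

/-- Unimodular analytic coordinates `Ψ` around `P = Ψ 0`, with inverse `Φ`. -/
structure UnimodularCoords (P : ι → ℝ) (W₀ W : Set (ι → ℝ)) (Ψ Φ : (ι → ℝ) → ι → ℝ) : Prop where
  isOpen_W₀ : IsOpen W₀
  isOpen_W : IsOpen W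
  zero_mem : (0 : ι → ℝ) ∈ W₀
  Ψ_mem : ∀ x ∈ W₀, Ψ x ∈ W
  Φ_mem : ∀ y ∈ W, Φ y ∈ W₀
  Φ_Ψ : ∀ x ∈ W₀, Φ (Ψ x) = x
  Ψ_Φ : ∀ y ∈ W, Ψ (Φ y) = y
  Ψ_zero : Ψ 0 = P
  contDiffOn_Ψ : ContDiffOn ℝ ω Ψ W₀
  contDiffOn_Φ : ContDiffOn ℝ ω Φ W
  det_Ψ : ∀ x ∈ W₀, |(fderiv ℝ Ψ x).det| = 1

namespace UnimodularCoords

variable {P : ι → ℝ} {W₀ W : Set (ι → ℝ)} {Ψ Φ : (ι → ℝ) → ι → ℝ}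

theorem restrict (H : UnimodularCoords P W₀ W Ψ Φ) {T : Set (ι → ℝ)} (hT : T ∈ 𝓝 0) :
    UnimodularCoords P (W₀ ∩ interior T) (W ∩ Φ ⁻¹' (interior T)) Ψ Φ where
  isOpen_W₀ := H.isOpen_W₀.inter isOpen_interior
  isOpen_W := H.contDiffOn_Φ.continuousOn.isOpen_inter_preimage H.isOpen_W isOpen_interior
  zero_mem := ⟨H.zero_mem, mem_interior_iff_mem_nhds.2 hT⟩
  Ψ_mem x hx := ⟨H.Ψ_mem x hx.1, by rw [Set.mem_preimage, H.Φ_Ψ x hx.1]; exact hx.2⟩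
  Φ_mem y hy := ⟨H.Φ_mem y hy.1, hy.2⟩
  Φ_Ψ x hx := H.Φ_Ψ x hx.1
  Ψ_Φ y hy := H.Ψ_Φ y hy.1
  Ψ_zero := H.Ψ_zero
  contDiffOn_Ψ := H.contDiffOn_Ψ.mono Set.inter_subset_left
  contDiffOn_Φ := H.contDiffOn_Φ.mono Set.inter_subset_left
  det_Ψ x hx := H.det_Ψ x hx.1

open MeasureTheory in
theorem volume_image (H : UnimodularCoords P W₀ W Ψ Φ) {S : Set (ι → ℝ)} (hS : MeasurableSet S)
    (hSW : S ⊆ W₀) : volume (Ψ '' S) = volume S := by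
  have hinj : Set.InjOn Ψ S := fun x hx y hy hxy => by
    rw [← H.Φ_Ψ x (hSW hx), ← H.Φ_Ψ y (hSW hy), hxy]
  rw [← lintegral_abs_det_fderiv_eq_addHaar_image volume hS
    (fun u hu => ((H.contDiffOn_Ψ.contDiffAt (H.isOpen_W₀.mem_nhds (hSW hu))).differentiableAt
      (by simp)).hasFDerivAt.hasFDerivWithinAt) hinj]
  rw [setLIntegral_congr_fun hS (g := fun _ => 1) (fun x hx => by
    simp [H.det_Ψ x (hSW hx)])]
  simp

theorem image_mem_nhds (H : UnimodularCoords P W₀ W Ψ Φ) : Ψ '' W₀ ∈ 𝓝 P := by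
  have h : W ⊆ Ψ '' W₀ := fun y hy => ⟨Φ y, H.Φ_mem y hy, H.Ψ_Φ y hy⟩
  have hP : P ∈ W := by
    have h := H.Ψ_mem 0 H.zero_mem
    rwa [H.Ψ_zero] at h
  exact Filter.mem_of_superset (H.isOpen_W.mem_nhds hP) h

theorem continuousAt_zero (H : UnimodularCoords P W₀ W Ψ Φ) : ContinuousAt Ψ 0 :=
  H.contDiffOn_Ψ.continuousOn.continuousAt (H.isOpen_W₀.mem_nhds H.zero_mem)

end UnimodularCoords

variable {Z Y : Finset ι} {F : (ι → ℝ) → ℝ} {P : ι → ℝ} {W₀ W : Set (ι → ℝ)}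
  {Ψ Φ : (ι → ℝ) → ι → ℝ}

/-- The weighted radius of the box with sides `s ^ 2` along `Z`, `s` along `Y` and `r` along the
other coordinates. -/
noncomputable def weightedSide (Z Y : Finset ι) (s r : ℝ) (i : ι) : ℝ :=
  if i ∈ Z then s ^ 2 else if i ∈ Y then s else r

theorem prod_weightedSide (hZY : Disjoint Z Y) (s r : ℝ) :
    ∏ i, weightedSide Z Y s r i =
      s ^ (2 * Z.card + Y.card) * r ^ (Fintype.card ι - (Z.card + Y.card)) := by
  rw [← Finset.prod_mul_prod_compl (Z ∪ Y), Finset.prod_union hZY]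
  rw [Finset.prod_congr rfl (g := fun _ => s ^ 2) (fun i hi => by simp [weightedSide, hi]),
    Finset.prod_congr rfl (s₁ := Y) (g := fun _ => s) (fun i hi => by
      simp [weightedSide, hi, Finset.disjoint_right.1 hZY hi]),
    Finset.prod_congr rfl (s₁ := (Z ∪ Y)ᶜ) (g := fun _ => r) (fun i hi => by
      rw [Finset.mem_compl, Finset.mem_union, not_or] at hi
      simp [weightedSide, hi])]
  simp only [Finset.prod_const, Finset.card_compl, Finset.card_union_of_disjoint hZY]
  rw [pow_add, pow_mul]

theorem rpow_quarter_pow {x : ℝ} (hx : 0 ≤ x) (a b : ℕ) :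
    (x ^ (1 / 4 : ℝ)) ^ (2 * a + b) = x ^ ((2 * (a : ℝ) + b) / 4) := by
  rw [← Real.rpow_natCast, ← Real.rpow_mul hx]
  congr 1
  push_cast; ring

theorem rpow_quarter_pow_four {x : ℝ} (hx : 0 ≤ x) : (x ^ (1 / 4 : ℝ)) ^ 4 = x := by
  rw [← Real.rpow_natCast, ← Real.rpow_mul hx]
  norm_num

-- In the coordinates x a sublevel set lies in a box with sides of order ε^(1/2) along Z, ε^(1/4)
-- along Y and 1 elsewhere, and Ψ preserves volume.
open MeasureTheory in
theorem volume_sublevel_le (hZY : Disjoint Z Y) (H : UnimodularCoords P W₀ W Ψ Φ) {c : ℝ}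
    (hc : 0 < c)
    (hlow : ∀ᶠ x in 𝓝 (0 : ι → ℝ), c * (∑ i ∈ Z, x i ^ 2 + ∑ i ∈ Y, x i ^ 4) ≤ F (Ψ x)) :
    ∃ B ∈ 𝓝 P, ∃ C : ℝ, 0 < C ∧ ∀ ε : ℝ, 0 < ε →
      volume {x | x ∈ B ∧ F x ≠ 0 ∧ |F x| ≤ ε} ≤
        ENNReal.ofReal (C * ε ^ ((2 * (Z.card : ℝ) + Y.card) / 4)) := by
  have H' := H.restrict (hlow.and (Metric.ball_mem_nhds (0 : ι → ℝ) one_pos))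
  set T : Set (ι → ℝ) := {x | c * (∑ i ∈ Z, x i ^ 2 + ∑ i ∈ Y, x i ^ 4) ≤ F (Ψ x) ∧
    x ∈ Metric.ball (0 : ι → ℝ) 1} with hT
  refine ⟨Ψ '' (W₀ ∩ interior T), H'.image_mem_nhds,
    2 ^ Fintype.card ι * (c⁻¹) ^ ((2 * (Z.card : ℝ) + Y.card) / 4), by positivity, fun ε hε => ?_⟩
  -- Chosen so that c s⁴ = ε, which bounds every z_i² and y_j⁴ by s⁴.
  set s : ℝ := (ε * c⁻¹) ^ (1 / 4 : ℝ) with hs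
  have hs0 : 0 ≤ s := by positivity
  have hs4 : s ^ 4 = ε * c⁻¹ := rpow_quarter_pow_four (by positivity)
  set S : Set (ι → ℝ) := W₀ ∩ interior T ∩
    Set.univ.pi fun i => Set.Icc (-weightedSide Z Y s 1 i) (weightedSide Z Y s 1 i) with hS
  have hsub : {x | x ∈ Ψ '' (W₀ ∩ interior T) ∧ F x ≠ 0 ∧ |F x| ≤ ε} ⊆ Ψ '' S := by
    rintro _ ⟨⟨x, hx, rfl⟩, -, hF⟩
    refine ⟨x, ⟨hx, fun i _ => abs_le.1 ?_⟩, rfl⟩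
    obtain ⟨h1, h2⟩ := interior_subset hx.2
    have h3 : ∑ i ∈ Z, x i ^ 2 + ∑ i ∈ Y, x i ^ 4 ≤ s ^ 4 := by
      rw [hs4, ← div_eq_mul_inv, le_div_iff₀' hc]
      exact h1.trans ((le_abs_self _).trans hF)
    have hZ0 : 0 ≤ ∑ i ∈ Z, x i ^ 2 := Finset.sum_nonneg fun i _ => by positivity
    have hY0 : 0 ≤ ∑ i ∈ Y, x i ^ 4 := Finset.sum_nonneg fun i _ => by positivity
    unfold weightedSide
    split_ifs with hZ hY
    · have h4 := Finset.single_le_sum (f := fun i => x i ^ 2) (fun i _ => by positivity) hZ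
      exact abs_le_of_sq_le_sq (by nlinarith) (by positivity)
    · have h4 := Finset.single_le_sum (f := fun i => x i ^ 4) (fun i _ => by positivity) hY
      have h5 : |x i| ^ 4 ≤ s ^ 4 := by
        rw [Even.pow_abs (by decide)]; linarith
      exact le_of_pow_le_pow_left₀ (by norm_num) hs0 h5
    · have := (norm_le_pi_norm x i).trans (mem_ball_zero_iff.1 h2).le
      rwa [Real.norm_eq_abs] at this
  have hSm : MeasurableSet S := H'.isOpen_W₀.measurableSet.inter
    (MeasurableSet.univ_pi fun _ => measurableSet_Icc)
  have hside : ∀ i, 0 ≤ weightedSide Z Y s 1 i := fun i => by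
    unfold weightedSide; split_ifs <;> positivity
  calc volume {x | x ∈ Ψ '' (W₀ ∩ interior T) ∧ F x ≠ 0 ∧ |F x| ≤ ε}
      ≤ volume (Ψ '' S) := measure_mono hsub
    _ = volume S := H'.volume_image hSm Set.inter_subset_left
    _ ≤ volume (Set.univ.pi fun i => Set.Icc (-weightedSide Z Y s 1 i) (weightedSide Z Y s 1 i)) :=
        measure_mono Set.inter_subset_right
    _ = ENNReal.ofReal (∏ i, 2 * weightedSide Z Y s 1 i) := by
        rw [Set.pi_univ_Icc (fun i => -weightedSide Z Y s 1 i) (weightedSide Z Y s 1),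
          Real.volume_Icc_pi, ENNReal.ofReal_prod_of_nonneg
          fun i _ => mul_nonneg zero_le_two (hside i)]
        exact Finset.prod_congr rfl fun i _ => by congr 1; ring
    _ = _ := by
        rw [Finset.prod_mul_distrib, prod_weightedSide hZY, one_pow, mul_one, hs,
          rpow_quarter_pow (by positivity), Real.mul_rpow hε.le (by positivity)]
        simp only [Finset.prod_const, Finset.card_univ]
        congr 1; ring

theorem eventually_abs_le_add_one {f : (ι → ℝ) → ℝ} (hf : AnalyticAt ℝ f 0) :
    ∀ᶠ x in 𝓝 (0 : ι → ℝ), |f x| ≤ |f 0| + 1 := by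
  filter_upwards [hf.continuousAt.abs.eventually (Iio_mem_nhds (lt_add_one _))] with x hx
  exact le_of_lt hx

/-- Give the z_i weight 2 and the y_j weight 1: every generator of the ideal then has weight 2. -/
theorem InQuadIdeal.exists_abs_le {f : (ι → ℝ) → ℝ} (hf : InQuadIdeal Z Y f) :
    ∃ K : ℝ, ∀ᶠ x in 𝓝 (0 : ι → ℝ), ∀ s : ℝ, 0 ≤ s → (∀ i ∈ Z, |x i| ≤ s ^ 2) →
      (∀ i ∈ Y, |x i| ≤ s) → |f x| ≤ K * s ^ 2 := by
  obtain ⟨A, B, hA, hB, hf⟩ := hf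
  refine ⟨∑ i ∈ Z, (|A i 0| + 1) + ∑ i ∈ Y, ∑ j ∈ Y, (|B i j 0| + 1), ?_⟩
  filter_upwards [hf, Filter.eventually_all.2 fun i => eventually_abs_le_add_one (hA i),
    Filter.eventually_all.2 fun i => Filter.eventually_all.2 fun j =>
      eventually_abs_le_add_one (hB i j)] with x hx hxA hxB s hs hZ hY
  rw [hx, add_mul, Finset.sum_mul, Finset.sum_mul]
  simp only [Finset.sum_mul]
  refine (abs_add_le _ _).trans (add_le_add ?_ ?_)
  · refine (Finset.abs_sum_le_sum_abs _ _).trans (Finset.sum_le_sum fun i hi => ?_)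
    rw [abs_mul, mul_comm]
    exact mul_le_mul (hxA i) (hZ i hi) (abs_nonneg _) (by positivity)
  · refine (Finset.abs_sum_le_sum_abs _ _).trans (Finset.sum_le_sum fun i hi => ?_)
    refine (Finset.abs_sum_le_sum_abs _ _).trans (Finset.sum_le_sum fun j hj => ?_)
    rw [abs_mul, abs_mul, mul_comm, sq]
    exact mul_le_mul (hxB i j) (mul_le_mul (hY i hi) (hY j hj) (abs_nonneg _) hs)
      (by positivity) (by positivity)

-- A box with positive coordinates and the same weighted sides lies in the sublevel set. The
-- strictly positive z-coordinates, of which there is at least one, keep it off the zeros of F.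
open MeasureTheory in
theorem le_volume_sublevel (hZY : Disjoint Z Y) (hZ : Z.Nonempty)
    (H : UnimodularCoords P W₀ W Ψ Φ) {c : ℝ} (hc : 0 < c)
    (hlow : ∀ᶠ x in 𝓝 (0 : ι → ℝ), c * (∑ i ∈ Z, x i ^ 2 + ∑ i ∈ Y, x i ^ 4) ≤ F (Ψ x))
    {K : ℝ} (hup : ∀ᶠ x in 𝓝 (0 : ι → ℝ), ∀ s : ℝ, 0 ≤ s → (∀ i ∈ Z, |x i| ≤ s ^ 2) →
      (∀ i ∈ Y, |x i| ≤ s) → |F (Ψ x)| ≤ K * s ^ 4)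
    {B : Set (ι → ℝ)} (hB : B ∈ 𝓝 P) :
    ∃ c' : ℝ, 0 < c' ∧ ∀ᶠ ε : ℝ in 𝓝[>] 0,
      ENNReal.ofReal (c' * ε ^ ((2 * (Z.card : ℝ) + Y.card) / 4)) ≤
        volume {x | x ∈ B ∧ F x ≠ 0 ∧ |F x| ≤ ε} := by
  have hΨB : ∀ᶠ x in 𝓝 (0 : ι → ℝ), Ψ x ∈ B :=
    H.continuousAt_zero.eventually (by rwa [H.Ψ_zero])
  have hW₀ : ∀ᶠ x in 𝓝 (0 : ι → ℝ), x ∈ W₀ := H.isOpen_W₀.mem_nhds H.zero_mem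
  obtain ⟨δ, hδ, hball⟩ := Metric.eventually_nhds_iff_ball.1
    (hΨB.and (hW₀.and (hlow.and hup)))
  set L : ℝ := |K| + 1 with hL
  have hL0 : 0 < L := by positivity
  refine ⟨(L⁻¹) ^ ((2 * (Z.card : ℝ) + Y.card) / 4) *
    δ ^ (Fintype.card ι - (Z.card + Y.card)), by positivity, ?_⟩
  have hsmall : ∀ᶠ ε : ℝ in 𝓝[>] 0, (ε * L⁻¹) ^ (1 / 4 : ℝ) < min δ 1 := by
    have h1 : ContinuousAt (fun ε : ℝ => (ε * L⁻¹) ^ (1 / 4 : ℝ)) 0 :=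
      (continuousAt_id.mul continuousAt_const).rpow_const (Or.inr (by norm_num))
    have h0 : ((0 : ℝ) * L⁻¹) ^ (1 / 4 : ℝ) < min δ 1 := by
      rw [zero_mul, Real.zero_rpow (by norm_num)]
      exact lt_min hδ one_pos
    have h2 := h1.eventually (Iio_mem_nhds h0)
    exact h2.filter_mono nhdsWithin_le_nhds
  filter_upwards [hsmall, self_mem_nhdsWithin] with ε hε (hε0 : 0 < ε)
  set s : ℝ := (ε * L⁻¹) ^ (1 / 4 : ℝ) with hs
  have hs0 : 0 < s := by positivity
  have hs4 : s ^ 4 = ε * L⁻¹ := rpow_quarter_pow_four (by positivity)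
  have hsδ : s < δ := hε.trans_le (min_le_left _ _)
  have hs1 : s < 1 := hε.trans_le (min_le_right _ _)
  set S : Set (ι → ℝ) := Set.univ.pi fun i => Set.Ioo 0 (weightedSide Z Y s δ i) with hS
  have hside : ∀ i, 0 < weightedSide Z Y s δ i := fun i => by
    unfold weightedSide; split_ifs <;> positivity
  have hsideδ : ∀ i, weightedSide Z Y s δ i ≤ δ := fun i => by
    unfold weightedSide
    split_ifs
    · nlinarith
    · exact hsδ.le
    · exact le_rfl
  have hSball : S ⊆ Metric.ball 0 δ := by
    intro x hx
    rw [mem_ball_zero_iff, pi_norm_lt_iff hδ]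
    intro i
    have := hx i (Set.mem_univ i)
    rw [Real.norm_eq_abs, abs_of_pos this.1]
    exact this.2.trans_le (hsideδ i)
  have hSm : MeasurableSet S := MeasurableSet.univ_pi fun _ => measurableSet_Ioo
  have hsub : Ψ '' S ⊆ {x | x ∈ B ∧ F x ≠ 0 ∧ |F x| ≤ ε} := by
    rintro _ ⟨x, hx, rfl⟩
    obtain ⟨h1, -, h3, h4⟩ := hball x (hSball hx)
    have hxpos : ∀ i, 0 < x i := fun i => (hx i (Set.mem_univ i)).1
    have hxle : ∀ i, x i ≤ weightedSide Z Y s δ i := fun i => (hx i (Set.mem_univ i)).2.le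
    refine ⟨h1, ?_, ?_⟩
    · have : 0 < c * (∑ i ∈ Z, x i ^ 2 + ∑ i ∈ Y, x i ^ 4) :=
        mul_pos hc (add_pos_of_pos_of_nonneg (Finset.sum_pos (fun i _ => pow_pos (hxpos i) 2) hZ)
          (Finset.sum_nonneg fun i _ => (pow_pos (hxpos i) 4).le))
      exact (this.trans_le h3).ne'
    · have h5 := h4 s hs0.le
        (fun i hi => by
          rw [abs_of_pos (hxpos i)]
          have := hxle i
          simpa [weightedSide, hi] using this)
        (fun i hi => by
          rw [abs_of_pos (hxpos i)]
          have := hxle i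
          simpa [weightedSide, hi, Finset.disjoint_right.1 hZY hi] using this)
      refine h5.trans ?_
      calc K * s ^ 4 ≤ L * s ^ 4 := by
            gcongr
            exact (le_abs_self K).trans (by rw [hL]; linarith)
        _ = ε := by rw [hs4]; field_simp
  calc ENNReal.ofReal _ = ENNReal.ofReal (∏ i, weightedSide Z Y s δ i) := by
        rw [prod_weightedSide hZY, hs, rpow_quarter_pow (by positivity),
          Real.mul_rpow hε0.le (by positivity)]
        congr 1; ring
    _ = volume S := by
        rw [hS, Real.volume_pi_Ioo, ENNReal.ofReal_prod_of_nonneg fun i _ => (hside i).le]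
        simp
    _ = volume (Ψ '' S) := (H.volume_image hSm fun x hx => (hball x (hSball hx)).2.1).symm
    _ ≤ _ := measure_mono hsub

end NormalForm

/-! ### Existence of a resolution for the normal form -/

section NormalForm

variable {ι : Type} [Fintype ι] [DecidableEq ι] {Z Y : Finset ι}

namespace BlowupChart

theorem g_apply_of_mem_left (c : BlowupChart Z Y) (u : ι → ℝ) {i : ι} (hi : i ∈ Z) :
    c.g u i = (∏ j, u j ^ c.e j) * c.v u (some i) := by
  have h := congrFun (c.quadPart_g u) (some i)
  simpa [quadPart, hi] using h

theorem g_apply_of_mem_right (c : BlowupChart Z Y) (u : ι → ℝ) {i : ι} (hi : i ∈ Y) :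
    c.g u i = c.m u * c.w u i := by
  have h := congrFun (c.normalPart_g u) i
  rwa [normalPart_apply_of_mem_right hi] at h

/-- The quotient of an element of the ideal by the monomial defining the pullback of the ideal. -/
def quotient (c : BlowupChart Z Y) (A : ι → (ι → ℝ) → ℝ) (B : ι → ι → (ι → ℝ) → ℝ)
    (u : ι → ℝ) : ℝ :=
  ∑ i ∈ Z, c.v u (some i) * A i (c.g u) +
    c.n u * ∑ i ∈ Y, ∑ j ∈ Y, c.w u i * c.w u j * B i j (c.g u)

/-- This is principalization: each z_i, and each product of two y-coordinates, contains the chart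
monomial as a factor. -/
theorem mul_quotient (c : BlowupChart Z Y) (A : ι → (ι → ℝ) → ℝ) (B : ι → ι → (ι → ℝ) → ℝ)
    (u : ι → ℝ) :
    ∑ i ∈ Z, c.g u i * A i (c.g u) + ∑ i ∈ Y, ∑ j ∈ Y, c.g u i * c.g u j * B i j (c.g u) =
      (∏ j, u j ^ c.e j) * c.quotient A B u := by
  rw [quotient, mul_add, Finset.mul_sum, ← mul_assoc, ← c.m_sq, Finset.mul_sum]
  congr 1
  · exact Finset.sum_congr rfl fun i hi => by rw [c.g_apply_of_mem_left u hi]; ring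
  · refine Finset.sum_congr rfl fun i hi => ?_
    rw [Finset.mul_sum]
    exact Finset.sum_congr rfl fun j hj => by
      rw [c.g_apply_of_mem_right u hi, c.g_apply_of_mem_right u hj]; ring

theorem contDiffOn_quotient (c : BlowupChart Z Y) {A : ι → (ι → ℝ) → ℝ}
    {B : ι → ι → (ι → ℝ) → ℝ} {T : Set (ι → ℝ)} (hA : ∀ i, ContDiffOn ℝ ω (A i) T)
    (hB : ∀ i j, ContDiffOn ℝ ω (B i j) T) :
    ContDiffOn ℝ ω (c.quotient A B) {u | c.g u ∈ T} := by
  have hg : ContDiffOn ℝ ω c.g {u | c.g u ∈ T} := c.contDiff_g.contDiffOn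
  have hv : ∀ i, ContDiffOn ℝ ω (fun u => c.v u i) {u | c.g u ∈ T} := fun i =>
    (contDiff_pi.1 c.contDiff_v i).contDiffOn
  have hw : ∀ i, ContDiffOn ℝ ω (fun u => c.w u i) {u | c.g u ∈ T} := fun i =>
    (contDiff_pi.1 c.contDiff_w i).contDiffOn
  exact (ContDiffOn.sum fun i _ => (hv (some i)).mul ((hA i).comp hg fun _ h => h)).add
    (c.contDiff_n.contDiffOn.mul (ContDiffOn.sum fun i _ => ContDiffOn.sum fun j _ =>
      ((hw i).mul (hw j)).mul ((hB i j).comp hg fun _ h => h)))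

/-- A lower bound for the quotient by the square of the monomial, from a lower bound for the
function itself. -/
theorem le_of_mul_sq_eq (c : BlowupChart Z Y) {T : Set (ι → ℝ)} (hT : IsOpen T)
    {G : (ι → ℝ) → ℝ} {a : (ι → ℝ) → ℝ} (ha : ContinuousOn a {u | c.g u ∈ T})
    (hG : ∀ u, c.g u ∈ T → G (c.g u) = a u * (∏ j, u j ^ c.e j) ^ 2) {b : ℝ}
    (hb : ∀ x ∈ T, b * (∑ i ∈ Z, x i ^ 2 + ∑ i ∈ Y, x i ^ 4) ≤ G x) {u : ι → ℝ}
    (hu : c.g u ∈ T) :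
    b * (∑ i ∈ Z, c.v u (some i) ^ 2 + c.n u ^ 2 * ∑ i ∈ Y, c.w u i ^ 4) ≤ a u := by
  have hO : IsOpen {u | c.g u ∈ T} := hT.preimage c.contDiff_g.continuous
  have h1 := hO.inter_closure ⟨hu, c.dense u⟩
  rw [mem_closure_iff_nhdsWithin_neBot] at h1
  have hcont : Continuous fun u => b * (∑ i ∈ Z, c.v u (some i) ^ 2 +
      c.n u ^ 2 * ∑ i ∈ Y, c.w u i ^ 4) := by
    have hv : ∀ i, Continuous fun u => c.v u i := fun i =>
      (continuous_apply i).comp c.contDiff_v.continuous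
    have hw : ∀ i, Continuous fun u => c.w u i := fun i =>
      (continuous_apply i).comp c.contDiff_w.continuous
    have hn := c.contDiff_n.continuous
    fun_prop
  have _ := h1
  -- Dividing by the monomial is possible only on a dense set; continuity carries the inequality to
  -- all points of the chart over T.
  refine le_of_tendsto_of_tendsto
    (b := 𝓝[{u | c.g u ∈ T} ∩ {u | c.m u ≠ 0 ∧ ∏ i, u i ^ c.e i ≠ 0}] u)
    (hcont.continuousAt.mono_left nhdsWithin_le_nhds)
    ((ha.continuousAt (hO.mem_nhds hu)).mono_left nhdsWithin_le_nhds) ?_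
  filter_upwards [self_mem_nhdsWithin] with x hx
  obtain ⟨hxT, -, hx0⟩ := hx
  have h2 := hb _ hxT
  rw [hG x hxT] at h2
  have h3 : ∑ i ∈ Z, c.g x i ^ 2 = (∏ j, x j ^ c.e j) ^ 2 * ∑ i ∈ Z, c.v x (some i) ^ 2 := by
    rw [Finset.mul_sum]
    exact Finset.sum_congr rfl fun i hi => by rw [c.g_apply_of_mem_left x hi]; ring
  have h4 : ∑ i ∈ Y, c.g x i ^ 4 =
      (∏ j, x j ^ c.e j) ^ 2 * (c.n x ^ 2 * ∑ i ∈ Y, c.w x i ^ 4) := by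
    have h5 : c.m x ^ 4 = (∏ j, x j ^ c.e j) ^ 2 * c.n x ^ 2 := by
      rw [← mul_pow, ← c.m_sq]; ring
    rw [← mul_assoc, ← h5, Finset.mul_sum]
    exact Finset.sum_congr rfl fun i hi => by rw [c.g_apply_of_mem_right x hi]; ring
  rw [h3, h4, ← mul_add, mul_left_comm, mul_comm] at h2
  exact le_of_mul_le_mul_right h2 (by positivity)

end BlowupChart

variable {F : (ι → ℝ) → ℝ} {P : ι → ℝ} {W₀ W : Set (ι → ℝ)} {Ψ Φ : (ι → ℝ) → ι → ℝ}

/-- Writing F as a combination of squares of elements of the ideal pulls it back to the squared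
monomial times an analytic cofactor; the lower bound on F prevents the cofactor from vanishing. The
exponents need not be compared with the threshold, since the volume criterion determines it for any
resolution. -/
theorem nonempty_resolution (hZY : Disjoint Z Y) (hZ : Z.Nonempty)
    (H : UnimodularCoords P W₀ W Ψ Φ) {X : Type} [Fintype X] {d e : X → (ι → ℝ) → ℝ}
    (hd : ∀ x, InQuadIdeal Z Y (d x)) (he : ∀ x, AnalyticAt ℝ (e x) 0)
    (hF : ∀ᶠ y in 𝓝 (0 : ι → ℝ), F (Ψ y) = ∑ x, d x y ^ 2 * e x y) {b : ℝ} (hb : 0 < b)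
    (hlow : ∀ᶠ x in 𝓝 (0 : ι → ℝ), b * (∑ i ∈ Z, x i ^ 2 + ∑ i ∈ Y, x i ^ 4) ≤ F (Ψ x)) :
    Nonempty (Resolution F P) := by
  choose A B hA hB hd using hd
  have hev : ∀ᶠ y in 𝓝 (0 : ι → ℝ), (∀ x i, AnalyticAt ℝ (A x i) y) ∧
      (∀ x i j, AnalyticAt ℝ (B x i j) y) ∧ (∀ x, AnalyticAt ℝ (e x) y) ∧
      (∀ x, d x y = ∑ i ∈ Z, y i * A x i y + ∑ i ∈ Y, ∑ j ∈ Y, y i * y j * B x i j y) ∧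
      F (Ψ y) = ∑ x, d x y ^ 2 * e x y ∧
      b * (∑ i ∈ Z, y i ^ 2 + ∑ i ∈ Y, y i ^ 4) ≤ F (Ψ y) := by
    refine (Filter.eventually_all.2 fun x => Filter.eventually_all.2 fun i =>
      (hA x i).eventually_analyticAt).and ((Filter.eventually_all.2 fun x =>
      Filter.eventually_all.2 fun i => Filter.eventually_all.2 fun j =>
      (hB x i j).eventually_analyticAt).and ((Filter.eventually_all.2 fun x =>
      (he x).eventually_analyticAt).and ((Filter.eventually_all.2 hd).and (hF.and hlow))))
  have H' := H.restrict hev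
  set T := W₀ ∩ interior {y : ι → ℝ | (∀ x i, AnalyticAt ℝ (A x i) y) ∧
      (∀ x i j, AnalyticAt ℝ (B x i j) y) ∧ (∀ x, AnalyticAt ℝ (e x) y) ∧
      (∀ x, d x y = ∑ i ∈ Z, y i * A x i y + ∑ i ∈ Y, ∑ j ∈ Y, y i * y j * B x i j y) ∧
      F (Ψ y) = ∑ x, d x y ^ 2 * e x y ∧
      b * (∑ i ∈ Z, y i ^ 2 + ∑ i ∈ Y, y i ^ 4) ≤ F (Ψ y)} with hT
  have hTo : IsOpen T := H'.isOpen_W₀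
  have hT' := fun y (hy : y ∈ T) => interior_subset hy.2
  have hAT : ∀ x i, ContDiffOn ℝ ω (A x i) T := fun x i y hy =>
    (contDiffAt_omega_iff_analyticAt.2 ((hT' y hy).1 x i)).contDiffWithinAt
  have hBT : ∀ x i j, ContDiffOn ℝ ω (B x i j) T := fun x i j y hy =>
    (contDiffAt_omega_iff_analyticAt.2 ((hT' y hy).2.1 x i j)).contDiffWithinAt
  have heT : ∀ x, ContDiffOn ℝ ω (e x) T := fun x y hy =>
    (contDiffAt_omega_iff_analyticAt.2 ((hT' y hy).2.2.1 x)).contDiffWithinAt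
  have hFT : ∀ y ∈ T, F (Ψ y) = ∑ x, (∑ i ∈ Z, y i * A x i y +
      ∑ i ∈ Y, ∑ j ∈ Y, y i * y j * B x i j y) ^ 2 * e x y := fun y hy => by
    obtain ⟨-, -, -, h4, h5, -⟩ := hT' y hy
    rw [h5]
    exact Finset.sum_congr rfl fun x _ => by rw [h4]
  have hbT : ∀ y ∈ T, b * (∑ i ∈ Z, y i ^ 2 + ∑ i ∈ Y, y i ^ 4) ≤ F (Ψ y) := fun y hy =>
    (hT' y hy).2.2.2.2.2
  have hFan : ContDiffOn ℝ ω (fun y => F (Ψ y)) T := by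
    refine ContDiffOn.congr ?_ hFT
    refine ContDiffOn.sum fun x _ => ContDiffOn.mul (ContDiffOn.pow (ContDiffOn.add
      (ContDiffOn.sum fun i _ => ContDiffOn.mul (by fun_prop) (hAT x i))
      (ContDiffOn.sum fun i _ => ContDiffOn.sum fun j _ =>
        ContDiffOn.mul (by fun_prop) (hBT x i j))) 2) (heT x)
  set κ := blowupCharts hZY with hκ
  set a : (Z ⊕ Y ⊕ Y × Z) → (ι → ℝ) → ℝ := fun c u =>
    ∑ x, (κ c).quotient (A x) (B x) u ^ 2 * e x ((κ c).g u) with ha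
  have haT : ∀ c, ContDiffOn ℝ ω (a c) {u | (κ c).g u ∈ T} := fun c =>
    ContDiffOn.sum fun x _ => (((κ c).contDiffOn_quotient (hAT x) (hBT x)).pow 2).mul
      ((heT x).comp (κ c).contDiff_g.contDiffOn fun _ h => h)
  have hFg : ∀ c u, (κ c).g u ∈ T →
      F (Ψ ((κ c).g u)) = a c u * (∏ i, u i ^ (κ c).e i) ^ 2 := fun c u hu => by
    rw [hFT _ hu, ha, Finset.sum_mul]
    exact Finset.sum_congr rfl fun x _ => by rw [(κ c).mul_quotient]; ring
  let D : BlowupData Z Y F P :=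
    { C := Z ⊕ Y ⊕ Y × Z
      κ := κ
      cover := fun p hp => blowupCharts_cover hZY hp
      W₀ := T
      W := _
      isOpen_W₀ := H'.isOpen_W₀
      isOpen_W := H'.isOpen_W
      zero_mem := H'.zero_mem
      Ψ := Ψ
      Φ := Φ
      Ψ_mem := H'.Ψ_mem
      Φ_mem := H'.Φ_mem
      Φ_Ψ := H'.Φ_Ψ
      Ψ_Φ := H'.Ψ_Φ
      Ψ_zero := H'.Ψ_zero
      contDiffOn_Ψ := H'.contDiffOn_Ψ
      contDiffOn_Φ := H'.contDiffOn_Φ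
      det_Ψ := H'.det_Ψ
      analytic_F := fun y hy => by
        have h1 : ContDiffOn ℝ ω (fun y => F (Ψ (Φ y))) _ :=
          hFan.comp H'.contDiffOn_Φ H'.Φ_mem
        have h2 := h1.congr fun y hy => by rw [H'.Ψ_Φ y hy]
        exact contDiffAt_omega_iff_analyticAt.1 (h2.contDiffAt (H'.isOpen_W.mem_nhds hy))
      F_eq_zero := fun x hx h => by
        have h0 : ∀ i ∈ Z ∪ Y, x i = 0 := fun i hi => by
          have := congrFun h i
          simpa only [normalPart, hi, if_true, Pi.zero_apply] using this
        rw [hFT x hx]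
        refine Finset.sum_eq_zero fun _ _ => ?_
        rw [Finset.sum_eq_zero fun i hi => by rw [h0 i (Finset.mem_union_left _ hi), zero_mul],
          Finset.sum_eq_zero fun i hi => Finset.sum_eq_zero fun j _ => by
            rw [h0 i (Finset.mem_union_right _ hi), zero_mul, zero_mul]]
        ring
      a := a
      contDiffOn_a := haT
      -- The cofactor is at least b times the positive expression of `BlowupChart.pos`.
      a_ne_zero := fun c u hu =>
        (lt_of_lt_of_le (mul_pos hb ((κ c).pos u)) ((κ c).le_of_mul_sq_eq hTo
          (G := fun y => F (Ψ y)) (haT c).continuousOn (hFg c) hbT hu)).ne'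
      F_g := hFg }
  obtain ⟨p₀⟩ := D.nonempty hZ
  exact ⟨D.resolution p₀⟩

/-- The real log canonical threshold of a function which is, in unimodular analytic coordinates,
comparable to `∑ z_i² + ∑ y_j⁴` and a combination of squares of elements of the ideal generated
by the `z_i` and the `y_j y_k`. -/
theorem hasRLCTAt_of_quadIdeal (hZY : Disjoint Z Y) (hZ : Z.Nonempty)
    (H : UnimodularCoords P W₀ W Ψ Φ) {X : Type} [Fintype X] {d e : X → (ι → ℝ) → ℝ}
    (hd : ∀ x, InQuadIdeal Z Y (d x)) (he : ∀ x, AnalyticAt ℝ (e x) 0)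
    (hF : ∀ᶠ y in 𝓝 (0 : ι → ℝ), F (Ψ y) = ∑ x, d x y ^ 2 * e x y) {b : ℝ} (hb : 0 < b)
    (hlow : ∀ᶠ x in 𝓝 (0 : ι → ℝ), b * (∑ i ∈ Z, x i ^ 2 + ∑ i ∈ Y, x i ^ 4) ≤ F (Ψ x)) :
    HasRLCTAt F P (ENNReal.ofReal ((2 * (Z.card : ℝ) + Y.card) / 4)) 1 := by
  refine ⟨nonempty_resolution hZY hZ H hd he hF hb hlow, fun R => ?_⟩
  have hlam : 0 < (2 * (Z.card : ℝ) + Y.card) / 4 := by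
    have : (0 : ℝ) < Z.card := Nat.cast_pos.2 hZ.card_pos
    positivity
  choose K hK using fun x => (hd x).exists_abs_le
  refine R.threshold_eq_and_multiplicity_eq hlam (volume_sublevel_le hZY H hb hlow) fun B hB =>
    le_volume_sublevel hZY hZ H hb hlow (K := ∑ x, K x ^ 2 * (|e x 0| + 1)) ?_ hB
  filter_upwards [hF, Filter.eventually_all.2 hK,
    Filter.eventually_all.2 fun x => eventually_abs_le_add_one (he x)] with y hy hyK hye s hs h1 h2
  rw [hy, Finset.sum_mul]
  refine (Finset.abs_sum_le_sum_abs _ _).trans (Finset.sum_le_sum fun x _ => ?_)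
  rw [abs_mul, abs_pow]
  have h3 : |d x y| ^ 2 ≤ (K x * s ^ 2) ^ 2 :=
    pow_le_pow_left₀ (abs_nonneg _) (hyK x s hs h1 h2) 2
  calc |d x y| ^ 2 * |e x y| ≤ (K x * s ^ 2) ^ 2 * (|e x 0| + 1) :=
        mul_le_mul h3 (hye x) (abs_nonneg _) (by positivity)
    _ = _ := by ring

end NormalForm

/-! ### Shears as unimodular coordinate changes -/

section Shear

variable {ι : Type} [Fintype ι] [DecidableEq ι]

/-- Subtracting from one coordinate a function that does not depend on it is undone by adding the
function back, and the derivative is a transvection. -/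
theorem UnimodularCoords.shear (P : ι → ℝ) {Ω : Set (ι → ℝ)} (hΩ : IsOpen Ω) (h0Ω : 0 ∈ Ω) (l : ι)
    {f : (ι → ℝ) → ℝ} (hf : ContDiffOn ℝ ω f Ω)
    (hΩl : ∀ x ∈ Ω, ∀ s : ℝ, x + s • (Pi.single l 1 : ι → ℝ) ∈ Ω)
    (hfl : ∀ (x : ι → ℝ) (s : ℝ), f (x + s • (Pi.single l 1 : ι → ℝ)) = f x) (hf0 : f 0 = 0) :
    UnimodularCoords P Ω ((fun y => y - P) ⁻¹' Ω)
      (fun x => P + (x + (-f x) • (Pi.single l 1 : ι → ℝ)))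
      (fun y => y - P + f (y - P) • (Pi.single l 1 : ι → ℝ)) where
  isOpen_W₀ := hΩ
  isOpen_W := hΩ.preimage (by fun_prop)
  zero_mem := h0Ω
  Ψ_mem x hx := by
    rw [Set.mem_preimage, add_sub_cancel_left]
    exact hΩl x hx _
  Φ_mem y hy := hΩl _ hy _
  Φ_Ψ x _ := by
    simp only [add_sub_cancel_left, hfl]
    rw [add_assoc, ← add_smul, neg_add_cancel, zero_smul, add_zero]
  Ψ_Φ y _ := by
    simp only [hfl]
    rw [add_assoc, ← add_smul, add_neg_cancel, zero_smul, add_zero, add_sub_cancel]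
  Ψ_zero := by simp [hf0]
  contDiffOn_Ψ := contDiffOn_const.add (contDiffOn_id.add (hf.neg.smul contDiffOn_const))
  contDiffOn_Φ := (contDiffOn_id.sub contDiffOn_const).add
    ((hf.comp (contDiffOn_id.sub contDiffOn_const) fun _ hy => hy).smul contDiffOn_const)
  det_Ψ x hx := by
    have h1 : HasFDerivAt f (fderiv ℝ f x) x :=
      ((hf.contDiffAt (hΩ.mem_nhds hx)).differentiableAt (by simp)).hasFDerivAt
    have h2 : HasFDerivAt (fun x => P + (x + (-f x) • (Pi.single l 1 : ι → ℝ)))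
        (ContinuousLinearMap.id ℝ (ι → ℝ) +
          (-fderiv ℝ f x).smulRight (Pi.single l 1 : ι → ℝ)) x :=
      ((hasFDerivAt_id x).add (h1.neg.smul_const _)).const_add P
    have h3 : fderiv ℝ f x (Pi.single l 1) = 0 := by
      have h4 : HasDerivAt (fun s : ℝ => x + s • (Pi.single l 1 : ι → ℝ))
          (Pi.single l 1) 0 := by
        simpa using ((hasDerivAt_id (0 : ℝ)).smul_const (Pi.single l 1 : ι → ℝ)).const_add x
      have h5 := HasFDerivAt.comp_hasDerivAt_of_eq (0 : ℝ) h1 h4 (by simp)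
      have h6 : f ∘ (fun s : ℝ => x + s • (Pi.single l 1 : ι → ℝ)) = fun _ => f x :=
        funext fun s => hfl x s
      rw [h6] at h5
      exact h5.unique (hasDerivAt_const _ _)
    have h7 : ((ContinuousLinearMap.id ℝ (ι → ℝ) +
        (-fderiv ℝ f x).smulRight (Pi.single l 1 : ι → ℝ) : (ι → ℝ) →L[ℝ] (ι → ℝ)) :
          (ι → ℝ) →ₗ[ℝ] (ι → ℝ)) =
        LinearMap.transvection ((-fderiv ℝ f x : (ι → ℝ) →L[ℝ] ℝ) : (ι → ℝ) →ₗ[ℝ] ℝ)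
          (Pi.single l 1 : ι → ℝ) := LinearMap.ext fun y => by
      rw [LinearMap.transvection.apply]; rfl
    rw [h2.fderiv, ContinuousLinearMap.det, h7, LinearMap.transvection.det]
    simp [h3]

end Shear

/-! ### Calculus in the ideal generated by the z_i and the y_j y_k -/

section Ideal

variable {ι : Type} [Fintype ι] [DecidableEq ι] {Z Y : Finset ι}

namespace InQuadIdeal

theorem congr {f g : (ι → ℝ) → ℝ} (hf : InQuadIdeal Z Y f) (h : ∀ᶠ x in 𝓝 0, g x = f x) :
    InQuadIdeal Z Y g := by
  obtain ⟨A, B, hA, hB, hf⟩ := hf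
  exact ⟨A, B, hA, hB, by filter_upwards [hf, h] with x h1 h2; rw [h2, h1]⟩

theorem zero : InQuadIdeal Z Y fun _ => 0 :=
  ⟨fun _ _ => 0, fun _ _ _ => 0, fun _ => analyticAt_const, fun _ _ => analyticAt_const,
    by simp⟩

theorem add {f g : (ι → ℝ) → ℝ} (hf : InQuadIdeal Z Y f) (hg : InQuadIdeal Z Y g) :
    InQuadIdeal Z Y fun x => f x + g x := by
  obtain ⟨A, B, hA, hB, hf⟩ := hf
  obtain ⟨A', B', hA', hB', hg⟩ := hg
  refine ⟨fun i x => A i x + A' i x, fun i j x => B i j x + B' i j x,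
    fun i => (hA i).add (hA' i), fun i j => (hB i j).add (hB' i j), ?_⟩
  filter_upwards [hf, hg] with x h1 h2
  rw [h1, h2]
  simp only [mul_add, Finset.sum_add_distrib]
  ring

theorem mul_left {f g : (ι → ℝ) → ℝ} (hg : AnalyticAt ℝ g 0) (hf : InQuadIdeal Z Y f) :
    InQuadIdeal Z Y fun x => g x * f x := by
  obtain ⟨A, B, hA, hB, hf⟩ := hf
  refine ⟨fun i x => g x * A i x, fun i j x => g x * B i j x,
    fun i => hg.mul (hA i), fun i j => hg.mul (hB i j), ?_⟩
  filter_upwards [hf] with x h1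
  rw [h1, mul_add, Finset.mul_sum, Finset.mul_sum]
  simp only [Finset.mul_sum]
  congr 1
  · exact Finset.sum_congr rfl fun i _ => by ring
  · exact Finset.sum_congr rfl fun i _ => Finset.sum_congr rfl fun j _ => by ring

theorem sum {κ : Type} (s : Finset κ) {f : κ → (ι → ℝ) → ℝ}
    (hf : ∀ k ∈ s, InQuadIdeal Z Y (f k)) : InQuadIdeal Z Y fun x => ∑ k ∈ s, f k x := by
  classical
  induction s using Finset.induction_on with
  | empty => simpa using zero
  | insert k s hk ih =>
    simp only [Finset.sum_insert hk]
    exact (hf k (Finset.mem_insert_self _ _)).add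
      (ih fun k hk => hf k (Finset.mem_insert_of_mem hk))

theorem coord {i : ι} (hi : i ∈ Z) : InQuadIdeal Z Y fun x => x i := by
  refine ⟨fun j _ => if j = i then 1 else 0, fun _ _ _ => 0, fun _ => analyticAt_const,
    fun _ _ => analyticAt_const, Filter.Eventually.of_forall fun x => ?_⟩
  simp [hi]

theorem coord_mul_coord {i j : ι} (hi : i ∈ Y) (hj : j ∈ Y) :
    InQuadIdeal Z Y fun x => x i * x j := by
  refine ⟨fun _ _ => 0, fun k l _ => if k = i then if l = j then 1 else 0 else 0,
    fun _ => analyticAt_const, fun _ _ => analyticAt_const,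
    Filter.Eventually.of_forall fun x => ?_⟩
  simp only [mul_zero, Finset.sum_const_zero, zero_add, mul_ite, mul_one]
  rw [Finset.sum_eq_single i]
  · simp [hj]
  · intro k _ hk; simp [hk]
  · intro h; exact absurd hi h

end InQuadIdeal

end Ideal

/-! ### Second order estimates for the logarithm -/

section Log

/-- The function u - log (1 + u) vanishes to second order at 0, so two successive divided
differences give an analytic quotient by u². -/
theorem exists_log_one_add_eq : ∃ ψ : ℝ → ℝ, AnalyticAt ℝ ψ 0 ∧
    ∀ u, -1 < u → Real.log (1 + u) = u - u ^ 2 * ψ u := by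
  set f : ℝ → ℝ := fun u => u - Real.log (1 + u) with hf
  have hfa : AnalyticAt ℝ f 0 :=
    analyticAt_id.sub ((analyticAt_const.add analyticAt_id).log (by norm_num))
  have hd : ∀ {g : ℝ → ℝ}, AnalyticAt ℝ g 0 → AnalyticAt ℝ (dslope g 0) 0 := fun hg => by
    obtain ⟨p, hp⟩ := hg
    exact ⟨_, hp.has_fpower_series_dslope_fslope⟩
  refine ⟨dslope (dslope f 0) 0, hd (hd hfa), fun u _ => ?_⟩
  have h0 : f 0 = 0 := by simp [hf]
  have h1 : dslope f 0 0 = 0 := by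
    rw [dslope_same]
    have : HasDerivAt f (1 - 1 / (1 + 0)) 0 :=
      (hasDerivAt_id (0 : ℝ)).sub (((hasDerivAt_id (0 : ℝ)).const_add 1).log (by norm_num))
    rw [this.deriv]; norm_num
  have h2 : u * dslope f 0 u = f u := by
    have := sub_smul_dslope f 0 u
    simpa [h0] using this
  have h3 : u * dslope (dslope f 0) 0 u = dslope f 0 u := by
    have := sub_smul_dslope (dslope f 0) 0 u
    rwa [h1, sub_zero, sub_zero, smul_eq_mul] at this
  rw [sq, mul_assoc, h3, h2, hf]
  ring

/-- With r = √(1 + u), the bound log r ≤ r - 1 gives u - log (1 + u) ≥ (r - 1)², while u = (r - 1)(r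
+ 1) and r + 1 ≤ 3. -/
theorem sq_div_nine_le_sub_log {u : ℝ} (h1 : -1 < u) (h2 : u ≤ 3) :
    u ^ 2 / 9 ≤ u - Real.log (1 + u) := by
  have hpos : 0 < 1 + u := by linarith
  set r := √(1 + u) with hr
  have hr0 : 0 < r := Real.sqrt_pos.2 hpos
  have hr2 : r ^ 2 = 1 + u := Real.sq_sqrt hpos.le
  have hr3 : r ≤ 2 := by nlinarith
  have hlog : Real.log (1 + u) ≤ 2 * (r - 1) := by
    rw [← hr2, Real.log_pow]
    have := Real.log_le_sub_one_of_pos hr0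
    push_cast; linarith
  have hu : u = (r - 1) * (r + 1) := by linarith [hr2, show (r - 1) * (r + 1) = r ^ 2 - 1 by ring]
  have h5 : u - 2 * (r - 1) = (r - 1) ^ 2 := by linarith [show (r - 1) ^ 2 = r ^ 2 - 2 * r + 1 by ring]
  have h6 : u ^ 2 ≤ 9 * (r - 1) ^ 2 := by
    rw [hu, mul_pow, mul_comm]
    exact mul_le_mul_of_nonneg_right (by nlinarith) (sq_nonneg _)
  linarith

end Log

/-! ### Bernstein expansions and Taylor remainders -/

section Polynomials

open Polynomial

/-- Multiply each monomial s ^ k by (s + (1 - s)) ^ (M - k) = 1 and expand. -/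
theorem exists_eval_eq_sum_binomialProb {M : ℕ} {f : ℝ[X]} (hf : f.natDegree ≤ M) :
    ∃ c : Fin (M + 1) → ℝ, ∀ s, f.eval s = ∑ x, c x * binomialProb M x s := by
  have hpow : ∀ k ≤ M, ∃ c : Fin (M + 1) → ℝ, ∀ s : ℝ, s ^ k = ∑ x, c x * binomialProb M x s := by
    intro k hk
    refine ⟨fun x => if k ≤ (x : ℕ) then ((M - k).choose (x - k) : ℝ) / M.choose x else 0,
      fun s => ?_⟩
    have h1 : s ^ k = ∑ x ∈ Finset.range (M + 1), (if k ≤ x then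
        ((M - k).choose (x - k) : ℝ) * (s ^ x * (1 - s) ^ (M - x)) else 0) := by
      have h2 : (1 : ℝ) = (s + (1 - s)) ^ (M - k) := by simp
      rw [← Finset.sum_filter]
      have h3 : (Finset.range (M + 1)).filter (fun x => k ≤ x) =
          (Finset.range (M - k + 1)).image (fun y => k + y) := by
        ext x
        simp only [Finset.mem_filter, Finset.mem_range, Finset.mem_image]
        constructor
        · rintro ⟨h4, h5⟩; exact ⟨x - k, by omega, by omega⟩
        · rintro ⟨y, hy, rfl⟩; omega
      rw [h3, Finset.sum_image (by intro a _ b _ h; simpa using h)]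
      calc s ^ k = s ^ k * (s + (1 - s)) ^ (M - k) := by rw [← h2, mul_one]
        _ = _ := by
          rw [add_pow, Finset.mul_sum]
          refine Finset.sum_congr rfl fun y hy => ?_
          rw [Nat.add_sub_cancel_left, pow_add, Nat.sub_sub]
          ring
    rw [h1, Finset.sum_range]
    refine Finset.sum_congr rfl fun x _ => ?_
    have hx : (M.choose x : ℝ) ≠ 0 :=
      Nat.cast_ne_zero.2 (Nat.choose_pos (Nat.lt_succ_iff.1 x.2)).ne'
    by_cases h : k ≤ (x : ℕ)
    · simp only [if_pos h, binomialProb]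
      field_simp
    · simp only [if_neg h, zero_mul]
  choose! c hc using hpow
  refine ⟨fun x => ∑ k ∈ Finset.range (M + 1), f.coeff k * c k x, fun s => ?_⟩
  rw [eval_eq_sum_range' (Nat.lt_succ_iff.2 hf)]
  simp only [Finset.sum_mul]
  rw [Finset.sum_comm]
  refine Finset.sum_congr rfl fun k hk => ?_
  rw [hc k (Nat.lt_succ_iff.1 (Finset.mem_range.1 hk)) s, Finset.mul_sum]
  exact Finset.sum_congr rfl fun x _ => by ring

theorem binomialProb_eq_eval (M : ℕ) (x : Fin (M + 1)) (s : ℝ) :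
    binomialProb M x s = (bernsteinPolynomial ℝ M x).eval s := by
  simp [binomialProb, bernsteinPolynomial]

theorem sum_binomialProb (M : ℕ) (s : ℝ) : ∑ x, binomialProb M x s = 1 := by
  have := congrArg (eval s) (bernsteinPolynomial.sum ℝ M)
  rw [eval_finsetSum, Finset.sum_range, eval_one] at this
  simpa only [binomialProb_eq_eval] using this

theorem exists_eval_eq_taylor (f : ℝ[X]) (a : ℝ) : ∃ R : ℝ[X], ∀ s,
    f.eval s = f.eval a + (s - a) * (derivative f).eval a + (s - a) ^ 2 * R.eval s := by
  obtain ⟨g, hg⟩ := X_sub_C_dvd_sub_C_eval (a := a) (p := f)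
  obtain ⟨R, hR⟩ := X_sub_C_dvd_sub_C_eval (a := a) (p := g)
  have h1 : ∀ s, f.eval s = f.eval a + (s - a) * g.eval s := fun s => by
    have := congrArg (eval s) hg
    simp at this; linarith
  have h2 : ∀ s, g.eval s = g.eval a + (s - a) * R.eval s := fun s => by
    have := congrArg (eval s) hR
    simp at this; linarith
  have h3 : (derivative f).eval a = g.eval a := by
    have := congrArg (fun p => (derivative p).eval a) hg
    simpa using this
  exact ⟨R, fun s => by rw [h1 s, h2 s, h3]; ring⟩

theorem eval_eq_zero_of_sq_dvd {f : ℝ[X]} {a : ℝ} (h : (X - C a) ^ 2 ∣ f) :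
    f.eval a = 0 ∧ (derivative f).eval a = 0 := by
  obtain ⟨r, rfl⟩ := h
  constructor <;> simp [derivative_mul, derivative_pow]

end Polynomials

/-! ### Mass and moment defects of the clusters, and their control by p - q -/

section Mixture

variable {H H0 M : ℕ}

theorem sum_mixWeight (hH : 1 ≤ H) (v : MixParam H) : ∑ i, mixWeight v i = 1 := by
  obtain ⟨n, rfl⟩ : ∃ n, H = n + 1 := ⟨H - 1, by omega⟩
  rw [Fin.sum_univ_castSucc]
  have h1 : ∀ i : Fin n, mixWeight v i.castSucc = v (Sum.inr i) := fun i => by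
    rw [mixWeight, dif_pos (by simp)]; rfl
  have h2 : mixWeight v (Fin.last n) = 1 - ∑ j : Fin n, v (Sum.inr j) := by
    rw [mixWeight, dif_neg (by simp)]; rfl
  rw [h2, Finset.sum_congr rfl fun i _ => h1 i]
  ring

theorem contDiff_mixWeight (i : Fin H) : ContDiff ℝ ω fun v : MixParam H => mixWeight v i := by
  unfold mixWeight
  split_ifs <;> fun_prop

/-- The index of the component of the true distribution near which the component `i` of a split
point lies. -/
def clusterIdx (h : 1 ≤ H0) (i : Fin H) : Fin H0 := ⟨min i (H0 - 1), by omega⟩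

/-- The components of a split point that lie near the component `j` of the true distribution. -/
def cluster (H : ℕ) (h : 1 ≤ H0) (j : Fin H0) : Finset (Fin H) :=
  Finset.univ.filter fun i => clusterIdx h i = j

theorem cluster_of_lt (h : 1 ≤ H0) (hH : H0 ≤ H) {j : Fin H0} (hj : (j : ℕ) < H0 - 1) :
    cluster H h j = {⟨j, by omega⟩} := by
  ext i
  simp only [cluster, clusterIdx, Finset.mem_filter, Finset.mem_univ, true_and, Fin.ext_iff,
    Finset.mem_singleton]
  omega

theorem sum_cluster (h : 1 ≤ H0) (f : Fin H → ℝ) : ∑ j, ∑ i ∈ cluster H h j, f i = ∑ i, f i :=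
  Finset.sum_fiberwise _ _ _

/-- The setting of the theorem: a split point `P` for a mixture of `H0` components. -/
structure MixSetup (M : ℕ) {H H0 : ℕ} (w t : Fin H0 → ℝ) (P : MixParam H) : Prop where
  hH : 2 ≤ H
  hH0 : 1 ≤ H0
  hH0H : H0 ≤ H
  hH0M : 2 * H0 ≤ M
  sum_w : ∑ j, w j = 1
  t_inj : Function.Injective t
  split : IsSplitPoint w t P

/-- The difference of the integrals of `f` with respect to the mixing measure of `v` and to the
true one. -/
noncomputable def mixDiff (w t : Fin H0 → ℝ) (f : Polynomial ℝ) (v : MixParam H) : ℝ :=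
  ∑ i, mixWeight v i * f.eval (v (Sum.inl i)) - ∑ j, w j * f.eval (t j)

/-- The excess of the mass of the cluster `j`. -/
noncomputable def massDefect (h : 1 ≤ H0) (w : Fin H0 → ℝ) (j : Fin H0) (v : MixParam H) : ℝ :=
  ∑ i ∈ cluster H h j, mixWeight v i - w j

/-- The first moment of the cluster `j` around `t j`. -/
noncomputable def momentDefect (h : 1 ≤ H0) (t : Fin H0 → ℝ) (j : Fin H0) (v : MixParam H) : ℝ :=
  ∑ i ∈ cluster H h j, mixWeight v i * (v (Sum.inl i) - t j)

theorem sum_massDefect (h : 1 ≤ H0) (hH : 1 ≤ H) {w : Fin H0 → ℝ} (hw : ∑ j, w j = 1)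
    (v : MixParam H) : ∑ j, massDefect h w j v = 0 := by
  simp only [massDefect, Finset.sum_sub_distrib]
  rw [sum_cluster, sum_mixWeight hH, hw, sub_self]

/-- The second order expansion of `mixDiff`. -/
theorem exists_mixDiff_eq (h : 1 ≤ H0) (w t : Fin H0 → ℝ) (f : Polynomial ℝ) :
    ∃ R : Fin H0 → Polynomial ℝ, ∀ v : MixParam H, mixDiff w t f v =
      ∑ j, (f.eval (t j) * massDefect h w j v +
        (Polynomial.derivative f).eval (t j) * momentDefect h t j v) +
      ∑ i, mixWeight v i * (R (clusterIdx h i)).eval (v (Sum.inl i)) *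
        (v (Sum.inl i) - t (clusterIdx h i)) ^ 2 := by
  choose R hR using fun j => exists_eval_eq_taylor f (t j)
  refine ⟨R, fun v => ?_⟩
  rw [mixDiff, ← sum_cluster h (fun i => mixWeight v i * f.eval (v (Sum.inl i))),
    ← sum_cluster h (fun i => mixWeight v i * (R (clusterIdx h i)).eval (v (Sum.inl i)) *
      (v (Sum.inl i) - t (clusterIdx h i)) ^ 2), ← Finset.sum_sub_distrib,
    ← Finset.sum_add_distrib]
  refine Finset.sum_congr rfl fun j _ => ?_
  rw [massDefect, momentDefect, mul_sub, Finset.mul_sum, Finset.mul_sum, mul_comm (w j),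
    sub_add_eq_add_sub, sub_add_eq_add_sub, ← Finset.sum_add_distrib, ← Finset.sum_add_distrib]
  congr 1
  refine Finset.sum_congr rfl fun i hi => ?_
  have hij : clusterIdx h i = j := (Finset.mem_filter.1 hi).2
  rw [hij, hR j (v (Sum.inl i))]
  ring

namespace MixSetup

variable {w t : Fin H0 → ℝ} {P : MixParam H}

theorem theta_eq (S : MixSetup M w t P) (i : Fin H) :
    P (Sum.inl i) = t (clusterIdx S.hH0 i) := S.split.1 i _ rfl

theorem mixWeight_pos (h : IsSplitPoint w t P) (i : Fin H) : 0 < mixWeight P i := by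
  unfold mixWeight
  split_ifs
  · exact h.2.2.1 _
  · linarith [h.2.2.2]

theorem massDefect_of_lt (S : MixSetup M w t P) {j : Fin H0} {i : Fin (H - 1)}
    (hij : (i : ℕ) = j) (hi : (i : ℕ) < H0 - 1) (v : MixParam H) :
    massDefect S.hH0 w j v = v (Sum.inr i) - P (Sum.inr i) := by
  rw [massDefect, cluster_of_lt S.hH0 S.hH0H (hij ▸ hi), Finset.sum_singleton, mixWeight,
    dif_pos (show (j : ℕ) < H - 1 from hij ▸ i.2), S.split.2.1 i j hij.symm hi,
    show (⟨j, hij ▸ i.2⟩ : Fin (H - 1)) = i from Fin.ext hij.symm]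

/-- The excess of the last cluster is not a separate condition: the total excess is zero. -/
theorem massDefect_eq_zero (S : MixSetup M w t P) {v : MixParam H}
    (hv : ∀ i : Fin (H - 1), (i : ℕ) < H0 - 1 → v (Sum.inr i) = P (Sum.inr i)) (j : Fin H0) :
    massDefect S.hH0 w j v = 0 := by
  have hlt : ∀ j : Fin H0, (j : ℕ) < H0 - 1 → massDefect S.hH0 w j v = 0 := fun j hj => by
    have h1 := S.hH0H
    rw [S.massDefect_of_lt (i := ⟨j, by omega⟩) rfl hj, hv _ hj, sub_self]
  by_cases hj : (j : ℕ) < H0 - 1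
  · exact hlt j hj
  · have h1 := sum_massDefect S.hH0 (by linarith [S.hH]) S.sum_w v
    rw [Finset.sum_eq_single j] at h1
    · exact h1
    · intro k _ hk
      refine hlt k ?_
      have := Fin.val_ne_of_ne hk
      omega
    · simp

theorem mixDiff_eq_zero (S : MixSetup M w t P) {v : MixParam H}
    (hθ : ∀ i, v (Sum.inl i) = P (Sum.inl i))
    (hτ : ∀ i : Fin (H - 1), (i : ℕ) < H0 - 1 → v (Sum.inr i) = P (Sum.inr i))
    (f : Polynomial ℝ) : mixDiff w t f v = 0 := by
  obtain ⟨R, hR⟩ := exists_mixDiff_eq (H := H) S.hH0 w t f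
  have h1 : ∀ j, momentDefect S.hH0 t j v = 0 := fun j => Finset.sum_eq_zero fun i hi => by
    have hij : clusterIdx S.hH0 i = j := (Finset.mem_filter.1 hi).2
    rw [hθ, S.theta_eq, hij, sub_self, mul_zero]
  rw [hR v]
  simp [S.massDefect_eq_zero hτ, h1, hθ, S.theta_eq]

end MixSetup

open Asymptotics Polynomial

/-- The sum of the absolute values of the differences of the probabilities. -/
noncomputable def probDist (M : ℕ) (q : Fin (M + 1) → ℝ) (v : MixParam H) : ℝ :=
  ∑ x, |mixModel M H x v - q x|

theorem mixModel_sub_eq_mixDiff {w t : Fin H0 → ℝ} {q : Fin (M + 1) → ℝ}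
    (hq : ∀ x, q x = ∑ j, w j * binomialProb M x (t j)) (x : Fin (M + 1)) (v : MixParam H) :
    mixModel M H x v - q x = mixDiff w t (bernsteinPolynomial ℝ M x) v := by
  rw [hq, mixModel, mixDiff]
  simp only [binomialProb_eq_eval]

/-- A polynomial of degree at most M is a combination of the binomial probabilities, so its integral
against the difference of mixing measures is a fixed combination of the p(x) - q(x). -/
theorem mixDiff_isBigO {w t : Fin H0 → ℝ} {q : Fin (M + 1) → ℝ} {P : MixParam H}
    (hq : ∀ x, q x = ∑ j, w j * binomialProb M x (t j)) {f : ℝ[X]} (hf : f.natDegree ≤ M) :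
    mixDiff w t f =O[𝓝 P] probDist (H := H) M q := by
  obtain ⟨c, hc⟩ := exists_eval_eq_sum_binomialProb hf
  have h1 : mixDiff (H := H) w t f = fun v => ∑ x, c x * (mixModel M H x v - q x) := by
    funext v
    rw [mixDiff]
    simp only [hc, hq, mixModel, mul_sub, Finset.mul_sum, Finset.sum_sub_distrib]
    rw [Finset.sum_comm, Finset.sum_comm (s := Finset.univ (α := Fin H0))]
    congr 1 <;> exact Finset.sum_congr rfl fun x _ => Finset.sum_congr rfl fun i _ => by ring
  rw [h1]
  refine IsBigO.fun_sum fun x _ => IsBigO.const_mul_left (IsBigO.of_bound 1 ?_) _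
  refine Filter.Eventually.of_forall fun v => ?_
  rw [one_mul, Real.norm_eq_abs, Real.norm_eq_abs, probDist]
  exact (Finset.single_le_sum (f := fun x => |mixModel M H x v - q x|)
    (fun _ _ => abs_nonneg _) (Finset.mem_univ x)).trans (le_abs_self _)

theorem isBigO_continuous_mul {P : MixParam H} {f g D : MixParam H → ℝ} (hg : ContinuousAt g P)
    (hf : f =O[𝓝 P] D) : (fun v => g v * f v) =O[𝓝 P] D := by
  simpa using hg.isBigO_one ℝ |>.mul hf

theorem continuous_eval_theta (f : ℝ[X]) (i : Fin H) :
    Continuous fun v : MixParam H => f.eval (v (Sum.inl i)) :=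
  f.continuous.comp (continuous_apply _)

namespace MixSetup

variable {w t : Fin H0 → ℝ} {P : MixParam H} {q : Fin (M + 1) → ℝ}

/-- The polynomial with double zeros at the `t k`, `k ≠ j`. -/
noncomputable def testPoly (t : Fin H0 → ℝ) (j : Fin H0) : ℝ[X] :=
  ∏ k ∈ Finset.univ.erase j, (X - C (t k)) ^ 2

theorem testPoly_eval_ne_zero (ht : Function.Injective t) (j : Fin H0) :
    (testPoly t j).eval (t j) ≠ 0 := by
  rw [testPoly, eval_prod]
  refine Finset.prod_ne_zero_iff.2 fun k hk => ?_
  have : t j ≠ t k := fun h => Finset.ne_of_mem_erase hk (ht h).symm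
  simpa [sub_eq_zero] using this

theorem natDegree_testPoly_le (t : Fin H0 → ℝ) (j : Fin H0) :
    (testPoly t j).natDegree ≤ 2 * (H0 - 1) := by
  refine (natDegree_prod_le _ _).trans ?_
  refine (Finset.sum_le_card_nsmul _ _ 2 fun k _ => ?_).trans ?_
  · rw [natDegree_pow, natDegree_X_sub_C]
  · rw [Finset.card_erase_of_mem (Finset.mem_univ j), Finset.card_univ, Fintype.card_fin,
      smul_eq_mul, mul_comm]

theorem sq_dvd_testPoly (t : Fin H0 → ℝ) {j k : Fin H0} (h : k ≠ j) :
    (X - C (t k)) ^ 2 ∣ testPoly t j :=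
  Finset.dvd_prod_of_mem (fun k => (X - C (t k)) ^ 2) (Finset.mem_erase.2 ⟨h, Finset.mem_univ k⟩)

/-- The product of all (X - t_k)² has degree 2 * H0 ≤ M, is nonnegative and vanishes at all atoms of
the true mixing measure. With positive weights its integral is a sum of nonnegative terms, each of
which is therefore controlled; near t_j the polynomial is (X - t_j)² times a nonzero factor. -/
theorem sq_isBigO (S : MixSetup M w t P) (hq : ∀ x, q x = ∑ j, w j * binomialProb M x (t j))
    (i : Fin H) : (fun v : MixParam H => (v (Sum.inl i) - t (clusterIdx S.hH0 i)) ^ 2)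
      =O[𝓝 P] probDist (H := H) M q := by
  have hprod : ∀ j, (∏ k, (X - C (t k)) ^ 2 : ℝ[X]) = (X - C (t j)) ^ 2 * testPoly t j := fun j =>
    (Finset.mul_prod_erase _ _ (Finset.mem_univ j)).symm
  set f : ℝ[X] := ∏ k, (X - C (t k)) ^ 2 with hf
  have hdeg : f.natDegree ≤ M := by
    refine (natDegree_prod_le _ _).trans ?_
    refine (Finset.sum_le_card_nsmul _ _ 2 fun k _ => ?_).trans ?_
    · rw [natDegree_pow, natDegree_X_sub_C]
    · rw [Finset.card_univ, Fintype.card_fin, smul_eq_mul, mul_comm]; exact S.hH0M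
  have hf0 : ∀ s, 0 ≤ f.eval s := fun s => by
    rw [hf, eval_prod]
    exact Finset.prod_nonneg fun k _ => by rw [eval_pow]; positivity
  have hw : ∀ᶠ v in 𝓝 P, ∀ i, 0 < mixWeight v i := Filter.eventually_all.2 fun i =>
    (contDiff_mixWeight i).continuous.continuousAt.eventually
      (Ioi_mem_nhds (mixWeight_pos S.split i))
  have h1 : (fun v : MixParam H => mixWeight v i * f.eval (v (Sum.inl i)))
      =O[𝓝 P] probDist (H := H) M q := by
    refine IsBigO.trans (IsBigO.of_bound 1 ?_) (mixDiff_isBigO (w := w) (t := t) hq hdeg)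
    filter_upwards [hw] with v hv
    have h2 : mixDiff w t f v = ∑ i, mixWeight v i * f.eval (v (Sum.inl i)) := by
      have h3 : ∀ j, f.eval (t j) = 0 := fun j => by rw [hprod j]; simp
      simp [mixDiff, h3]
    have h4 : ∀ i, 0 ≤ mixWeight v i * f.eval (v (Sum.inl i)) := fun i =>
      mul_nonneg (hv i).le (hf0 _)
    rw [one_mul, h2, Real.norm_eq_abs, Real.norm_eq_abs, abs_of_nonneg (h4 i)]
    exact (Finset.single_le_sum (f := fun i => mixWeight v i * f.eval (v (Sum.inl i)))
      (fun i _ => h4 i) (Finset.mem_univ i)).trans (le_abs_self _)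
  set j := clusterIdx S.hH0 i with hj
  have hc : Continuous fun v : MixParam H =>
      mixWeight v i * (testPoly t j).eval (v (Sum.inl i)) :=
    (contDiff_mixWeight i).continuous.mul (continuous_eval_theta _ i)
  have hc0 : mixWeight P i * (testPoly t j).eval (P (Sum.inl i)) ≠ 0 := by
    rw [S.theta_eq i]
    exact mul_ne_zero (mixWeight_pos S.split i).ne' (testPoly_eval_ne_zero S.t_inj j)
  refine (isBigO_continuous_mul (hc.continuousAt.inv₀ hc0) h1).congr' ?_ Filter.EventuallyEq.rfl
  filter_upwards [hc.continuousAt.eventually_ne hc0] with v hv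
  rw [hprod j, eval_mul, eval_pow, eval_sub, eval_X, eval_C, Pi.inv_apply]
  field_simp
  exact mul_div_cancel_left₀ _ hv

/-- Double zeros at the other t_k remove the other clusters from the zeroth and first order terms,
and `sq_isBigO` absorbs the second order remainder. -/
theorem defects_isBigO (S : MixSetup M w t P)
    (hq : ∀ x, q x = ∑ j, w j * binomialProb M x (t j)) {j : Fin H0} {f : ℝ[X]}
    (hf : f.natDegree ≤ M) (hfj : ∀ k ≠ j, (X - C (t k)) ^ 2 ∣ f) :
    (fun v : MixParam H => f.eval (t j) * massDefect S.hH0 w j v +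
      (derivative f).eval (t j) * momentDefect S.hH0 t j v)
      =O[𝓝 P] probDist (H := H) M q := by
  obtain ⟨R, hR⟩ := exists_mixDiff_eq (H := H) S.hH0 w t f
  have h1 : (fun v : MixParam H => ∑ i, mixWeight v i *
      (R (clusterIdx S.hH0 i)).eval (v (Sum.inl i)) *
        (v (Sum.inl i) - t (clusterIdx S.hH0 i)) ^ 2) =O[𝓝 P] probDist (H := H) M q :=
    IsBigO.fun_sum fun i _ => isBigO_continuous_mul
      (g := fun v => mixWeight v i * (R (clusterIdx S.hH0 i)).eval (v (Sum.inl i)))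
      (((contDiff_mixWeight i).continuous.mul (continuous_eval_theta _ i)).continuousAt)
      (S.sq_isBigO hq i)
  refine ((mixDiff_isBigO (w := w) (t := t) hq hf).sub h1).congr_left fun v => ?_
  rw [hR v, add_sub_cancel_right, Finset.sum_eq_single j]
  · intro k _ hk
    obtain ⟨h2, h3⟩ := eval_eq_zero_of_sq_dvd (hfj k hk)
    rw [h2, h3, zero_mul, zero_mul, add_zero]
  · simp

/-- The extra factor X - t_j kills the mass term; the degree is then at most 2 * H0 - 1. -/
theorem momentDefect_isBigO (S : MixSetup M w t P)
    (hq : ∀ x, q x = ∑ j, w j * binomialProb M x (t j)) (j : Fin H0) :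
    momentDefect S.hH0 t j =O[𝓝 P] probDist (H := H) M q := by
  have h := S.defects_isBigO hq (j := j) (f := (X - C (t j)) * testPoly t j) (by
    refine natDegree_mul_le.trans ?_
    have h1 := natDegree_testPoly_le t j
    have h2 := S.hH0M
    have h3 := S.hH0
    rw [natDegree_X_sub_C]
    omega) fun k hk => (sq_dvd_testPoly t hk).mul_left _
  have h0 := testPoly_eval_ne_zero S.t_inj j
  have h1 := h.const_mul_left ((testPoly t j).eval (t j))⁻¹
  refine h1.congr_left fun v => ?_
  simp only [eval_mul, eval_sub, eval_X, eval_C, sub_self, zero_mul, zero_add, derivative_mul,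
    eval_add, derivative_sub, derivative_X, derivative_C, sub_zero, one_mul, add_zero]
  rw [← mul_assoc, inv_mul_cancel₀ h0, one_mul]

/-- The test polynomial may have nonzero derivative at t_j, so the moment term, already controlled,
is subtracted. -/
theorem massDefect_isBigO (S : MixSetup M w t P)
    (hq : ∀ x, q x = ∑ j, w j * binomialProb M x (t j)) (j : Fin H0) :
    massDefect S.hH0 w j =O[𝓝 P] probDist (H := H) M q := by
  have h := S.defects_isBigO hq (j := j) (f := testPoly t j) (by
    have h1 := natDegree_testPoly_le t j
    have h2 := S.hH0M
    omega) fun k hk => sq_dvd_testPoly t hk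
  have h0 := testPoly_eval_ne_zero S.t_inj j
  have h1 := (h.sub ((S.momentDefect_isBigO hq j).const_mul_left
    ((derivative (testPoly t j)).eval (t j)))).const_mul_left ((testPoly t j).eval (t j))⁻¹
  refine h1.congr_left fun v => ?_
  rw [add_sub_cancel_right, ← mul_assoc, inv_mul_cancel₀ h0, one_mul]

end MixSetup

end Mixture

/-! ### Comparison of the Kullback-Leibler divergence with ∑ (p - q)² -/

section KullbackLeibler

variable {H M : ℕ}

theorem contDiff_mixModel (x : Fin (M + 1)) :
    ContDiff ℝ ω fun v : MixParam H => mixModel M H x v := by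
  unfold mixModel binomialProb
  refine ContDiff.sum fun i _ => (contDiff_mixWeight i).mul ?_
  fun_prop

theorem sum_mixModel (hH : 1 ≤ H) (v : MixParam H) : ∑ x, mixModel M H x v = 1 := by
  simp only [mixModel]
  rw [Finset.sum_comm, ← sum_mixWeight hH v]
  exact Finset.sum_congr rfl fun i _ => by rw [← Finset.mul_sum, sum_binomialProb, mul_one]

variable {q : Fin (M + 1) → ℝ}

theorem klMix_term_eq {a p : ℝ} (ha : 0 < a) :
    a * Real.log (a / p) = a * ((p - a) / a - Real.log (1 + (p - a) / a)) - (p - a) := by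
  have h1 : 1 + (p - a) / a = p / a := by field_simp; ring
  rw [h1, ← inv_div p a, Real.log_inv, mul_sub, mul_div_cancel₀ _ ha.ne']
  ring

/-- Both p and q have total mass one, also for parameters outside the parameter space, so the first
order terms p - q add up to zero. -/
theorem klMix_eq_sum (hH : 1 ≤ H) (hq : ∀ x, 0 < q x) (hq1 : ∑ x, q x = 1) (v : MixParam H) :
    klMix M H q v = ∑ x, q x * ((mixModel M H x v - q x) / q x -
      Real.log (1 + (mixModel M H x v - q x) / q x)) := by
  rw [klMix, Finset.sum_congr rfl fun x _ => klMix_term_eq (hq x), Finset.sum_sub_distrib,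
    Finset.sum_sub_distrib (f := fun x => mixModel M H x v), sum_mixModel hH, hq1, sub_self, sub_zero]

theorem klMix_eq_sum_sq {ψ : ℝ → ℝ} (hψ : ∀ u, -1 < u → Real.log (1 + u) = u - u ^ 2 * ψ u)
    (hH : 1 ≤ H) (hq : ∀ x, 0 < q x) (hq1 : ∑ x, q x = 1) {v : MixParam H}
    (hv : ∀ x, 0 < mixModel M H x v) :
    klMix M H q v = ∑ x, (mixModel M H x v - q x) ^ 2 *
      ((q x)⁻¹ * ψ ((mixModel M H x v - q x) / q x)) := by
  rw [klMix_eq_sum hH hq hq1]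
  refine Finset.sum_congr rfl fun x _ => ?_
  have h0 := hq x
  have h1 : -1 < (mixModel M H x v - q x) / q x := by
    rw [lt_div_iff₀ h0]; linarith [hv x]
  rw [hψ _ h1]
  field_simp
  ring

/-- Cauchy-Schwarz over the M + 1 outcomes combined with the quadratic lower bound for u - log (1 +
u). The condition p ≤ 4 q is u ≤ 3, and q ≤ 1 allows the factor 1 / q to be dropped. -/
theorem probDist_sq_le_klMix (hH : 1 ≤ H) (hq : ∀ x, 0 < q x) (hq1 : ∑ x, q x = 1)
    {v : MixParam H} (hv : ∀ x, 0 < mixModel M H x v) (hv' : ∀ x, mixModel M H x v ≤ 4 * q x) :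
    probDist M q v ^ 2 ≤ 9 * (M + 1) * klMix M H q v := by
  have h1 : probDist M q v ^ 2 ≤ (M + 1) * ∑ x, (mixModel M H x v - q x) ^ 2 := by
    have := sq_sum_le_card_mul_sum_sq (s := Finset.univ)
      (f := fun x : Fin (M + 1) => |mixModel M H x v - q x|)
    simpa [probDist, sq_abs] using this
  have h2 : ∑ x, (mixModel M H x v - q x) ^ 2 ≤ 9 * klMix M H q v := by
    rw [klMix_eq_sum hH hq hq1, Finset.mul_sum]
    refine Finset.sum_le_sum fun x _ => ?_
    have h0 := hq x
    have hle : q x ≤ 1 := hq1 ▸ Finset.single_le_sum (fun y _ => (hq y).le) (Finset.mem_univ x)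
    have h3 := sq_div_nine_le_sub_log (u := (mixModel M H x v - q x) / q x)
      (by rw [lt_div_iff₀ h0]; linarith [hv x]) (by rw [div_le_iff₀ h0]; linarith [hv' x])
    have h4 := mul_le_mul_of_nonneg_left h3 (mul_pos (by norm_num : (0 : ℝ) < 9) h0).le
    refine le_trans ?_ (h4.trans_eq (mul_assoc _ _ _))
    rw [div_pow, show 9 * q x * ((mixModel M H x v - q x) ^ 2 / q x ^ 2 / 9) =
      (mixModel M H x v - q x) ^ 2 / q x by field_simp]
    rw [le_div_iff₀ h0]
    exact mul_le_of_le_one_right (sq_nonneg _) hle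
  calc probDist M q v ^ 2 ≤ _ := h1
    _ ≤ (M + 1) * (9 * klMix M H q v) := by gcongr
    _ = _ := by ring

end KullbackLeibler

/-! ### Split points: realizability, nearby solutions, existence -/

section SplitPoint

open Asymptotics

variable {H H0 M : ℕ}

namespace MixSetup

variable {w t : Fin H0 → ℝ} {P : MixParam H} {q : Fin (M + 1) → ℝ}

theorem sum_eq_one (S : MixSetup M w t P)
    (hq : ∀ x, q x = ∑ j, w j * binomialProb M x (t j)) : ∑ x, q x = 1 := by
  simp only [hq]
  rw [Finset.sum_comm, ← S.sum_w]
  exact Finset.sum_congr rfl fun i _ => by rw [← Finset.mul_sum, sum_binomialProb, mul_one]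

theorem mixModel_eq (S : MixSetup M w t P)
    (hq : ∀ x, q x = ∑ j, w j * binomialProb M x (t j)) {v : MixParam H}
    (hθ : ∀ i, v (Sum.inl i) = P (Sum.inl i))
    (hτ : ∀ i : Fin (H - 1), (i : ℕ) < H0 - 1 → v (Sum.inr i) = P (Sum.inr i))
    (x : Fin (M + 1)) : mixModel M H x v = q x := by
  have := mixModel_sub_eq_mixDiff (H := H) hq x v
  rw [S.mixDiff_eq_zero hθ hτ] at this
  linarith

theorem mem_realizable (S : MixSetup M w t P)
    (hq : ∀ x, q x = ∑ j, w j * binomialProb M x (t j)) (ht : ∀ j, t j ∈ Set.Icc (0 : ℝ) 1) :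
    P ∈ realizable M H q := by
  refine ⟨⟨?_, S.split.2.2.2.le⟩, S.mixModel_eq hq (fun _ => rfl) fun _ _ => rfl⟩
  rintro (i | i)
  · rw [S.theta_eq]; exact ht _
  · exact ⟨(S.split.2.2.1 i).le, (Finset.single_le_sum (f := fun i => P (Sum.inr i))
      (fun j _ => (S.split.2.2.1 j).le) (Finset.mem_univ i)).trans S.split.2.2.2.le⟩

/-- The solution set of `p(· | v) = q` close to a split point. -/
theorem eventually_solution_iff (S : MixSetup M w t P)
    (hq : ∀ x, q x = ∑ j, w j * binomialProb M x (t j)) :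
    ∀ᶠ v in 𝓝 P, (∀ x, mixModel M H x v = q x) ↔
      (∀ i : Fin H, v (Sum.inl i) = P (Sum.inl i)) ∧
      (∀ i : Fin (H - 1), (i : ℕ) < H0 - 1 → v (Sum.inr i) = P (Sum.inr i)) := by
  have h1 : ∀ᶠ v in 𝓝 P, ∀ i, probDist M q v = 0 →
      (v (Sum.inl i) - t (clusterIdx S.hH0 i)) ^ 2 = 0 :=
    Filter.eventually_all.2 fun i => (S.sq_isBigO hq i).eq_zero_imp
  have h2 : ∀ᶠ v in 𝓝 P, ∀ j, probDist M q v = 0 → massDefect S.hH0 w j v = 0 :=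
    Filter.eventually_all.2 fun j => (S.massDefect_isBigO hq j).eq_zero_imp
  filter_upwards [h1, h2] with v h1 h2
  refine ⟨fun h => ?_, fun h => S.mixModel_eq hq h.1 h.2⟩
  have h0 : probDist M q v = 0 := Finset.sum_eq_zero fun x _ => by rw [h x, sub_self, abs_zero]
  refine ⟨fun i => ?_, fun i hi => ?_⟩
  · rw [S.theta_eq, ← sub_eq_zero, ← sq_eq_zero_iff]
    exact h1 i h0
  · have := h2 ⟨i, by omega⟩ h0
    rw [S.massDefect_of_lt rfl hi] at this
    linarith

end MixSetup

/-- Share the weight of each true component equally among the members of its cluster. -/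
theorem exists_isSplitPoint (hH : 2 ≤ H) (hH0 : 1 ≤ H0) (hH0H : H0 ≤ H) {w : Fin H0 → ℝ}
    (t : Fin H0 → ℝ) (hw : ∀ j, 0 < w j) (hw1 : ∑ j, w j = 1) :
    ∃ P : MixParam H, IsSplitPoint w t P := by
  obtain ⟨n, rfl⟩ : ∃ n, H = n + 1 := ⟨H - 1, by omega⟩
  set μ : Fin (n + 1) → ℝ := fun i =>
    w (clusterIdx hH0 i) / (cluster (n + 1) hH0 (clusterIdx hH0 i)).card with hμ
  have hcard : ∀ i : Fin (n + 1), 0 < (cluster (n + 1) hH0 (clusterIdx hH0 i)).card := fun i =>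
    Finset.card_pos.2 ⟨i, Finset.mem_filter.2 ⟨Finset.mem_univ i, rfl⟩⟩
  have hμ0 : ∀ i, 0 < μ i := fun i => div_pos (hw _) (Nat.cast_pos.2 (hcard i))
  have hμ1 : ∑ i, μ i = 1 := by
    rw [← sum_cluster hH0, ← hw1]
    refine Finset.sum_congr rfl fun j _ => ?_
    have h1 : clusterIdx hH0 (⟨j, by omega⟩ : Fin (n + 1)) = j := by
      ext; simp only [clusterIdx]; omega
    have h2 := hcard ⟨j, by omega⟩
    rw [h1] at h2
    have h3 : ∀ i ∈ cluster (n + 1) hH0 j, μ i = w j / (cluster (n + 1) hH0 j).card := by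
      intro i hi
      simp only [hμ, (Finset.mem_filter.1 hi).2]
    rw [Finset.sum_congr rfl h3, Finset.sum_const, nsmul_eq_mul, mul_div_cancel₀]
    exact (Nat.cast_pos.2 h2).ne'
  refine ⟨Sum.elim (fun i => t (clusterIdx hH0 i)) fun i => μ (Fin.castSucc i), ?_, ?_, ?_, ?_⟩
  · intro i j hij
    exact congrArg t (Fin.ext hij.symm)
  · intro i j hij hi
    have h1 : clusterIdx hH0 (Fin.castSucc i : Fin (n + 1)) = j := by
      ext; simp only [clusterIdx, Fin.val_castSucc]; omega
    rw [Sum.elim_inr, hμ]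
    simp only [h1]
    rw [cluster_of_lt hH0 hH0H (by omega), Finset.card_singleton, Nat.cast_one, div_one]
  · exact fun i => hμ0 _
  · rw [Fin.sum_univ_castSucc] at hμ1
    have := hμ0 (Fin.last n)
    simp only [Sum.elim_inr]
    change ∑ i : Fin n, μ i.castSucc < 1
    linarith

end SplitPoint

/-! ### Coordinates adapted to a split point -/

section SplitCoordinates

open Asymptotics

variable {H H0 M : ℕ}

theorem mixWeight_congr {v v' : MixParam H} (h : ∀ j, v (Sum.inr j) = v' (Sum.inr j)) (i : Fin H) :
    mixWeight v i = mixWeight v' i := by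
  simp only [mixWeight, h]

/-- The last component. -/
def lastIdx (hH : 2 ≤ H) : Fin H := ⟨H - 1, by omega⟩

/-- A component in the cluster `j`; it is the last one for the last cluster. -/
def clusterRep (hH : 2 ≤ H) (hH0H : H0 ≤ H) (j : Fin H0) : Fin H :=
  if (j : ℕ) < H0 - 1 then ⟨j, by omega⟩ else lastIdx hH

theorem clusterIdx_lastIdx (hH : 2 ≤ H) (h : 1 ≤ H0) (hH0H : H0 ≤ H) :
    (clusterIdx h (lastIdx hH) : ℕ) = H0 - 1 := by
  simp only [clusterIdx, lastIdx]; omega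

/-- The indices of the coordinates that enter the ideal of `K` linearly. -/
def linIdx (H H0 : ℕ) : Finset (Fin H ⊕ Fin (H - 1)) :=
  (Finset.univ.filter fun i : Fin H => ¬(H0 - 1 ≤ (i : ℕ) ∧ (i : ℕ) < H - 1)).disjSum
    (Finset.univ.filter fun i : Fin (H - 1) => (i : ℕ) < H0 - 1)

/-- The indices of the coordinates that enter the ideal of `K` quadratically. -/
def sqIdx (H H0 : ℕ) : Finset (Fin H ⊕ Fin (H - 1)) :=
  (Finset.univ.filter fun i : Fin H => H0 - 1 ≤ (i : ℕ) ∧ (i : ℕ) < H - 1).disjSum ∅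

theorem mem_linIdx_inl {i : Fin H} :
    Sum.inl i ∈ linIdx H H0 ↔ ¬(H0 - 1 ≤ (i : ℕ) ∧ (i : ℕ) < H - 1) := by
  simp only [linIdx, Finset.inl_mem_disjSum, Finset.mem_filter, Finset.mem_univ, true_and]

theorem mem_linIdx_inr {i : Fin (H - 1)} : Sum.inr i ∈ linIdx H H0 ↔ (i : ℕ) < H0 - 1 := by
  simp only [linIdx, Finset.inr_mem_disjSum, Finset.mem_filter, Finset.mem_univ, true_and]

theorem mem_sqIdx_inl {i : Fin H} :
    Sum.inl i ∈ sqIdx H H0 ↔ H0 - 1 ≤ (i : ℕ) ∧ (i : ℕ) < H - 1 := by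
  simp only [sqIdx, Finset.inl_mem_disjSum, Finset.mem_filter, Finset.mem_univ, true_and]

theorem disjoint_linIdx_sqIdx : Disjoint (linIdx H H0) (sqIdx H H0) := by
  rw [Finset.disjoint_left]
  rintro (i | i) h1 h2
  · exact mem_linIdx_inl.1 h1 (mem_sqIdx_inl.1 h2)
  · simp [sqIdx] at h2

theorem card_filter_interval {n a b : ℕ} (hb : b ≤ n) :
    (Finset.univ.filter fun i : Fin n => a ≤ (i : ℕ) ∧ (i : ℕ) < b).card = b - a := by
  rw [← Finset.card_map Fin.valEmbedding, ← Nat.card_Ico]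
  congr 1
  ext k
  simp only [Finset.mem_map, Finset.mem_filter, Finset.mem_univ, true_and, Fin.valEmbedding_apply,
    Finset.mem_Ico]
  exact ⟨by rintro ⟨i, h, rfl⟩; exact h, fun h => ⟨⟨k, by omega⟩, h, rfl⟩⟩

theorem card_sqIdx (hH0 : 1 ≤ H0) (hH0H : H0 ≤ H) : (sqIdx H H0).card = H - H0 := by
  rw [sqIdx, Finset.card_disjSum, Finset.card_empty, card_filter_interval (by omega)]
  omega

/-- There are H0 locations, one per cluster, and the weights of the first H0 - 1 components. -/
theorem card_linIdx (hH0 : 1 ≤ H0) (hH0H : H0 ≤ H) : (linIdx H H0).card = 2 * H0 - 1 := by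
  have h1 := Finset.card_filter_add_card_filter_not (s := Finset.univ)
    (fun i : Fin H => H0 - 1 ≤ (i : ℕ) ∧ (i : ℕ) < H - 1)
  rw [card_filter_interval (by omega), Finset.card_univ, Fintype.card_fin] at h1
  have h2 := card_filter_interval (n := H - 1) (a := 0) (b := H0 - 1) (by omega)
  simp only [zero_le, true_and] at h2
  rw [linIdx, Finset.card_disjSum, h2]
  omega

namespace MixSetup

variable {w t : Fin H0 → ℝ} {P : MixParam H} {q : Fin (M + 1) → ℝ}

/-- The coefficients of the linear forms that express the `θ i - t (clusterIdx i)` in the new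
coordinates. -/
noncomputable def thetaCoeff (hH : 2 ≤ H) (h : 1 ≤ H0) (P : MixParam H) (i k : Fin H)
    (x : MixParam H) : ℝ :=
  if i = k then 1 else if i = lastIdx hH ∧ k ∈ cluster H h (clusterIdx h (lastIdx hH)) then
    -(mixWeight (P + x) k / mixWeight (P + x) (lastIdx hH)) else 0

/-- The shear that makes the first moment of the last cluster a multiple of a coordinate. -/
noncomputable def shearFun (hH : 2 ≤ H) (h : 1 ≤ H0) (P x : MixParam H) : ℝ :=
  ∑ k ∈ (cluster H h (clusterIdx h (lastIdx hH))).erase (lastIdx hH),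
    mixWeight (P + x) k / mixWeight (P + x) (lastIdx hH) * x (Sum.inl k)

/-- The inverse of the coordinates at the split point `P`. -/
noncomputable def splitMap (hH : 2 ≤ H) (h : 1 ≤ H0) (P x : MixParam H) : MixParam H :=
  P + (x + (-shearFun hH h P x) • Pi.single (Sum.inl (lastIdx hH)) 1)

theorem splitMap_inr (hH : 2 ≤ H) (h : 1 ≤ H0) (P x : MixParam H) (i : Fin (H - 1)) :
    splitMap hH h P x (Sum.inr i) = P (Sum.inr i) + x (Sum.inr i) := by
  simp [splitMap]

theorem splitMap_inl (hH : 2 ≤ H) (h : 1 ≤ H0) (P x : MixParam H) {i : Fin H}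
    (hi : i ≠ lastIdx hH) : splitMap hH h P x (Sum.inl i) = P (Sum.inl i) + x (Sum.inl i) := by
  simp [splitMap, hi]

theorem splitMap_last (hH : 2 ≤ H) (h : 1 ≤ H0) (P x : MixParam H) :
    splitMap hH h P x (Sum.inl (lastIdx hH)) =
      P (Sum.inl (lastIdx hH)) + x (Sum.inl (lastIdx hH)) - shearFun hH h P x := by
  simp [splitMap]; ring

theorem mixWeight_splitMap (hH : 2 ≤ H) (h : 1 ≤ H0) (P x : MixParam H) (i : Fin H) :
    mixWeight (splitMap hH h P x) i = mixWeight (P + x) i :=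
  mixWeight_congr (fun j => by rw [splitMap_inr]; rfl) i

/-- Only the last location is sheared; its displacement involves the coordinates of the whole last
cluster, while the other displacements are coordinates. -/
theorem splitMap_inl_sub (S : MixSetup M w t P) (x : MixParam H) (i : Fin H) :
    splitMap S.hH S.hH0 P x (Sum.inl i) - t (clusterIdx S.hH0 i) =
      ∑ k, thetaCoeff S.hH S.hH0 P i k x * x (Sum.inl k) := by
  rw [← Finset.add_sum_erase _ _ (Finset.mem_univ i), thetaCoeff, if_pos rfl, one_mul,
    ← S.theta_eq]
  by_cases hi : i = lastIdx S.hH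
  · subst hi
    rw [splitMap_last, shearFun]
    have h1 : (cluster H S.hH0 (clusterIdx S.hH0 (lastIdx S.hH))).erase (lastIdx S.hH) ⊆
        Finset.univ.erase (lastIdx S.hH) := Finset.erase_subset_erase _ (Finset.subset_univ _)
    rw [← Finset.sum_subset h1]
    · rw [add_sub_assoc, add_sub_cancel_left, sub_eq_add_neg, ← Finset.sum_neg_distrib]
      congr 1
      refine Finset.sum_congr rfl fun k hk => ?_
      rw [thetaCoeff, if_neg (Finset.ne_of_mem_erase hk).symm,
        if_pos ⟨rfl, Finset.mem_of_mem_erase hk⟩, neg_mul]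
    · intro k hk hk'
      rw [thetaCoeff, if_neg (Finset.ne_of_mem_erase hk).symm, if_neg, zero_mul]
      exact fun h => hk' (Finset.mem_erase.2 ⟨Finset.ne_of_mem_erase hk, h.2⟩)
  · rw [splitMap_inl _ _ _ _ hi, add_sub_cancel_left, Finset.sum_eq_zero, add_zero]
    intro k hk
    rw [thetaCoeff, if_neg (Finset.ne_of_mem_erase hk).symm, if_neg (fun h => hi h.1), zero_mul]

theorem clusterRep_mem (S : MixSetup M w t P) (j : Fin H0) :
    Sum.inl (clusterRep S.hH S.hH0H j) ∈ linIdx H H0 := by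
  rw [mem_linIdx_inl, clusterRep]
  split_ifs
  · simp only; omega
  · simp only [lastIdx]; omega

/-- The shear subtracts from the last location the weighted displacements of its cluster mates,
divided by the last weight; this cancels their contribution to the first moment. -/
theorem momentDefect_splitMap (S : MixSetup M w t P) {x : MixParam H}
    (hx : mixWeight (P + x) (lastIdx S.hH) ≠ 0) (j : Fin H0) :
    momentDefect S.hH0 t j (splitMap S.hH S.hH0 P x) =
      mixWeight (P + x) (clusterRep S.hH S.hH0H j) *
        x (Sum.inl (clusterRep S.hH S.hH0H j)) := by
  have h1 := S.hH0H
  by_cases hj : (j : ℕ) < H0 - 1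
  · have h2 : (⟨j, by omega⟩ : Fin H) ≠ lastIdx S.hH := by
      simp only [lastIdx, ne_eq, Fin.mk.injEq]; omega
    rw [momentDefect, cluster_of_lt S.hH0 S.hH0H hj, Finset.sum_singleton, mixWeight_splitMap,
      splitMap_inl _ _ _ _ h2, S.theta_eq, clusterRep, if_pos hj,
      show clusterIdx S.hH0 (⟨j, by omega⟩ : Fin H) = j by
        ext; simp only [clusterIdx]; omega, add_sub_cancel_left]
  · have h2 : clusterIdx S.hH0 (lastIdx S.hH) = j := by
      ext; rw [clusterIdx_lastIdx _ _ S.hH0H]; omega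
    have h3 : lastIdx S.hH ∈ cluster H S.hH0 j := Finset.mem_filter.2 ⟨Finset.mem_univ _, h2⟩
    have h4 : t j = P (Sum.inl (lastIdx S.hH)) := by rw [S.theta_eq, h2]
    have h5 : ∀ k ∈ (cluster H S.hH0 j).erase (lastIdx S.hH),
        mixWeight (P + x) k * (splitMap S.hH S.hH0 P x (Sum.inl k) - t j) =
          mixWeight (P + x) (lastIdx S.hH) *
            (mixWeight (P + x) k / mixWeight (P + x) (lastIdx S.hH) * x (Sum.inl k)) := by
      intro k hk
      have h6 : clusterIdx S.hH0 k = j := (Finset.mem_filter.1 (Finset.mem_of_mem_erase hk)).2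
      rw [splitMap_inl _ _ _ _ (Finset.ne_of_mem_erase hk), S.theta_eq, h6]
      field_simp
      ring
    simp only [momentDefect, mixWeight_splitMap]
    rw [clusterRep, if_neg hj, ← Finset.add_sum_erase _ _ h3, Finset.sum_congr rfl h5,
      ← Finset.mul_sum, splitMap_last, shearFun, h2, h4]
    ring

theorem massDefect_splitMap (S : MixSetup M w t P) (x : MixParam H) {j : Fin H0}
    {i : Fin (H - 1)} (hij : (i : ℕ) = j) (hi : (i : ℕ) < H0 - 1) :
    massDefect S.hH0 w j (splitMap S.hH S.hH0 P x) = x (Sum.inr i) := by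
  rw [S.massDefect_of_lt hij hi, splitMap_inr, add_sub_cancel_left]

/-- The domain of the coordinates. -/
def splitDomain (hH : 2 ≤ H) (P : MixParam H) : Set (MixParam H) :=
  {x | 0 < mixWeight (P + x) (lastIdx hH)}

theorem contDiff_mixWeight_add (P : MixParam H) (i : Fin H) :
    ContDiff ℝ ω fun x => mixWeight (P + x) i :=
  (contDiff_mixWeight i).comp (contDiff_const.add contDiff_id)

theorem isOpen_splitDomain (hH : 2 ≤ H) (P : MixParam H) : IsOpen (splitDomain hH P) :=
  isOpen_lt continuous_const (contDiff_mixWeight_add P _).continuous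

theorem zero_mem_splitDomain (S : MixSetup M w t P) : 0 ∈ splitDomain S.hH P := by
  have := mixWeight_pos S.split (lastIdx S.hH)
  simpa [splitDomain] using this

theorem contDiffOn_ratio (hH : 2 ≤ H) (P : MixParam H) (k : Fin H) :
    ContDiffOn ℝ ω (fun x => mixWeight (P + x) k / mixWeight (P + x) (lastIdx hH))
      (splitDomain hH P) :=
  (contDiff_mixWeight_add P k).contDiffOn.div (contDiff_mixWeight_add P _).contDiffOn
    fun _ hx => ne_of_gt hx

theorem contDiffOn_shearFun (hH : 2 ≤ H) (h : 1 ≤ H0) (P : MixParam H) :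
    ContDiffOn ℝ ω (shearFun hH h P) (splitDomain hH P) :=
  ContDiffOn.sum fun k _ => (contDiffOn_ratio hH P k).mul (by fun_prop)

theorem contDiffOn_thetaCoeff (hH : 2 ≤ H) (h : 1 ≤ H0) (P : MixParam H) (i k : Fin H) :
    ContDiffOn ℝ ω (thetaCoeff hH h P i k) (splitDomain hH P) := by
  unfold thetaCoeff
  split_ifs
  · exact contDiffOn_const
  · exact (contDiffOn_ratio hH P k).neg
  · exact contDiffOn_const

theorem mixWeight_add_smul (hH : 2 ≤ H) (P x : MixParam H) (s : ℝ) (i : Fin H) :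
    mixWeight (P + (x + s • Pi.single (Sum.inl (lastIdx hH)) 1)) i = mixWeight (P + x) i :=
  mixWeight_congr (fun j => by simp) i

theorem shearFun_add_smul (hH : 2 ≤ H) (h : 1 ≤ H0) (P x : MixParam H) (s : ℝ) :
    shearFun hH h P (x + s • Pi.single (Sum.inl (lastIdx hH)) 1) = shearFun hH h P x := by
  simp only [shearFun, mixWeight_add_smul]
  refine Finset.sum_congr rfl fun k hk => ?_
  simp [Finset.ne_of_mem_erase hk]

theorem unimodularCoords (S : MixSetup M w t P) :
    UnimodularCoords P (splitDomain S.hH P) ((fun y => y - P) ⁻¹' splitDomain S.hH P)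
      (splitMap S.hH S.hH0 P)
      (fun y => y - P + shearFun S.hH S.hH0 P (y - P) • Pi.single (Sum.inl (lastIdx S.hH)) 1) :=
  UnimodularCoords.shear P (isOpen_splitDomain S.hH P) S.zero_mem_splitDomain
    (Sum.inl (lastIdx S.hH)) (contDiffOn_shearFun S.hH S.hH0 P)
    (fun x hx s => by rw [splitDomain, Set.mem_ofPred_eq, mixWeight_add_smul]; exact hx)
    (fun x s => shearFun_add_smul S.hH S.hH0 P x s) (by simp [shearFun])

end MixSetup

end SplitCoordinates

/-! ### Ideal membership, lower bound and threshold at a split point -/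

section SplitThreshold

open Asymptotics Polynomial

variable {H H0 M : ℕ}

namespace MixSetup

variable {w t : Fin H0 → ℝ} {P : MixParam H} {q : Fin (M + 1) → ℝ}

theorem analyticAt_of_contDiffOn (S : MixSetup M w t P) {E : Type} [NormedAddCommGroup E]
    [NormedSpace ℝ E] [CompleteSpace E] {f : MixParam H → E}
    (hf : ContDiffOn ℝ ω f (splitDomain S.hH P)) : AnalyticAt ℝ f 0 :=
  contDiffAt_omega_iff_analyticAt.1
    (hf.contDiffAt ((isOpen_splitDomain S.hH P).mem_nhds S.zero_mem_splitDomain))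

theorem analyticAt_splitMap (S : MixSetup M w t P) : AnalyticAt ℝ (splitMap S.hH S.hH0 P) 0 :=
  S.analyticAt_of_contDiffOn S.unimodularCoords.contDiffOn_Ψ

theorem splitMap_zero (S : MixSetup M w t P) : splitMap S.hH S.hH0 P 0 = P :=
  S.unimodularCoords.Ψ_zero

theorem tendsto_splitMap (S : MixSetup M w t P) :
    Filter.Tendsto (splitMap S.hH S.hH0 P) (𝓝 0) (𝓝 P) := by
  simpa only [ContinuousAt, S.splitMap_zero] using S.analyticAt_splitMap.continuousAt

/-- Every location coordinate is linear or quadratic: one linear factor suffices, and otherwise both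
are quadratic. -/
theorem coord_mul_coord_inQuadIdeal (i k : Fin H) :
    InQuadIdeal (linIdx H H0) (sqIdx H H0)
      fun x : MixParam H => x (Sum.inl i) * x (Sum.inl k) := by
  have han : ∀ i : Fin H, AnalyticAt ℝ (fun x : MixParam H => x (Sum.inl i)) 0 := fun i =>
    contDiffAt_omega_iff_analyticAt.1 (by fun_prop)
  by_cases hk : Sum.inl k ∈ linIdx H H0
  · exact InQuadIdeal.mul_left (han i) (InQuadIdeal.coord hk)
  by_cases hi : Sum.inl i ∈ linIdx H H0
  · exact (InQuadIdeal.mul_left (han k) (InQuadIdeal.coord hi)).congr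
      (Filter.Eventually.of_forall fun x => mul_comm _ _)
  rw [mem_linIdx_inl, not_not] at hi hk
  exact InQuadIdeal.coord_mul_coord (mem_sqIdx_inl.2 hi) (mem_sqIdx_inl.2 hk)

theorem sq_inQuadIdeal (S : MixSetup M w t P) (i : Fin H) :
    InQuadIdeal (linIdx H H0) (sqIdx H H0) fun x : MixParam H =>
      (splitMap S.hH S.hH0 P x (Sum.inl i) - t (clusterIdx S.hH0 i)) ^ 2 := by
  have han : ∀ k, AnalyticAt ℝ (thetaCoeff S.hH S.hH0 P i k) 0 := fun k =>
    S.analyticAt_of_contDiffOn (contDiffOn_thetaCoeff S.hH S.hH0 P i k)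
  refine (InQuadIdeal.sum Finset.univ fun k _ => InQuadIdeal.sum Finset.univ fun l _ =>
    InQuadIdeal.mul_left ((han k).mul (han l)) (coord_mul_coord_inQuadIdeal k l)).congr
    (Filter.Eventually.of_forall fun x => ?_)
  rw [S.splitMap_inl_sub, sq, Finset.sum_mul_sum]
  refine Finset.sum_congr rfl fun k _ => Finset.sum_congr rfl fun l _ => ?_
  rw [Pi.mul_apply]
  ring

theorem momentDefect_inQuadIdeal (S : MixSetup M w t P) (j : Fin H0) :
    InQuadIdeal (linIdx H H0) (sqIdx H H0)
      fun x => momentDefect S.hH0 t j (splitMap S.hH S.hH0 P x) := by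
  refine (InQuadIdeal.mul_left (contDiffAt_omega_iff_analyticAt.1
    (contDiff_mixWeight_add P (clusterRep S.hH S.hH0H j)).contDiffAt)
    (InQuadIdeal.coord (S.clusterRep_mem j))).congr ?_
  filter_upwards [(isOpen_splitDomain S.hH P).mem_nhds S.zero_mem_splitDomain] with x hx
  exact S.momentDefect_splitMap (ne_of_gt hx) j

/-- The first H0 - 1 defects are coordinates, and the last is minus their sum. -/
theorem massDefect_inQuadIdeal (S : MixSetup M w t P) (j : Fin H0) :
    InQuadIdeal (linIdx H H0) (sqIdx H H0)
      fun x => massDefect S.hH0 w j (splitMap S.hH S.hH0 P x) := by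
  have hlt : ∀ j : Fin H0, (j : ℕ) < H0 - 1 → InQuadIdeal (linIdx H H0) (sqIdx H H0)
      fun x => massDefect S.hH0 w j (splitMap S.hH S.hH0 P x) := fun j hj => by
    have h1 := S.hH0H
    have h2 : (⟨j, by omega⟩ : Fin (H - 1)).1 < H0 - 1 := hj
    exact (InQuadIdeal.coord (mem_linIdx_inr.2 h2)).congr
      (Filter.Eventually.of_forall fun x => S.massDefect_splitMap x rfl h2)
  by_cases hj : (j : ℕ) < H0 - 1
  · exact hlt j hj
  · refine (InQuadIdeal.mul_left (g := fun _ => -1) analyticAt_const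
      (InQuadIdeal.sum (Finset.univ.erase j) fun k hk => hlt k ?_)).congr
      (Filter.Eventually.of_forall fun x => ?_)
    · have := Fin.val_ne_of_ne (Finset.ne_of_mem_erase hk)
      omega
    · have h1 := sum_massDefect S.hH0 (by linarith [S.hH]) S.sum_w (splitMap S.hH S.hH0 P x)
      rw [← Finset.add_sum_erase _ _ (Finset.mem_univ j)] at h1
      linarith

/-- All three kinds of terms in the Taylor expansion, namely masses, moments and squared
displacements with analytic coefficients, belong to the ideal. -/
theorem mixDiff_inQuadIdeal (S : MixSetup M w t P) (f : ℝ[X]) :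
    InQuadIdeal (linIdx H H0) (sqIdx H H0)
      fun x => mixDiff w t f (splitMap S.hH S.hH0 P x) := by
  obtain ⟨R, hR⟩ := exists_mixDiff_eq (H := H) S.hH0 w t f
  refine InQuadIdeal.congr (InQuadIdeal.add
    (InQuadIdeal.sum Finset.univ fun j _ => InQuadIdeal.add
      (InQuadIdeal.mul_left (g := fun _ => f.eval (t j)) analyticAt_const
        (S.massDefect_inQuadIdeal j))
      (InQuadIdeal.mul_left (g := fun _ => (derivative f).eval (t j)) analyticAt_const
        (S.momentDefect_inQuadIdeal j)))
    (InQuadIdeal.sum Finset.univ fun i _ => InQuadIdeal.mul_left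
      (g := fun x => mixWeight (splitMap S.hH S.hH0 P x) i *
        (R (clusterIdx S.hH0 i)).eval (splitMap S.hH S.hH0 P x (Sum.inl i)))
      (AnalyticAt.mul ?_ ?_) (S.sq_inQuadIdeal i)))
    (Filter.Eventually.of_forall fun x => hR _)
  · simp only [mixWeight_splitMap]
    exact contDiffAt_omega_iff_analyticAt.1 (contDiff_mixWeight_add P i).contDiffAt
  · have h1 : AnalyticAt ℝ (fun x => splitMap S.hH S.hH0 P x (Sum.inl i)) 0 :=
      ((ContinuousLinearMap.proj (R := ℝ) (φ := fun _ : Fin H ⊕ Fin (H - 1) => ℝ)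
        (Sum.inl i)).analyticAt _).comp S.analyticAt_splitMap
    simpa only [coe_aeval_eq_eval] using h1.aeval_polynomial (R (clusterIdx S.hH0 i))

/-- A linear coordinate is either the mass defect of a singleton cluster or a first moment divided
by a weight that is nonzero near P. -/
theorem linCoord_isBigO (S : MixSetup M w t P)
    (hq : ∀ x, q x = ∑ j, w j * binomialProb M x (t j)) {i : Fin H ⊕ Fin (H - 1)}
    (hi : i ∈ linIdx H H0) :
    (fun x : MixParam H => x i) =O[𝓝 0] fun x => probDist M q (splitMap S.hH S.hH0 P x) := by
  obtain i | i := i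
  · obtain ⟨j, rfl⟩ : ∃ j, i = clusterRep S.hH S.hH0H j := by
      rw [mem_linIdx_inl] at hi
      have h1 := S.hH0
      by_cases h : (i : ℕ) < H0 - 1
      · exact ⟨⟨i, by omega⟩, by rw [clusterRep, if_pos h]⟩
      · refine ⟨⟨H0 - 1, by omega⟩, ?_⟩
        rw [clusterRep, if_neg (lt_irrefl _)]
        ext; simp only [lastIdx]; omega
    have h1 := (S.momentDefect_isBigO hq j).comp_tendsto S.tendsto_splitMap
    have h0 : mixWeight (P + 0) (clusterRep S.hH S.hH0H j) ≠ 0 := by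
      rw [add_zero]; exact (mixWeight_pos S.split _).ne'
    have hc := (contDiff_mixWeight_add P (clusterRep S.hH S.hH0H j)).continuous.continuousAt
      (x := 0)
    refine (isBigO_continuous_mul (hc.inv₀ h0) h1).congr' ?_ Filter.EventuallyEq.rfl
    filter_upwards [hc.eventually_ne h0,
      (isOpen_splitDomain S.hH P).mem_nhds S.zero_mem_splitDomain] with x hx hx'
    rw [Function.comp_apply, S.momentDefect_splitMap (ne_of_gt hx'), Pi.inv_apply, ← mul_assoc,
      inv_mul_cancel₀ hx, one_mul]
  · have hi' := mem_linIdx_inr.1 hi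
    refine ((S.massDefect_isBigO hq ⟨i, by omega⟩).comp_tendsto S.tendsto_splitMap).congr_left
      fun x => S.massDefect_splitMap x rfl hi'

/-- The sheared location is not among these coordinates, so each one is an actual displacement and
the squared bound applies directly. -/
theorem sqCoord_isBigO (S : MixSetup M w t P)
    (hq : ∀ x, q x = ∑ j, w j * binomialProb M x (t j)) {i : Fin H ⊕ Fin (H - 1)}
    (hi : i ∈ sqIdx H H0) : (fun x : MixParam H => x i ^ 2) =O[𝓝 0]
      fun x => probDist M q (splitMap S.hH S.hH0 P x) := by
  obtain i | i := i
  · have h1 : i ≠ lastIdx S.hH := by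
      have := mem_sqIdx_inl.1 hi
      rintro rfl
      simp [lastIdx] at this
    refine ((S.sq_isBigO hq i).comp_tendsto S.tendsto_splitMap).congr_left fun x => ?_
    rw [Function.comp_apply, splitMap_inl _ _ _ _ h1, S.theta_eq, add_sub_cancel_left]
  · simp [sqIdx] at hi

theorem eventually_mixModel_bounds (S : MixSetup M w t P)
    (hq : ∀ x, q x = ∑ j, w j * binomialProb M x (t j)) (hq_pos : ∀ x, 0 < q x) :
    ∀ᶠ v in 𝓝 P, ∀ x, 0 < mixModel M H x v ∧ mixModel M H x v ≤ 4 * q x := by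
  refine Filter.eventually_all.2 fun x => ?_
  have hP : (fun v => mixModel M H x v) P = q x := S.mixModel_eq hq (fun _ => rfl) (fun _ _ => rfl) x
  have hc := (contDiff_mixModel (H := H) x).continuous.continuousAt (x := P)
  have h0 := hq_pos x
  filter_upwards [hc.eventually (Ioo_mem_nhds (a := 0) (b := 4 * q x)
    (by rw [hP]; exact h0) (by rw [hP]; linarith))] with v hv
  exact ⟨hv.1, hv.2.le⟩

theorem exists_lower_bound (S : MixSetup M w t P)
    (hq : ∀ x, q x = ∑ j, w j * binomialProb M x (t j)) (hq_pos : ∀ x, 0 < q x) :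
    ∃ b > 0, ∀ᶠ x in 𝓝 (0 : MixParam H),
      b * (∑ i ∈ linIdx H H0, x i ^ 2 + ∑ i ∈ sqIdx H H0, x i ^ 4) ≤
        klMix M H q (splitMap S.hH S.hH0 P x) := by
  have h1 : (fun x : MixParam H => ∑ i ∈ linIdx H H0, x i ^ 2 + ∑ i ∈ sqIdx H H0, x i ^ 4)
      =O[𝓝 0] fun x => probDist M q (splitMap S.hH S.hH0 P x) ^ 2 := by
    refine (IsBigO.fun_sum fun i hi => (S.linCoord_isBigO hq hi).pow 2).add
      (IsBigO.fun_sum fun i hi => ?_)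
    refine ((S.sqCoord_isBigO hq hi).pow 2).congr_left fun x => ?_
    rw [← pow_mul]
  obtain ⟨C, hC, h2⟩ := h1.exists_pos
  -- C compares the normal form with the squared distance of the probabilities; 9 * (M + 1) compares
  -- that squared distance with K.
  refine ⟨(C * (9 * (M + 1)))⁻¹, by positivity, ?_⟩
  filter_upwards [h2.bound, S.tendsto_splitMap.eventually (S.eventually_mixModel_bounds hq hq_pos)]
    with x hx hb
  have h3 := probDist_sq_le_klMix (by linarith [S.hH]) hq_pos (S.sum_eq_one hq)
    (fun y => (hb y).1) (fun y => (hb y).2)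
  rw [inv_mul_le_iff₀ (by positivity), mul_assoc]
  refine (le_abs_self _).trans (hx.trans (mul_le_mul_of_nonneg_left ?_ hC.le))
  rwa [Real.norm_of_nonneg (sq_nonneg _)]

/-- The threshold of the Kullback-Leibler divergence at a split point. -/
theorem hasRLCTAt_klMix (S : MixSetup M w t P)
    (hq : ∀ x, q x = ∑ j, w j * binomialProb M x (t j)) (hq_pos : ∀ x, 0 < q x) :
    HasRLCTAt (klMix M H q) P (ENNReal.ofReal ((3 * (H0 : ℝ) + (H : ℝ) - 2) / 4)) 1 := by
  have hH0 := S.hH0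
  obtain ⟨ψ, hψa, hψ⟩ := exists_log_one_add_eq
  obtain ⟨b, hb, hlow⟩ := S.exists_lower_bound hq hq_pos
  have hd : ∀ x, InQuadIdeal (linIdx H H0) (sqIdx H H0)
      fun y => mixModel M H x (splitMap S.hH S.hH0 P y) - q x := fun x => by
    simpa only [mixModel_sub_eq_mixDiff hq] using S.mixDiff_inQuadIdeal _
  have hda : ∀ x, AnalyticAt ℝ (fun y => mixModel M H x (splitMap S.hH S.hH0 P y) - q x) 0 :=
    fun x => ((contDiffAt_omega_iff_analyticAt.1 (contDiff_mixModel x).contDiffAt).comp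
      S.analyticAt_splitMap).sub analyticAt_const
  have hcard : (2 * ((linIdx H H0).card : ℝ) + (sqIdx H H0).card) / 4 =
      (3 * (H0 : ℝ) + (H : ℝ) - 2) / 4 := by
    rw [card_linIdx hH0 S.hH0H, card_sqIdx hH0 S.hH0H, Nat.cast_sub (by omega),
      Nat.cast_sub S.hH0H]
    push_cast
    ring
  rw [← hcard]
  refine hasRLCTAt_of_quadIdeal disjoint_linIdx_sqIdx
    (Finset.card_pos.1 (by rw [card_linIdx hH0 S.hH0H]; omega)) S.unimodularCoords
    (e := fun x y => (q x)⁻¹ * ψ ((mixModel M H x (splitMap S.hH S.hH0 P y) - q x) / q x))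
    hd (fun x => analyticAt_const.mul (hψa.comp_of_eq ((hda x).div analyticAt_const
      (hq_pos x).ne') ?_)) ?_ hb hlow
  -- At the split point the argument of ψ is 0, where ψ is analytic.
  · rw [S.splitMap_zero, S.mixModel_eq hq (fun _ => rfl) (fun _ _ => rfl), sub_self, zero_div]
  · filter_upwards [S.tendsto_splitMap.eventually (S.eventually_mixModel_bounds hq hq_pos)]
      with y hy
    exact klMix_eq_sum_sq hψ (by linarith [S.hH]) hq_pos (S.sum_eq_one hq) fun x => (hy x).1

end MixSetup

end SplitThreshold

theorem rlctAt_le_of_hasRLCTAt {ι : Type} [Fintype ι] {F : (ι → ℝ) → ℝ} {P : ι → ℝ} {lam : ℝ≥0∞}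
    {m : ℕ∞} (h : HasRLCTAt F P lam m) : rlctAt F P ≤ lam := by
  obtain ⟨⟨R⟩, hR⟩ := h
  exact (iInf_le _ R).trans (hR R).1.le

theorem mainTheorem3 (M H H0 : ℕ) (hM : 2 ≤ M) (hH : 2 ≤ H)
    (hH0 : 1 ≤ H0) (hH0H : H0 ≤ H) (hH0M : 2 * H0 ≤ M)
    (w t : Fin H0 → ℝ) (hw : ∀ j, 0 < w j) (hw1 : ∑ j, w j = 1)
    (ht : ∀ j, t j ∈ Set.Icc (0 : ℝ) 1) (ht_inj : Function.Injective t)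
    (q : Fin (M + 1) → ℝ) (hq : ∀ x, q x = ∑ j, w j * binomialProb M x (t j))
    (hq_pos : ∀ x, 0 < q x) :
    learningCoefficient M H q ≤ ENNReal.ofReal ((3 * (H0 : ℝ) + (H : ℝ) - 2) / 4) ∧
    (∃ P : MixParam H, IsSplitPoint w t P) ∧
    ∀ P : MixParam H, IsSplitPoint w t P →
      P ∈ realizable M H q ∧
      (∀ᶠ v in 𝓝 P, (∀ x, mixModel M H x v = q x) ↔
        (∀ i : Fin H, v (Sum.inl i) = P (Sum.inl i)) ∧
        (∀ i : Fin (H - 1), (i : ℕ) < H0 - 1 → v (Sum.inr i) = P (Sum.inr i))) ∧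
      HasRLCTAt (klMix M H q) P (ENNReal.ofReal ((3 * (H0 : ℝ) + (H : ℝ) - 2) / 4)) 1 := by
  have hS : ∀ P : MixParam H, IsSplitPoint w t P → MixSetup M w t P := fun P hP =>
    ⟨hH, hH0, hH0H, hH0M, hw1, ht_inj, hP⟩
  obtain ⟨P, hP⟩ := exists_isSplitPoint hH hH0 hH0H t hw hw1
  refine ⟨?_, ⟨P, hP⟩, fun P hP => ⟨(hS P hP).mem_realizable hq ht,
    (hS P hP).eventually_solution_iff hq, (hS P hP).hasRLCTAt_klMix hq hq_pos⟩⟩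
  exact (iInf₂_le P ((hS P hP).mem_realizable hq ht)).trans
    (rlctAt_le_of_hasRLCTAt ((hS P hP).hasRLCTAt_klMix hq hq_pos))
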